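/- Let $\Bbbk$ be a commutative ring of characteristic not equal to $2$, let $z \in \Bbbk$, and let $1 \le i \le r$ be integers. **Conventions.** Supercategories are enriched in $\Bbbk$-supermodules. In a strict monoidal supercategory $(f'\otimes g)\circ(f\otimes g')=(-1)^{|f||g|}(f'\circ f)\otimes(g\circ g')$ for homogeneous $f,g$. Diagrams are read from bottom to top, and $X$ also denotes $1_X$. $\mathcal{SE}nd(\mathcal A)$ is the strict monoidal supercategory of endosuperfunctors of $\mathcal A$ and supernatural transformations. **The supercategory $\mathcal Q(z)$.** The *quantum isomeric supercategory* $\mathcal Q(z)$ is the strict monoidal supercategory generated by objects $\uparrow,\downarrow$ and morphisms $\sigma_+,\sigma_-\colon \uparrow\otimes\uparrow\to\uparrow\otimes\uparrow$ (the positive crossing, in which the strand from bottom left to top right is over, and the negative crossing, in which it is under), $\rho\colon\uparrow\otimes\downarrow\to\downarrow\otimes\uparrow$ (the right crossing in which the upward strand is over), $\mathrm{cap}\colon\downarrow\otimes\uparrow\to\mathbf 1$, $\mathrm{cup}\colon\mathbf 1\to\uparrow\otimes\downarrow$, all even, and an odd $c\colon\uparrow\to\uparrow$ (the *closed Clifford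 token*). Put $\lambda(\sigma)=(\mathrm{cap}\otimes\uparrow\otimes\downarrow)\circ(\downarrow\otimes\,\sigma\otimes\downarrow)\circ(\downarrow\otimes\uparrow\otimes\,\mathrm{cup})\colon\downarrow\otimes\uparrow\to\uparrow\otimes\downarrow$ for $\sigma=\sigma_\pm$, and $\mathrm{cap}'=\mathrm{cap}\circ\rho$. The relations are: * $\sigma_-\sigma_+=1=\sigma_+\sigma_-$; $\rho$ and $\lambda(\sigma_+)$ are mutually inverse; $(\sigma_+\otimes\uparrow)(\uparrow\otimes\,\sigma_+)(\sigma_+\otimes\uparrow)=(\uparrow\otimes\,\sigma_+)(\sigma_+\otimes\uparrow)(\uparrow\otimes\,\sigma_+)$; $\sigma_+-\sigma_-=z\cdot 1$; * $c^2=-1$; $\sigma_+\circ(c\otimes\uparrow)=(\uparrow\otimes\, c)\circ\sigma_+$; $\mathrm{cap}'\circ(c\otimes\downarrow)\circ\mathrm{cup}=0=\mathrm{cap}'\circ\mathrm{cup}$; * $(\uparrow\otimes\,\mathrm{cap})\circ(\mathrm{cup}\,\otimes\uparrow)=1_\uparrow$ and $(\mathrm{cap}\,\otimes\downarrow)\circ(\downarrow\otimes\,\mathrm{cup})=1_\downarrow$.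 **The supercategory $\mathcal{AQ}(z)$.** The *quantum affine isomeric supercategory* $\mathcal{AQ}(z)$ is obtained from $\mathcal Q(z)$ by adjoining one further odd generator $o\colon\uparrow\to\uparrow$ (the *open Clifford token*) and the relations $o^2=-1$, $\sigma_+\circ(\uparrow\otimes\, o)=(o\,\otimes\uparrow)\circ\sigma_+$, $\mathrm{cap}'\circ(o\otimes\downarrow)\circ\mathrm{cup}=0$. The *zebra* is $c\circ o\colon\uparrow\to\uparrow$. There is an evident monoidal superfunctor $\mathcal Q(z)\to\mathcal{AQ}(z)$ that is the identity on objects and on diagrams. **The superfunctors $\mathbf C$ and $\mathrm{Ev}_{\mathbf 1}$.** The *collapsing superfunctor* is the monoidal superfunctor $\mathbf C\colon\mathcal{AQ}(z)\to\mathcal{SE}nd(\mathcal Q(z))$ with $\mathbf C(X)=X\otimes-$ on objects, $\mathbf C(f)=f\otimes-$ for the generators $f$ of $\mathcal Q(z)$, and $$\mathbf C(o)_X=\beta_X^{-1}\circ(X\otimes c)\circ\beta_X\colon\ \uparrow\otimes X\to\uparrow\otimes X,$$ where $\beta_X\colon\uparrow\otimes X\to X\otimes\uparrow$ is the crossing in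 which the strand $\uparrow$ passes under all the strands of $X$. Explicitly, $\beta_{\mathbf 1}=1_\uparrow$ and $\beta_{a\otimes X}=(a\otimes\beta_X)\circ(\beta_a\otimes X)$ for $a\in\{\uparrow,\downarrow\}$, with $\beta_\uparrow=\sigma_-$ and $\beta_\downarrow=\lambda(\sigma_-)^{-1}=\rho+z\,(\rho\circ\mathrm{cup})\circ\mathrm{cap}'$. Let $\mathrm{Ev}_{\mathbf 1}\colon\mathcal{SE}nd(\mathcal Q(z))\to\mathcal Q(z)$ be evaluation on the unit object. **The superalgebras.** The *Hecke–Clifford superalgebra* $\mathrm{HC}_r(z)$ is the $\Bbbk$-superalgebra generated by even $t_1,\dots,t_{r-1}$ and odd $c_1,\dots,c_r$ subject to $t_j^2=zt_j+1$, $t_jt_{j+1}t_j=t_{j+1}t_jt_{j+1}$, $t_jt_l=t_lt_j$ for $|j-l|>1$, $c_j^2=-1$, $c_jc_l=-c_lc_j$ for $j\ne l$, $t_jc_j=c_{j+1}t_j$, and $t_jc_l=c_lt_j$ for $l\neq j,j+1$. The *affine Hecke–Clifford superalgebra* $\mathrm{AHC}_r(z)$ is generated by $\mathrm{HC}_r(z)$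 and odd elements $\varpi_1,\dots,\varpi_r$ subject to $\varpi_j^2=-1$, $\varpi_j\varpi_l=-\varpi_l\varpi_j$ for $j\neq l$, $t_j\varpi_{j+1}=\varpi_jt_j$, and $t_j\varpi_l=\varpi_lt_j$ for $l\ne j,j+1$. Let $$\imath_r\colon\mathrm{AHC}_r(z)\to\mathrm{End}_{\mathcal{AQ}(z)}(\uparrow^{\otimes r})$$ be the homomorphism of superalgebras with $t_j\mapsto-\uparrow^{\otimes(r-j-1)}\otimes\,\sigma_-\otimes\uparrow^{\otimes(j-1)}$, $c_j\mapsto\uparrow^{\otimes(r-j)}\otimes\, c\,\otimes\uparrow^{\otimes(j-1)}$, $\varpi_j\mapsto\uparrow^{\otimes(r-j)}\otimes\, o\,\otimes\uparrow^{\otimes(j-1)}$. The first two formulas also define $\imath_r\colon\mathrm{HC}_r(z)\to\mathrm{End}_{\mathcal Q(z)}(\uparrow^{\otimes r})$. The *Jucys–Murphy elements* are $J_1=1$ and $J_j=(t_{j-1}-zc_{j-1}c_j)J_{j-1}t_{j-1}$ for $2\le j\le r$. The *odd Jucys–Murphy elements* are $J_j^{\mathrm{odd}}=t_{j-1}^{-1}\cdots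 t_1^{-1}c_1t_1\cdots t_{j-1}$ for $1\le j\le r$, so that $J_1^{\mathrm{odd}}=c_1$. They are given by the same formulas in $\mathrm{HC}_r(z)$ and in $\mathrm{AHC}_r(z)$. **Statement.** In $\mathrm{End}_{\mathcal Q(z)}(\uparrow^{\otimes r})$, $$\mathrm{Ev}_{\mathbf 1}\circ\mathbf C\bigl(\uparrow^{\otimes(r-i)}\otimes\, o\,\otimes\uparrow^{\otimes(i-1)}\bigr)=\imath_r(J_i^{\mathrm{odd}}),\qquad \mathrm{Ev}_{\mathbf 1}\circ\mathbf C\bigl(\uparrow^{\otimes(r-i)}\otimes(c\circ o)\otimes\uparrow^{\otimes(i-1)}\bigr)=-\imath_r(J_i).$$ The same two equalities hold in $\mathrm{End}_{\mathcal{AQ}(z)}(\uparrow^{\otimes r})$ after applying $\mathcal Q(z)\to\mathcal{AQ}(z)$ to the left-hand sides. Moreover $J_i=-c_iJ_i^{\mathrm{odd}}$ in $\mathrm{HC}_r(z)$ and in $\mathrm{AHC}_r(z)$. -/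

import Mathlib

open CategoryTheory

namespace Isomeric

universe u v w

/-- The sign `(-1) ^ (p q)` attached to two parities. -/
def sgn (k : Type u) [CommRing k] (p q : ZMod 2) : k := (-1) ^ (p.val * q.val)

/-- A supercategory: a category enriched in `k`-supermodules.  Every morphism module is the
internal direct sum of its even and its odd part, identities are even, and composition is
bilinear and adds parities. -/
class Supercategory (k : Type u) [CommRing k] (C : Type w) [Category.{v} C] [Preadditive C]
    [Linear k C] where
  parity (X Y : C) : ZMod 2 → Submodule k (X ⟶ Y)
  isCompl_parity (X Y : C) : IsCompl (parity X Y 0) (parity X Y 1)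
  id_mem (X : C) : 𝟙 X ∈ parity X X 0
  comp_mem {X Y Z : C} {p q : ZMod 2} {f : X ⟶ Y} {g : Y ⟶ Z} :
    f ∈ parity X Y p → g ∈ parity Y Z q → f ≫ g ∈ parity X Z (p + q)

/-- A strict monoidal supercategory.  The objects form a monoid, and associativity and unitality
of the tensor product of morphisms hold up to the identifications of objects given by the
monoid laws.  As `f ≫ g` is `g ∘ f`, the field `interchange` is the super interchange law
`(f' ⊗ g) ∘ (f ⊗ g') = (-1) ^ (|f| |g|) (f' ∘ f) ⊗ (g ∘ g')`. -/
class StrictMonoidalSupercategory (k : Type u) [CommRing k] (C : Type w) [Category.{v} C]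
    [Preadditive C] [Linear k C] [Supercategory k C] [Monoid C] where
  tensor {X Y X' Y' : C} : (X ⟶ Y) → (X' ⟶ Y') → (X * X' ⟶ Y * Y')
  add_tensor {X Y X' Y' : C} (f g : X ⟶ Y) (h : X' ⟶ Y') :
    tensor (f + g) h = tensor f h + tensor g h
  tensor_add {X Y X' Y' : C} (f : X ⟶ Y) (g h : X' ⟶ Y') :
    tensor f (g + h) = tensor f g + tensor f h
  smul_tensor {X Y X' Y' : C} (a : k) (f : X ⟶ Y) (g : X' ⟶ Y') :
    tensor (a • f) g = a • tensor f g
  tensor_smul {X Y X' Y' : C} (a : k) (f : X ⟶ Y) (g : X' ⟶ Y') :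
    tensor f (a • g) = a • tensor f g
  tensor_mem {X Y X' Y' : C} {p q : ZMod 2} {f : X ⟶ Y} {g : X' ⟶ Y'} :
    f ∈ Supercategory.parity (k := k) X Y p → g ∈ Supercategory.parity (k := k) X' Y' q →
      tensor f g ∈ Supercategory.parity (k := k) (X * X') (Y * Y') (p + q)
  tensor_id (X Y : C) : tensor (𝟙 X) (𝟙 Y) = 𝟙 (X * Y)
  interchange {X Y Z X' Y' Z' : C} {p q : ZMod 2} {f : X ⟶ Y} {g : Y' ⟶ Z'} (f' : Y ⟶ Z)
    (g' : X' ⟶ Y') (hf : f ∈ Supercategory.parity (k := k) X Y p)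
    (hg : g ∈ Supercategory.parity (k := k) Y' Z' q) :
    tensor f g' ≫ tensor f' g = sgn k p q • tensor (f ≫ f') (g' ≫ g)
  tensor_assoc {X Y X' Y' X'' Y'' : C} (f : X ⟶ Y) (g : X' ⟶ Y') (h : X'' ⟶ Y'') :
    tensor (tensor f g) h = eqToHom (mul_assoc X X' X'') ≫ tensor f (tensor g h) ≫
      eqToHom (mul_assoc Y Y' Y'').symm
  one_tensor {X Y : C} (f : X ⟶ Y) :
    tensor (𝟙 1) f = eqToHom (one_mul X) ≫ f ≫ eqToHom (one_mul Y).symm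
  tensor_one {X Y : C} (f : X ⟶ Y) :
    tensor f (𝟙 1) = eqToHom (mul_one X) ≫ f ≫ eqToHom (mul_one Y).symm

/-- A superfunctor: a functor that is `k`-linear and preserves parity on morphisms. -/
@[ext]
structure Superfunctor (k : Type u) [CommRing k] (C : Type*) [Category C] [Preadditive C]
    [Linear k C] [Supercategory k C] (D : Type*) [Category D] [Preadditive D] [Linear k D]
    [Supercategory k D] extends C ⥤ D where
  map_add {X Y : C} (f g : X ⟶ Y) : map (f + g) = map f + map g
  map_smul {X Y : C} (a : k) (f : X ⟶ Y) : map (a • f) = a • map f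
  map_mem {X Y : C} {p : ZMod 2} {f : X ⟶ Y} :
    f ∈ Supercategory.parity (k := k) X Y p →
      map f ∈ Supercategory.parity (k := k) (obj X) (obj Y) p

/-- A (strict) monoidal superfunctor between strict monoidal supercategories. -/
@[ext]
structure MonoidalSuperfunctor (k : Type u) [CommRing k] (C : Type*) [Category C]
    [Preadditive C] [Linear k C] [Supercategory k C] [Monoid C] [StrictMonoidalSupercategory k C]
    (D : Type*) [Category D] [Preadditive D] [Linear k D] [Supercategory k D] [Monoid D]
    [StrictMonoidalSupercategory k D] extends Superfunctor k C D where
  obj_one : obj 1 = 1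
  obj_mul (X Y : C) : obj (X * Y) = obj X * obj Y
  map_tensor {X Y X' Y' : C} (f : X ⟶ Y) (g : X' ⟶ Y') :
    map (StrictMonoidalSupercategory.tensor k f g) = eqToHom (obj_mul X X') ≫
      StrictMonoidalSupercategory.tensor k (map f) (map g) ≫ eqToHom (obj_mul Y Y').symm

open StrictMonoidalSupercategory

/-! ### The strict monoidal supercategory of endosuperfunctors -/

/-- Endosuperfunctors of a supercategory. -/
abbrev SEnd (k : Type u) [CommRing k] (C : Type w) [Category.{v} C] [Preadditive C] [Linear k C]
    [Supercategory k C] := Superfunctor k C C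

section SEnd

variable {k : Type u} [CommRing k] {C : Type w} [Category.{v} C] [Preadditive C] [Linear k C]
  [Supercategory k C]

theorem Superfunctor.map_zero (F : SEnd k C) (X Y : C) : F.map (0 : X ⟶ Y) = 0 := by
  have := F.map_smul (0 : k) (0 : X ⟶ Y); simpa using this

/-- Supernatural transformations of parity `p`: families of morphisms `α X` of parity `p` such
that `G f ∘ α X = (-1) ^ (p |f|) α Y ∘ F f` for homogeneous `f`. -/
def supernat (F G : SEnd k C) (p : ZMod 2) : Submodule k (∀ X, F.obj X ⟶ G.obj X) where
  carrier := {α | (∀ X, α X ∈ Supercategory.parity (k := k) (F.obj X) (G.obj X) p) ∧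
    ∀ ⦃X Y : C⦄ ⦃q : ZMod 2⦄ ⦃f : X ⟶ Y⦄, f ∈ Supercategory.parity (k := k) X Y q →
      α X ≫ G.map f = sgn k p q • (F.map f ≫ α Y)}
  add_mem' := by
    rintro α β ⟨h1, h2⟩ ⟨h3, h4⟩
    exact ⟨fun X => add_mem (h1 X) (h3 X), fun X Y q f hf => by
      simp [h2 hf, h4 hf]⟩
  zero_mem' := ⟨fun X => zero_mem _, fun X Y q f hf => by simp⟩
  smul_mem' := by
    rintro a α ⟨h1, h2⟩
    exact ⟨fun X => Submodule.smul_mem _ a (h1 X), fun X Y q f hf => by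
      simp [h2 hf, smul_smul, mul_comm]⟩

/-- Supernatural transformations: sums of an even and an odd one. -/
def supernatAll (F G : SEnd k C) : Submodule k (∀ X, F.obj X ⟶ G.obj X) :=
  supernat F G 0 ⊔ supernat F G 1

theorem supernat_le (F G : SEnd k C) (p : ZMod 2) : supernat F G p ≤ supernatAll F G := by
  fin_cases p
  · exact le_sup_left
  · exact le_sup_right

theorem sgn_zero_left (q : ZMod 2) : sgn k 0 q = 1 := by simp [sgn]
theorem sgn_zero_right (q : ZMod 2) : sgn k q 0 = 1 := by simp [sgn]

theorem sgn_add_left (p p' q : ZMod 2) : sgn k (p + p') q = sgn k p q * sgn k p' q := by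
  have h : ∀ p p' q : ZMod 2,
      ((p + p').val * q.val) % 2 = (p.val * q.val + p'.val * q.val) % 2 := by decide
  rw [sgn, sgn, sgn, ← pow_add, neg_one_pow_eq_pow_mod_two, h, ← neg_one_pow_eq_pow_mod_two]

theorem sgn_comm (p q : ZMod 2) : sgn k p q = sgn k q p := by
  rw [sgn, sgn, mul_comm]

theorem sgn_mul_self (p q : ZMod 2) : sgn k p q * sgn k p q = 1 := by
  rw [sgn, ← mul_pow]; simp

/-- Composition of families of morphisms. -/
theorem supernat_comp {F G H : SEnd k C} {p q : ZMod 2} {α : ∀ X, F.obj X ⟶ G.obj X}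
    {β : ∀ X, G.obj X ⟶ H.obj X} (hα : α ∈ supernat F G p) (hβ : β ∈ supernat G H q) :
    (fun X => α X ≫ β X) ∈ supernat F H (p + q) := by
  refine ⟨fun X => Supercategory.comp_mem (hα.1 X) (hβ.1 X), fun X Y r f hf => ?_⟩
  simp only [Category.assoc, hβ.2 hf, Linear.comp_smul]
  rw [← Category.assoc, hα.2 hf, Linear.smul_comp, smul_smul, sgn_add_left, mul_comm,
    Category.assoc]

theorem supernatAll_comp {F G H : SEnd k C} {α : ∀ X, F.obj X ⟶ G.obj X}
    {β : ∀ X, G.obj X ⟶ H.obj X} (hα : α ∈ supernatAll F G) (hβ : β ∈ supernatAll G H) :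
    (fun X => α X ≫ β X) ∈ supernatAll F H := by
  obtain ⟨a, ha, a', ha', rfl⟩ := Submodule.mem_sup.1 hα
  obtain ⟨b, hb, b', hb', rfl⟩ := Submodule.mem_sup.1 hβ
  have : (fun X => (a + a') X ≫ (b + b') X) = (fun X => a X ≫ b X) + (fun X => a X ≫ b' X) +
      (fun X => a' X ≫ b X) + (fun X => a' X ≫ b' X) := by
    funext X; simp; abel
  rw [this]
  exact add_mem (add_mem (add_mem (supernat_le _ _ _ (supernat_comp ha hb))
    (supernat_le _ _ _ (supernat_comp ha hb'))) (supernat_le _ _ _ (supernat_comp ha' hb)))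
    (supernat_le _ _ _ (supernat_comp ha' hb'))

theorem supernat_id (F : SEnd k C) : (fun X => 𝟙 (F.obj X)) ∈ supernat F F 0 :=
  ⟨fun X => Supercategory.id_mem _, fun X Y q f _ => by simp [sgn_zero_left]⟩

instance : Monoid (SEnd k C) where
  one :=
    { toFunctor := 𝟭 C
      map_add := fun _ _ => rfl
      map_smul := fun _ _ => rfl
      map_mem := fun h => h }
  mul F G :=
    { toFunctor := G.toFunctor ⋙ F.toFunctor
      map_add := fun f g => by simp [G.map_add, F.map_add]
      map_smul := fun a f => by simp [G.map_smul, F.map_smul]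
      map_mem := fun h => F.map_mem (G.map_mem h) }
  mul_assoc _ _ _ := rfl
  one_mul _ := rfl
  mul_one _ := rfl

instance : Category (SEnd k C) where
  Hom F G := supernatAll F G
  id F := ⟨fun X => 𝟙 (F.obj X), supernat_le _ _ _ (supernat_id F)⟩
  comp α β := ⟨fun X => α.1 X ≫ β.1 X, supernatAll_comp α.2 β.2⟩
  id_comp _ := Subtype.ext (funext fun _ => Category.id_comp _)
  comp_id _ := Subtype.ext (funext fun _ => Category.comp_id _)
  assoc _ _ _ := Subtype.ext (funext fun _ => Category.assoc _ _ _)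

/-- The component at `X` of a supernatural transformation. -/
def SEnd.app {F G : SEnd k C} (α : F ⟶ G) (X : C) : F.obj X ⟶ G.obj X := α.1 X

theorem SEnd.ext {F G : SEnd k C} {α β : F ⟶ G} (h : ∀ X, SEnd.app α X = SEnd.app β X) :
    α = β := Subtype.ext (funext h)

instance : Preadditive (SEnd k C) where
  homGroup F G := inferInstanceAs (AddCommGroup (supernatAll F G))
  add_comp _ _ _ _ _ _ := Subtype.ext (funext fun _ => Preadditive.add_comp _ _ _ _ _ _)
  comp_add _ _ _ _ _ _ := Subtype.ext (funext fun _ => Preadditive.comp_add _ _ _ _ _ _)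

instance : Linear k (SEnd k C) where
  homModule F G := inferInstanceAs (Module k (supernatAll F G))
  smul_comp _ _ _ _ _ _ := Subtype.ext (funext fun _ => Linear.smul_comp _ _ _ _ _ _)
  comp_smul _ _ _ _ _ _ := Subtype.ext (funext fun _ => Linear.comp_smul _ _ _ _ _ _)

instance : Supercategory k (SEnd k C) where
  parity F G p := (supernat F G p).comap (supernatAll F G).subtype
  isCompl_parity F G := by
    refine ⟨?_, ?_⟩
    · rw [Submodule.disjoint_def]
      intro α h0 h1
      refine SEnd.ext fun X => ?_
      exact (Submodule.disjoint_def.1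
        (Supercategory.isCompl_parity (k := k) (F.obj X) (G.obj X)).1) _ (h0.1 X) (h1.1 X)
    · rw [codisjoint_iff, eq_top_iff]
      rintro ⟨α, hα⟩ -
      obtain ⟨a, ha, b, hb, rfl⟩ := Submodule.mem_sup.1 hα
      exact Submodule.mem_sup.2 ⟨⟨a, supernat_le _ _ _ ha⟩, ha, ⟨b, supernat_le _ _ _ hb⟩, hb, rfl⟩
  id_mem F := supernat_id F
  comp_mem hf hg := supernat_comp hf hg

theorem supernat_tensor {F G F' G' : SEnd k C} {p q : ZMod 2} {α : ∀ X, F.obj X ⟶ G.obj X}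
    {β : ∀ X, F'.obj X ⟶ G'.obj X} (hα : α ∈ supernat F G p) (hβ : β ∈ supernat F' G' q) :
    (fun X => F.map (β X) ≫ α (G'.obj X)) ∈ supernat (F * F') (G * G') (p + q) := by
  refine ⟨fun X => ?_, fun X Y r f hf => ?_⟩
  · rw [add_comm]
    exact Supercategory.comp_mem (F.map_mem (hβ.1 X)) (hα.1 _)
  · change (F.map (β X) ≫ α (G'.obj X)) ≫ G.map (G'.map f) =
      sgn k (p + q) r • (F.map (F'.map f) ≫ F.map (β Y) ≫ α (G'.obj Y))
    rw [Category.assoc, hα.2 (G'.map_mem hf), Linear.comp_smul, ← Category.assoc, ← F.map_comp,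
      hβ.2 hf, F.map_smul, F.map_comp, Linear.smul_comp, smul_smul, sgn_add_left, Category.assoc]

theorem supernatAll_tensor {F G F' G' : SEnd k C} {α : ∀ X, F.obj X ⟶ G.obj X}
    {β : ∀ X, F'.obj X ⟶ G'.obj X} (hα : α ∈ supernatAll F G) (hβ : β ∈ supernatAll F' G') :
    (fun X => F.map (β X) ≫ α (G'.obj X)) ∈ supernatAll (F * F') (G * G') := by
  obtain ⟨a, ha, a', ha', rfl⟩ := Submodule.mem_sup.1 hα
  obtain ⟨b, hb, b', hb', rfl⟩ := Submodule.mem_sup.1 hβ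
  have : (fun X => F.map ((b + b') X) ≫ (a + a') (G'.obj X)) =
      (fun X => F.map (b X) ≫ a (G'.obj X)) + (fun X => F.map (b X) ≫ a' (G'.obj X)) +
      (fun X => F.map (b' X) ≫ a (G'.obj X)) + (fun X => F.map (b' X) ≫ a' (G'.obj X)) := by
    funext X; simp [F.map_add]; abel
  rw [this]
  exact add_mem (add_mem (add_mem (supernat_le _ _ _ (supernat_tensor ha hb))
    (supernat_le _ _ _ (supernat_tensor ha' hb))) (supernat_le _ _ _ (supernat_tensor ha hb')))
    (supernat_le _ _ _ (supernat_tensor ha' hb'))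

instance : StrictMonoidalSupercategory k (SEnd k C) where
  tensor {F G F' G'} α β :=
    ⟨fun X => F.map (SEnd.app β X) ≫ SEnd.app α (G'.obj X), supernatAll_tensor α.2 β.2⟩
  add_tensor _ _ _ := SEnd.ext fun _ => Preadditive.comp_add _ _ _ _ _ _
  tensor_add {F G F' G'} f g h := SEnd.ext fun X =>
    (congrArg (· ≫ SEnd.app f _) (F.map_add _ _)).trans (Preadditive.add_comp _ _ _ _ _ _)
  smul_tensor _ _ _ := SEnd.ext fun _ => Linear.comp_smul _ _ _ _ _ _
  tensor_smul {F G F' G'} a f g := SEnd.ext fun X =>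
    (congrArg (· ≫ SEnd.app f _) (F.map_smul _ _)).trans (Linear.smul_comp _ _ _ _ _ _)
  tensor_mem hf hg := supernat_tensor hf hg
  tensor_id F G := SEnd.ext fun X =>
    (congrArg (· ≫ 𝟙 _) (F.map_id _)).trans (Category.comp_id _)
  interchange {F F₁ F₂ G₀ G₁ G₂ p q f g} f' g' hf hg := SEnd.ext fun X => by
    change (F.map (SEnd.app g' X) ≫ SEnd.app f (G₁.obj X)) ≫
      F₁.map (SEnd.app g X) ≫ SEnd.app f' (G₂.obj X) =
        sgn k p q • (F.map (SEnd.app g' X ≫ SEnd.app g X) ≫ SEnd.app f (G₂.obj X) ≫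
          SEnd.app f' (G₂.obj X))
    have := hf.2 (hg.1 X)
    change SEnd.app f (G₁.obj X) ≫ F₁.map (SEnd.app g X) = _ at this
    rw [Category.assoc, ← Category.assoc (SEnd.app f _), this]
    simp [SEnd.app]
    rfl
  tensor_assoc {F G F' G' F'' G''} f g h := SEnd.ext fun X => by
    change F.map (F'.map (SEnd.app h X)) ≫ F.map (SEnd.app g (G''.obj X)) ≫
      SEnd.app f (G'.obj (G''.obj X)) = 𝟙 _ ≫ (F.map (F'.map (SEnd.app h X) ≫
        SEnd.app g (G''.obj X)) ≫ SEnd.app f (G'.obj (G''.obj X))) ≫ 𝟙 _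
    simp
  one_tensor {F G} f := SEnd.ext fun X => by
    change SEnd.app f X ≫ 𝟙 _ = 𝟙 _ ≫ SEnd.app f X ≫ 𝟙 _
    simp
  tensor_one {F G} f := SEnd.ext fun X => by
    change F.map (𝟙 X) ≫ SEnd.app f X = 𝟙 _ ≫ SEnd.app f X ≫ 𝟙 _
    simp

variable (k) in
theorem exists_parity {X Y : C} (f : X ⟶ Y) :
    ∃ a ∈ Supercategory.parity (k := k) X Y 0, ∃ b ∈ Supercategory.parity (k := k) X Y 1,
      a + b = f := by
  have h : f ∈ Supercategory.parity (k := k) X Y 0 ⊔ Supercategory.parity (k := k) X Y 1 := by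
    rw [(Supercategory.isCompl_parity (k := k) X Y).sup_eq_top]; trivial
  exact Submodule.mem_sup.1 h

variable (k C) in
/-- Evaluation of endosuperfunctors on the unit object; not a monoidal superfunctor. -/
def evOne [Monoid C] : Superfunctor k (SEnd k C) C where
  obj F := F.obj 1
  map α := SEnd.app α 1
  map_id _ := rfl
  map_comp _ _ := rfl
  map_add _ _ := rfl
  map_smul _ _ := rfl
  map_mem h := h.1 1

variable (k) in
/-- The endosuperfunctor `X ⊗ -`. -/
def tensorLeft [Monoid C] [StrictMonoidalSupercategory k C] (X : C) : SEnd k C where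
  obj Y := X * Y
  map f := tensor k (𝟙 X) f
  map_id Y := tensor_id X Y
  map_comp f g := by
    obtain ⟨a, ha, b, hb, rfl⟩ := exists_parity k g
    have e0 := interchange (k := k) (f := 𝟙 X) (𝟙 X) f (Supercategory.id_mem X) ha
    have e1 := interchange (k := k) (f := 𝟙 X) (𝟙 X) f (Supercategory.id_mem X) hb
    simp only [sgn_zero_left, one_smul, Category.comp_id] at e0 e1
    rw [Preadditive.comp_add, tensor_add, tensor_add, Preadditive.comp_add, e0, e1]
  map_add f g := tensor_add _ f g
  map_smul a f := tensor_smul a _ f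
  map_mem h := by
    have := tensor_mem (Supercategory.id_mem (k := k) X) h
    rwa [zero_add] at this

end SEnd

/-- Composition of superfunctors. -/
def Superfunctor.comp {k : Type u} [CommRing k] {C D E : Type*} [Category C] [Preadditive C]
    [Linear k C] [Supercategory k C] [Category D] [Preadditive D] [Linear k D]
    [Supercategory k D] [Category E] [Preadditive E] [Linear k E] [Supercategory k E]
    (F : Superfunctor k C D) (G : Superfunctor k D E) : Superfunctor k C E where
  toFunctor := F.toFunctor ⋙ G.toFunctor
  map_add f g := by simp [F.map_add, G.map_add]
  map_smul a f := by simp [F.map_smul, G.map_smul]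
  map_mem h := G.map_mem (F.map_mem h)

/-! ### Strict monoidal supercategories given by generators and relations -/

/-- Generating objects, generating morphisms between words in the generating objects, and the
parities of the generating morphisms. -/
structure Signature (L : Type) where
  Gen : Type
  dom : Gen → FreeMonoid L
  cod : Gen → FreeMonoid L
  par : Gen → ZMod 2

/-- Formal expressions for morphisms, built from the generating morphisms.  As for `≫`, the
first factor of `comp` is applied first. -/
inductive Term (k : Type u) {L : Type} (S : Signature L) : FreeMonoid L → FreeMonoid L → Type u
  | gen (g : S.Gen) : Term k S (S.dom g) (S.cod g)
  | id (X : FreeMonoid L) : Term k S X X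
  | comp {X Y Z : FreeMonoid L} (f : Term k S X Y) (g : Term k S Y Z) : Term k S X Z
  | tensor {X Y X' Y' : FreeMonoid L} (f : Term k S X Y) (g : Term k S X' Y') :
      Term k S (X * X') (Y * Y')
  | zero (X Y : FreeMonoid L) : Term k S X Y
  | add {X Y : FreeMonoid L} (f g : Term k S X Y) : Term k S X Y
  | smul {X Y : FreeMonoid L} (a : k) (f : Term k S X Y) : Term k S X Y

namespace Term

variable {k : Type u} {L : Type} {S : Signature L}

/-- The identity, seen as a morphism between two equal words. -/
def eqTo {X Y : FreeMonoid L} (h : X = Y) : Term k S X Y := h ▸ Term.id X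

/-- The homogeneous expressions. -/
inductive Homog : ∀ {X Y : FreeMonoid L}, Term k S X Y → ZMod 2 → Prop
  | gen (g : S.Gen) : Homog (Term.gen g) (S.par g)
  | id (X : FreeMonoid L) : Homog (Term.id X) 0
  | comp {X Y Z : FreeMonoid L} {f : Term k S X Y} {g : Term k S Y Z} {p q : ZMod 2} :
      Homog f p → Homog g q → Homog (comp f g) (p + q)
  | tensor {X Y X' Y' : FreeMonoid L} {f : Term k S X Y} {g : Term k S X' Y'}
      {p q : ZMod 2} : Homog f p → Homog g q → Homog (tensor f g) (p + q)
  | zero (X Y : FreeMonoid L) (p : ZMod 2) : Homog (zero X Y) p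
  | add {X Y : FreeMonoid L} {f g : Term k S X Y} {p : ZMod 2} :
      Homog f p → Homog g p → Homog (add f g) p
  | smul {X Y : FreeMonoid L} (a : k) {f : Term k S X Y} {p : ZMod 2} :
      Homog f p → Homog (smul a f) p

end Term

/-- A signature together with homogeneous relations. -/
structure Presentation (k : Type u) [CommRing k] (L : Type) extends Signature L where
  rel : ∀ {X Y : FreeMonoid L}, Term k toSignature X Y → Term k toSignature X Y → Prop
  homog : ∀ {X Y : FreeMonoid L} {s t : Term k toSignature X Y}, rel s t →
    ∃ p, s.Homog p ∧ t.Homog p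

namespace Presentation

variable {k : Type u} [CommRing k] {L : Type} (P : Presentation k L)

/-- The identifications to be made on formal expressions: the given relations and the laws of a
strict monoidal supercategory. -/
inductive Rel : ∀ {X Y : FreeMonoid L}, Term k P.toSignature X Y →
    Term k P.toSignature X Y → Prop
  -- the given relations
  | of {X Y : FreeMonoid L} {s t : Term k P.toSignature X Y} : P.rel s t → Rel s t
  -- compatibility with the operations
  | comp_left {X Y Z : FreeMonoid L} {f f' : Term k P.toSignature X Y}
      (g : Term k P.toSignature Y Z) : Rel f f' → Rel (f.comp g) (f'.comp g)
  | comp_right {X Y Z : FreeMonoid L} (f : Term k P.toSignature X Y)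
      {g g' : Term k P.toSignature Y Z} : Rel g g' → Rel (f.comp g) (f.comp g')
  | tensor_left {X Y X' Y' : FreeMonoid L} {f f' : Term k P.toSignature X Y}
      (g : Term k P.toSignature X' Y') : Rel f f' → Rel (f.tensor g) (f'.tensor g)
  | tensor_right {X Y X' Y' : FreeMonoid L} (f : Term k P.toSignature X Y)
      {g g' : Term k P.toSignature X' Y'} : Rel g g' → Rel (f.tensor g) (f.tensor g')
  | add_left {X Y : FreeMonoid L} {f f' : Term k P.toSignature X Y}
      (g : Term k P.toSignature X Y) : Rel f f' → Rel (f.add g) (f'.add g)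
  | add_right {X Y : FreeMonoid L} (f : Term k P.toSignature X Y)
      {g g' : Term k P.toSignature X Y} : Rel g g' → Rel (f.add g) (f.add g')
  | smul_right {X Y : FreeMonoid L} (a : k) {f f' : Term k P.toSignature X Y} :
      Rel f f' → Rel (f.smul a) (f'.smul a)
  -- `k`-modules
  | add_comm {X Y : FreeMonoid L} (f g : Term k P.toSignature X Y) :
      Rel (f.add g) (g.add f)
  | add_assoc {X Y : FreeMonoid L} (f g h : Term k P.toSignature X Y) :
      Rel ((f.add g).add h) (f.add (g.add h))
  | zero_add {X Y : FreeMonoid L} (f : Term k P.toSignature X Y) :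
      Rel ((Term.zero X Y).add f) f
  | zero_smul {X Y : FreeMonoid L} (f : Term k P.toSignature X Y) :
      Rel (f.smul 0) (Term.zero X Y)
  | one_smul {X Y : FreeMonoid L} (f : Term k P.toSignature X Y) : Rel (f.smul 1) f
  | mul_smul {X Y : FreeMonoid L} (a b : k) (f : Term k P.toSignature X Y) :
      Rel (f.smul (a * b)) ((f.smul b).smul a)
  | add_smul {X Y : FreeMonoid L} (a b : k) (f : Term k P.toSignature X Y) :
      Rel (f.smul (a + b)) ((f.smul a).add (f.smul b))
  | smul_add {X Y : FreeMonoid L} (a : k) (f g : Term k P.toSignature X Y) :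
      Rel ((f.add g).smul a) ((f.smul a).add (g.smul a))
  -- categories with bilinear composition
  | id_comp {X Y : FreeMonoid L} (f : Term k P.toSignature X Y) :
      Rel ((Term.id X).comp f) f
  | comp_id {X Y : FreeMonoid L} (f : Term k P.toSignature X Y) :
      Rel (f.comp (Term.id Y)) f
  | assoc {W X Y Z : FreeMonoid L} (f : Term k P.toSignature W X)
      (g : Term k P.toSignature X Y) (h : Term k P.toSignature Y Z) :
      Rel ((f.comp g).comp h) (f.comp (g.comp h))
  | add_comp {X Y Z : FreeMonoid L} (f f' : Term k P.toSignature X Y)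
      (g : Term k P.toSignature Y Z) : Rel ((f.add f').comp g) ((f.comp g).add (f'.comp g))
  | comp_add {X Y Z : FreeMonoid L} (f : Term k P.toSignature X Y)
      (g g' : Term k P.toSignature Y Z) : Rel (f.comp (g.add g')) ((f.comp g).add (f.comp g'))
  | smul_comp {X Y Z : FreeMonoid L} (a : k) (f : Term k P.toSignature X Y)
      (g : Term k P.toSignature Y Z) : Rel ((f.smul a).comp g) ((f.comp g).smul a)
  | comp_smul {X Y Z : FreeMonoid L} (a : k) (f : Term k P.toSignature X Y)
      (g : Term k P.toSignature Y Z) : Rel (f.comp (g.smul a)) ((f.comp g).smul a)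
  -- the bilinear strict tensor product, with the super interchange law
  | add_tensor {X Y X' Y' : FreeMonoid L} (f f' : Term k P.toSignature X Y)
      (g : Term k P.toSignature X' Y') :
      Rel ((f.add f').tensor g) ((f.tensor g).add (f'.tensor g))
  | tensor_add {X Y X' Y' : FreeMonoid L} (f : Term k P.toSignature X Y)
      (g g' : Term k P.toSignature X' Y') :
      Rel (f.tensor (g.add g')) ((f.tensor g).add (f.tensor g'))
  | smul_tensor {X Y X' Y' : FreeMonoid L} (a : k) (f : Term k P.toSignature X Y)
      (g : Term k P.toSignature X' Y') : Rel ((f.smul a).tensor g) ((f.tensor g).smul a)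
  | tensor_smul {X Y X' Y' : FreeMonoid L} (a : k) (f : Term k P.toSignature X Y)
      (g : Term k P.toSignature X' Y') : Rel (f.tensor (g.smul a)) ((f.tensor g).smul a)
  | tensor_id (X Y : FreeMonoid L) :
      Rel ((Term.id X).tensor (Term.id Y)) (Term.id (X * Y))
  | interchange {X Y Z X' Y' Z' : FreeMonoid L} {f : Term k P.toSignature X Y}
      {f' : Term k P.toSignature Y Z} {g' : Term k P.toSignature X' Y'}
      {g : Term k P.toSignature Y' Z'} {p p' q' q : ZMod 2} (hf : f.Homog p) (hf' : f'.Homog p')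
      (hg' : g'.Homog q') (hg : g.Homog q) :
      Rel ((f.tensor g').comp (f'.tensor g)) (((f.comp f').tensor (g'.comp g)).smul (sgn k p q))
  | tensor_assoc {X Y X' Y' X'' Y'' : FreeMonoid L} (f : Term k P.toSignature X Y)
      (g : Term k P.toSignature X' Y') (h : Term k P.toSignature X'' Y'') :
      Rel ((f.tensor g).tensor h) ((Term.eqTo (mul_assoc X X' X'')).comp
        ((f.tensor (g.tensor h)).comp (Term.eqTo (mul_assoc Y Y' Y'').symm)))
  | one_tensor {X Y : FreeMonoid L} (f : Term k P.toSignature X Y) :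
      Rel ((Term.id 1).tensor f) ((Term.eqTo (one_mul X)).comp
        (f.comp (Term.eqTo (one_mul Y).symm)))
  | tensor_one {X Y : FreeMonoid L} (f : Term k P.toSignature X Y) :
      Rel (f.tensor (Term.id 1)) ((Term.eqTo (mul_one X)).comp
        (f.comp (Term.eqTo (mul_one Y).symm)))

/-- The morphisms of the strict monoidal supercategory presented by `P`: formal expressions up to
the identifications above. -/
def Hom (X Y : FreeMonoid L) : Type u := Quot (P.Rel (X := X) (Y := Y))

variable {P}
variable {W X Y Z X' Y' Z' X'' Y'' : FreeMonoid L}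

/-- The class of a formal expression. -/
def cls (f : Term k P.toSignature X Y) : P.Hom X Y := Quot.mk _ f

theorem cls_eq {s t : Term k P.toSignature X Y} (h : P.Rel s t) : cls s = cls t := Quot.sound h

namespace Hom

instance : Add (P.Hom X Y) where
  add := Quot.map₂ Term.add (fun f _ _ h => Rel.add_right f h) (fun _ _ g h => Rel.add_left g h)

instance : Zero (P.Hom X Y) where
  zero := cls (Term.zero X Y)

instance : SMul k (P.Hom X Y) where
  smul a := Quot.map (Term.smul a) fun _ _ h => Rel.smul_right _ h

instance : Neg (P.Hom X Y) where
  neg f := (-1 : k) • f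

theorem zero_smul (f : P.Hom X Y) : (0 : k) • f = 0 := by
  obtain ⟨f⟩ := f; exact cls_eq (Rel.zero_smul f)

instance : AddCommGroup (P.Hom X Y) where
  nsmul := nsmulRec
  zsmul := zsmulRec
  add_assoc := by
    rintro ⟨f⟩ ⟨g⟩ ⟨h⟩; exact cls_eq (Rel.add_assoc f g h)
  add_comm := by
    rintro ⟨f⟩ ⟨g⟩; exact cls_eq (Rel.add_comm f g)
  zero_add := by
    rintro ⟨f⟩; exact cls_eq (Rel.zero_add f)
  add_zero := by
    rintro ⟨f⟩; exact (cls_eq (Rel.add_comm f _)).trans (cls_eq (Rel.zero_add f))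
  neg_add_cancel := by
    rintro ⟨f⟩
    have h1 : cls (P := P) (f.smul (-1 + 1)) = cls ((f.smul (-1)).add (f.smul 1)) :=
      cls_eq (Rel.add_smul _ _ f)
    have h2 : cls (P := P) ((f.smul (-1)).add (f.smul 1)) = cls ((f.smul (-1)).add f) :=
      cls_eq (Rel.add_right _ (Rel.one_smul f))
    rw [neg_add_cancel] at h1
    exact (h2.symm.trans h1.symm).trans (cls_eq (Rel.zero_smul f))

instance : Module k (P.Hom X Y) where
  one_smul := by
    rintro ⟨f⟩; exact cls_eq (Rel.one_smul f)
  mul_smul := by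
    rintro a b ⟨f⟩; exact cls_eq (Rel.mul_smul a b f)
  smul_add := by
    rintro a ⟨f⟩ ⟨g⟩; exact cls_eq (Rel.smul_add a f g)
  smul_zero a := by
    have h1 : cls (P := P) ((Term.zero X Y).smul (a * 0)) =
        cls (((Term.zero X Y).smul 0).smul a) := cls_eq (Rel.mul_smul a 0 _)
    have h2 : cls (P := P) (((Term.zero X Y).smul 0).smul a) =
        cls ((Term.zero X Y).smul a) := cls_eq (Rel.smul_right a (Rel.zero_smul _))
    rw [mul_zero] at h1
    exact (h1.trans h2).symm.trans (Hom.zero_smul (cls _))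
  add_smul := by
    rintro a b ⟨f⟩; exact cls_eq (Rel.add_smul a b f)
  zero_smul := Hom.zero_smul

/-- Composition. -/
def comp : P.Hom X Y → P.Hom Y Z → P.Hom X Z :=
  Quot.map₂ Term.comp (fun f _ _ h => Rel.comp_right f h) (fun _ _ g h => Rel.comp_left g h)

/-- The tensor product of morphisms. -/
def tensor : P.Hom X Y → P.Hom X' Y' → P.Hom (X * X') (Y * Y') :=
  Quot.map₂ Term.tensor (fun f _ _ h => Rel.tensor_right f h) (fun _ _ g h => Rel.tensor_left g h)

theorem assoc : ∀ (f : P.Hom W X) (g : P.Hom X Y) (h : P.Hom Y Z),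
    (f.comp g).comp h = f.comp (g.comp h) := by
  rintro ⟨f⟩ ⟨g⟩ ⟨h⟩; exact cls_eq (Rel.assoc f g h)

theorem id_comp : ∀ f : P.Hom X Y, (cls (Term.id X)).comp f = f := by
  rintro ⟨f⟩; exact cls_eq (Rel.id_comp f)

theorem comp_id : ∀ f : P.Hom X Y, f.comp (cls (Term.id Y)) = f := by
  rintro ⟨f⟩; exact cls_eq (Rel.comp_id f)

theorem add_comp : ∀ (f f' : P.Hom X Y) (g : P.Hom Y Z),
    (f + f').comp g = f.comp g + f'.comp g := by
  rintro ⟨f⟩ ⟨f'⟩ ⟨g⟩; exact cls_eq (Rel.add_comp f f' g)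

theorem comp_add : ∀ (f : P.Hom X Y) (g g' : P.Hom Y Z),
    f.comp (g + g') = f.comp g + f.comp g' := by
  rintro ⟨f⟩ ⟨g⟩ ⟨g'⟩; exact cls_eq (Rel.comp_add f g g')

theorem smul_comp : ∀ (a : k) (f : P.Hom X Y) (g : P.Hom Y Z),
    (a • f).comp g = a • f.comp g := by
  rintro a ⟨f⟩ ⟨g⟩; exact cls_eq (Rel.smul_comp a f g)

theorem comp_smul : ∀ (f : P.Hom X Y) (a : k) (g : P.Hom Y Z),
    f.comp (a • g) = a • f.comp g := by
  rintro ⟨f⟩ a ⟨g⟩; exact cls_eq (Rel.comp_smul a f g)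

theorem zero_comp (g : P.Hom Y Z) : (0 : P.Hom X Y).comp g = 0 := by
  have := smul_comp (0 : k) (0 : P.Hom X Y) g; simpa using this

theorem comp_zero (f : P.Hom X Y) : f.comp (0 : P.Hom Y Z) = 0 := by
  have := comp_smul f (0 : k) (0 : P.Hom Y Z); simpa using this

theorem add_tensor : ∀ (f f' : P.Hom X Y) (g : P.Hom X' Y'),
    (f + f').tensor g = f.tensor g + f'.tensor g := by
  rintro ⟨f⟩ ⟨f'⟩ ⟨g⟩; exact cls_eq (Rel.add_tensor f f' g)

theorem tensor_add : ∀ (f : P.Hom X Y) (g g' : P.Hom X' Y'),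
    f.tensor (g + g') = f.tensor g + f.tensor g' := by
  rintro ⟨f⟩ ⟨g⟩ ⟨g'⟩; exact cls_eq (Rel.tensor_add f g g')

theorem smul_tensor : ∀ (a : k) (f : P.Hom X Y) (g : P.Hom X' Y'),
    (a • f).tensor g = a • f.tensor g := by
  rintro a ⟨f⟩ ⟨g⟩; exact cls_eq (Rel.smul_tensor a f g)

theorem tensor_smul : ∀ (a : k) (f : P.Hom X Y) (g : P.Hom X' Y'),
    f.tensor (a • g) = a • f.tensor g := by
  rintro a ⟨f⟩ ⟨g⟩; exact cls_eq (Rel.tensor_smul a f g)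

theorem zero_tensor (g : P.Hom X' Y') : (0 : P.Hom X Y).tensor g = 0 := by
  have := smul_tensor (0 : k) (0 : P.Hom X Y) g; simpa using this

theorem tensor_zero (f : P.Hom X Y) : f.tensor (0 : P.Hom X' Y') = 0 := by
  have := tensor_smul (0 : k) f (0 : P.Hom X' Y'); simpa using this

/-- The morphisms of parity `p`: the classes of the homogeneous expressions of parity `p`. -/
def parity (X Y : FreeMonoid L) (p : ZMod 2) : Submodule k (P.Hom X Y) where
  carrier := {f | ∃ t : Term k P.toSignature X Y, t.Homog p ∧ cls t = f}
  add_mem' := by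
    rintro _ _ ⟨s, hs, rfl⟩ ⟨t, ht, rfl⟩
    exact ⟨s.add t, hs.add ht, rfl⟩
  zero_mem' := ⟨Term.zero X Y, .zero X Y p, rfl⟩
  smul_mem' := by
    rintro a _ ⟨s, hs, rfl⟩
    exact ⟨s.smul a, hs.smul a, rfl⟩

theorem parity_comp {p q : ZMod 2} {f : P.Hom X Y} {g : P.Hom Y Z} (hf : f ∈ parity X Y p)
    (hg : g ∈ parity Y Z q) : f.comp g ∈ parity X Z (p + q) := by
  obtain ⟨s, hs, rfl⟩ := hf
  obtain ⟨t, ht, rfl⟩ := hg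
  exact ⟨s.comp t, hs.comp ht, rfl⟩

theorem parity_tensor {p q : ZMod 2} {f : P.Hom X Y} {g : P.Hom X' Y'} (hf : f ∈ parity X Y p)
    (hg : g ∈ parity X' Y' q) : f.tensor g ∈ parity (X * X') (Y * Y') (p + q) := by
  obtain ⟨s, hs, rfl⟩ := hf
  obtain ⟨t, ht, rfl⟩ := hg
  exact ⟨s.tensor t, hs.tensor ht, rfl⟩

theorem zmod_two (p : ZMod 2) : p = 0 ∨ p = 1 := by revert p; decide

theorem parity_le (p : ZMod 2) :
    parity (P := P) X Y p ≤ parity X Y 0 ⊔ parity X Y 1 := by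
  rcases zmod_two p with rfl | rfl
  · exact le_sup_left
  · exact le_sup_right

theorem parity_sup : ∀ {X Y : FreeMonoid L} (t : Term k P.toSignature X Y),
    cls t ∈ parity X Y 0 ⊔ parity X Y 1
  | _, _, .gen g => parity_le (P.par g) ⟨_, .gen g, rfl⟩
  | _, _, .id X => parity_le 0 ⟨_, .id X, rfl⟩
  | _, _, .comp f g => by
    obtain ⟨a, ha, b, hb, h⟩ := Submodule.mem_sup.1 (parity_sup f)
    obtain ⟨c, hc, d, hd, h'⟩ := Submodule.mem_sup.1 (parity_sup g)
    change (cls f).comp (cls g) ∈ _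
    rw [← h, ← h', add_comp, comp_add, comp_add]
    exact add_mem (add_mem (parity_le _ (parity_comp ha hc)) (parity_le _ (parity_comp ha hd)))
      (add_mem (parity_le _ (parity_comp hb hc)) (parity_le _ (parity_comp hb hd)))
  | _, _, .tensor f g => by
    obtain ⟨a, ha, b, hb, h⟩ := Submodule.mem_sup.1 (parity_sup f)
    obtain ⟨c, hc, d, hd, h'⟩ := Submodule.mem_sup.1 (parity_sup g)
    change (cls f).tensor (cls g) ∈ _
    rw [← h, ← h', add_tensor, tensor_add, tensor_add]
    exact add_mem
      (add_mem (parity_le _ (parity_tensor ha hc)) (parity_le _ (parity_tensor ha hd)))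
      (add_mem (parity_le _ (parity_tensor hb hc)) (parity_le _ (parity_tensor hb hd)))
  | _, _, .zero _ _ => zero_mem _
  | _, _, .add f g => add_mem (parity_sup f) (parity_sup g)
  | _, _, .smul a f => Submodule.smul_mem _ a (parity_sup f)

/-- The component of parity `p` of a formal expression. -/
def part : ∀ {X Y : FreeMonoid L}, ZMod 2 → Term k P.toSignature X Y → P.Hom X Y
  | _, _, p, .gen g => if P.par g = p then cls (.gen g) else 0
  | _, _, p, .id X => if 0 = p then cls (.id X) else 0
  | _, _, p, .comp f g => (part 0 f).comp (part p g) + (part 1 f).comp (part (p + 1) g)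
  | _, _, p, .tensor f g => (part 0 f).tensor (part p g) + (part 1 f).tensor (part (p + 1) g)
  | _, _, _, .zero _ _ => 0
  | _, _, p, .add f g => part p f + part p g
  | _, _, p, .smul a f => a • part p f

theorem part_homog {t : Term k P.toSignature X Y} {q : ZMod 2}
    (h : t.Homog q) (p : ZMod 2) : part p t = if q = p then cls t else 0 := by
  induction h generalizing p with
  | gen g => rfl
  | id X => rfl
  | @comp X Y Z f g q q' hf hg ihf ihg =>
    have e : cls (f.comp g) = (cls f).comp (cls g) := rfl
    simp only [part, ihf, ihg, e]
    rcases zmod_two q with rfl | rfl <;> rcases zmod_two q' with rfl | rfl <;>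
      rcases zmod_two p with rfl | rfl <;> simp +decide [zero_comp, comp_zero]
  | @tensor X Y X' Y' f g q q' hf hg ihf ihg =>
    have e : cls (f.tensor g) = (cls f).tensor (cls g) := rfl
    simp only [part, ihf, ihg, e]
    rcases zmod_two q with rfl | rfl <;> rcases zmod_two q' with rfl | rfl <;>
      rcases zmod_two p with rfl | rfl <;> simp +decide [zero_tensor, tensor_zero]
  | zero X Y q => simp only [part]; split <;> rfl
  | @add X Y f g q hf hg ihf ihg =>
    have e : cls (f.add g) = cls f + cls g := rfl
    simp only [part, ihf, ihg, e]; split <;> simp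
  | @smul X Y a f q hf ihf =>
    have e : cls (f.smul a) = a • cls f := rfl
    simp only [part, ihf, e]; split <;> simp

theorem eqTo_homog (h : X = Y) : (Term.eqTo h : Term k P.toSignature X Y).Homog 0 := by
  subst h; exact .id X

/-- The identity, seen as a morphism between two equal words. -/
def eqTo (h : X = Y) : P.Hom X Y := cls (Term.eqTo h)

theorem part_eqTo (h : X = Y) (p : ZMod 2) :
    part p (Term.eqTo h : Term k P.toSignature X Y) = if 0 = p then eqTo h else 0 :=
  part_homog (eqTo_homog h) p

theorem tensor_assoc : ∀ (f : P.Hom X Y) (g : P.Hom X' Y') (h : P.Hom X'' Y''),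
    (f.tensor g).tensor h = (eqTo (mul_assoc X X' X'')).comp
      ((f.tensor (g.tensor h)).comp (eqTo (mul_assoc Y Y' Y'').symm)) := by
  rintro ⟨f⟩ ⟨g⟩ ⟨h⟩; exact cls_eq (Rel.tensor_assoc f g h)

theorem one_tensor : ∀ f : P.Hom X Y, (cls (Term.id 1)).tensor f =
    (eqTo (one_mul X)).comp (f.comp (eqTo (one_mul Y).symm)) := by
  rintro ⟨f⟩; exact cls_eq (Rel.one_tensor f)

theorem tensor_one : ∀ f : P.Hom X Y, f.tensor (cls (Term.id 1)) =
    (eqTo (mul_one X)).comp (f.comp (eqTo (mul_one Y).symm)) := by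
  rintro ⟨f⟩; exact cls_eq (Rel.tensor_one f)

theorem part_rel {s t : Term k P.toSignature X Y} (h : P.Rel s t) (p : ZMod 2) :
    part p s = part p t := by
  have h11 : (1 + 1 : ZMod 2) = 0 := by decide
  have h01 : (0 : ZMod 2) ≠ 1 := by decide
  induction h generalizing p with
  | of h =>
    obtain ⟨q, hs, ht⟩ := P.homog h
    rw [part_homog hs, part_homog ht, cls_eq (.of h)]
  | comp_left g h ih => simp only [part, ih]
  | comp_right g h ih => simp only [part, ih]
  | tensor_left g h ih => simp only [part, ih]
  | tensor_right g h ih => simp only [part, ih]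
  | add_left g h ih => simp only [part, ih]
  | add_right g h ih => simp only [part, ih]
  | smul_right a h ih => simp only [part, ih]
  | add_comm f g => simp only [part]; exact _root_.add_comm _ _
  | add_assoc f g h => simp only [part]; exact _root_.add_assoc _ _ _
  | zero_add f => simp only [part]; exact _root_.zero_add _
  | zero_smul f => simp only [part]; exact _root_.zero_smul _ _
  | one_smul f => simp only [part]; exact _root_.one_smul _ _
  | mul_smul a b f => simp only [part]; exact SemigroupAction.mul_smul _ _ _
  | add_smul a b f => simp only [part]; exact _root_.add_smul _ _ _
  | smul_add a f g => simp only [part]; exact _root_.smul_add _ _ _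
  | id_comp f => simp [part, id_comp, zero_comp]
  | comp_id f =>
    rcases zmod_two p with rfl | rfl <;> simp [part, h11, comp_id, comp_zero]
  | assoc f g h =>
    rcases zmod_two p with rfl | rfl <;> simp only [part, h11, add_comp, comp_add, assoc,
      _root_.zero_add] <;> abel
  | add_comp f f' g => simp only [part, add_comp]; abel
  | comp_add f g g' => simp only [part, comp_add]; abel
  | smul_comp a f g => simp only [part, smul_comp, _root_.smul_add]
  | comp_smul a f g => simp only [part, comp_smul, _root_.smul_add]
  | add_tensor f f' g => simp only [part, add_tensor]; abel
  | tensor_add f g g' => simp only [part, tensor_add]; abel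
  | smul_tensor a f g => simp only [part, smul_tensor, _root_.smul_add]
  | tensor_smul a f g => simp only [part, tensor_smul, _root_.smul_add]
  | tensor_id X Y =>
    rw [part_homog (.tensor (.id X) (.id Y)), part_homog (.id _), cls_eq (.tensor_id X Y),
      _root_.add_zero]
  | @interchange X Y Z X' Y' Z' f f' g' g a b c d hf hf' hg' hg =>
    rw [part_homog (.comp (.tensor hf hg') (.tensor hf' hg)),
      part_homog (.smul _ (.tensor (.comp hf hf') (.comp hg' hg))),
      cls_eq (.interchange hf hf' hg' hg), show a + c + (b + d) = a + b + (c + d) by ring]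
  | tensor_assoc f g h =>
    rcases zmod_two p with rfl | rfl <;> simp [part, part_eqTo, h11, h01, add_tensor, tensor_add,
      tensor_assoc, comp_add, add_comp, zero_comp, comp_zero] <;> abel
  | one_tensor f =>
    rcases zmod_two p with rfl | rfl <;> simp [part, part_eqTo, h11, h01, one_tensor,
      zero_tensor, zero_comp, comp_zero]
  | tensor_one f =>
    rcases zmod_two p with rfl | rfl <;> simp [part, part_eqTo, h11, h01, tensor_one,
      tensor_zero, zero_comp, comp_zero]

theorem parity_disjoint : Disjoint (parity (P := P) X Y 0) (parity X Y 1) := by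
  rw [Submodule.disjoint_def]
  rintro f ⟨s, hs, rfl⟩ ⟨t, ht, h⟩
  -- `part 0` descends to classes
  let e : P.Hom X Y → P.Hom X Y := Quot.lift (part 0) fun _ _ h => part_rel h 0
  have h1 : e (cls s) = cls s := by
    change part 0 s = _; rw [part_homog hs]; simp
  have h2 : e (cls t) = 0 := by
    change part 0 t = _; rw [part_homog ht]; simp
  rw [← h1, ← h, h2]

end Hom

/-- The strict monoidal supercategory presented by `P`.  Its objects are the words in the
generating objects. -/
@[nolint unusedArguments]
def Cat (_ : Presentation k L) : Type := FreeMonoid L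

instance : Monoid P.Cat := inferInstanceAs (Monoid (FreeMonoid L))

instance : Category P.Cat where
  Hom X Y := P.Hom X Y
  id X := cls (Term.id X)
  comp := Hom.comp
  id_comp := Hom.id_comp
  comp_id := Hom.comp_id
  assoc := Hom.assoc

instance : Preadditive P.Cat where
  homGroup X Y := Hom.instAddCommGroup (P := P) (X := X) (Y := Y)
  add_comp _ _ _ := Hom.add_comp
  comp_add _ _ _ := Hom.comp_add

instance : Linear k P.Cat where
  homModule X Y := Hom.instModule (P := P) (X := X) (Y := Y)
  smul_comp _ _ _ := Hom.smul_comp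
  comp_smul _ _ _ := Hom.comp_smul

instance : Supercategory k P.Cat where
  parity X Y := Hom.parity X Y
  isCompl_parity X Y := by
    refine ⟨Hom.parity_disjoint (P := P), ?_⟩
    rw [codisjoint_iff, eq_top_iff]
    rintro ⟨t⟩ -
    exact Hom.parity_sup t
  id_mem X := ⟨Term.id X, .id X, rfl⟩
  comp_mem := Hom.parity_comp

theorem Hom.eqTo_eq {X Y : P.Cat} (h : X = Y) : (Hom.eqTo h : P.Hom X Y) = eqToHom h := by
  subst h; rfl

theorem Hom.interchange {p q : ZMod 2} {f : P.Hom X Y} {g : P.Hom Y' Z'} (f' : P.Hom Y Z)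
    (g' : P.Hom X' Y') (hf : f ∈ parity X Y p) (hg : g ∈ parity Y' Z' q) :
    (f.tensor g').comp (f'.tensor g) = sgn k p q • (f.comp f').tensor (g'.comp g) := by
  have key : ∀ {a b : ZMod 2} {f' : P.Hom Y Z} {g' : P.Hom X' Y'}, f' ∈ parity Y Z a →
      g' ∈ parity X' Y' b →
      (f.tensor g').comp (f'.tensor g) = sgn k p q • (f.comp f').tensor (g'.comp g) := by
    rintro a b _ _ ⟨f', hf', rfl⟩ ⟨g', hg', rfl⟩
    obtain ⟨f, hf, rfl⟩ := hf
    obtain ⟨g, hg, rfl⟩ := hg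
    exact cls_eq (Rel.interchange hf hf' hg' hg)
  have hs : ∀ {X Y : FreeMonoid L} (h : P.Hom X Y),
      h ∈ parity (P := P) X Y 0 ⊔ parity X Y 1 := by
    rintro _ _ ⟨t⟩; exact parity_sup t
  obtain ⟨a, ha, b, hb, rfl⟩ := Submodule.mem_sup.1 (hs f')
  obtain ⟨c, hc, d, hd, rfl⟩ := Submodule.mem_sup.1 (hs g')
  simp only [add_tensor, tensor_add, add_comp, comp_add, key ha hc, key ha hd, key hb hc,
    key hb hd, _root_.smul_add]
  abel

instance : StrictMonoidalSupercategory k P.Cat where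
  tensor := Hom.tensor
  add_tensor := Hom.add_tensor
  tensor_add := Hom.tensor_add
  smul_tensor := Hom.smul_tensor
  tensor_smul := Hom.tensor_smul
  tensor_mem := Hom.parity_tensor
  tensor_id X Y := cls_eq (Rel.tensor_id X Y)
  interchange := Hom.interchange
  tensor_assoc f g h := by
    rw [← Hom.eqTo_eq, ← Hom.eqTo_eq]; exact Hom.tensor_assoc f g h
  one_tensor f := by
    rw [← Hom.eqTo_eq, ← Hom.eqTo_eq]; exact Hom.one_tensor f
  tensor_one f := by
    rw [← Hom.eqTo_eq, ← Hom.eqTo_eq]; exact Hom.tensor_one f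

end Presentation
/-! ### The quantum isomeric supercategory and its affine version -/

/-- The generating objects `↑` and `↓`. -/
inductive Arrow
  | up
  | down

/-- The generating morphisms.  The open Clifford token `opn` is only present in the affine
case. -/
inductive IsoGen : Bool → Type
  /-- The positive crossing `↑ ⊗ ↑ → ↑ ⊗ ↑`: the strand from bottom left to top right is over. -/
  | pos {a : Bool} : IsoGen a
  /-- The negative crossing `↑ ⊗ ↑ → ↑ ⊗ ↑`: the strand from bottom left to top right is under. -/
  | neg {a : Bool} : IsoGen a
  /-- The negative right crossing `↑ ⊗ ↓ → ↓ ⊗ ↑`: the upward strand is over. -/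
  | negRight {a : Bool} : IsoGen a
  /-- The left cap `↓ ⊗ ↑ → 1`. -/
  | leftCap {a : Bool} : IsoGen a
  /-- The left cup `1 → ↑ ⊗ ↓`. -/
  | leftCup {a : Bool} : IsoGen a
  /-- The closed Clifford token `↑ → ↑`. -/
  | tok {a : Bool} : IsoGen a
  /-- The open Clifford token `↑ → ↑`. -/
  | opn : IsoGen true

/-- The object `↑`. -/
abbrev up : FreeMonoid Arrow := FreeMonoid.of Arrow.up

/-- The object `↓`. -/
abbrev dn : FreeMonoid Arrow := FreeMonoid.of Arrow.down

/-- The generating objects and morphisms; the Clifford tokens are odd, the rest is even. -/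
def isoSig (a : Bool) : Signature Arrow where
  Gen := IsoGen a
  dom
    | .pos => up * up
    | .neg => up * up
    | .negRight => up * dn
    | .leftCap => dn * up
    | .leftCup => 1
    | .tok => up
    | .opn => up
  cod
    | .pos => up * up
    | .neg => up * up
    | .negRight => dn * up
    | .leftCap => 1
    | .leftCup => up * dn
    | .tok => up
    | .opn => up
  par
    | .tok => 1
    | .opn => 1
    | _ => 0

namespace IsoTerm

variable {k : Type u} {a : Bool}

def pos : Term k (isoSig a) (up * up) (up * up) := Term.gen (S := isoSig a) IsoGen.pos
def neg : Term k (isoSig a) (up * up) (up * up) := Term.gen (S := isoSig a) IsoGen.neg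
def negRight : Term k (isoSig a) (up * dn) (dn * up) := Term.gen (S := isoSig a) IsoGen.negRight
def leftCap : Term k (isoSig a) (dn * up) 1 := Term.gen (S := isoSig a) IsoGen.leftCap
def leftCup : Term k (isoSig a) 1 (up * dn) := Term.gen (S := isoSig a) IsoGen.leftCup
def tok : Term k (isoSig a) up up := Term.gen (S := isoSig a) IsoGen.tok
def opn : Term k (isoSig true) up up := Term.gen (S := isoSig true) IsoGen.opn

/-- The identity of an object. -/
def one (X : FreeMonoid Arrow) : Term k (isoSig a) X X := Term.id (S := isoSig a) X

/-- Rotating a crossing of two upward strands to a left crossing `↓ ⊗ ↑ → ↑ ⊗ ↓`. -/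
def rotate (c : Term k (isoSig a) (up * up) (up * up)) : Term k (isoSig a) (dn * up) (up * dn) :=
  Term.comp (Y := dn * up * up * dn) ((one (dn * up)).tensor leftCup)
    (Term.comp (Y := dn * up * up * dn) ((one dn).tensor (c.tensor (one dn)))
      (leftCap.tensor (one (up * dn))))

/-- The positive left crossing: the upward strand is over. -/
def posLeft : Term k (isoSig a) (dn * up) (up * dn) := rotate pos

/-- The negative left crossing: the downward strand is over. -/
def negLeft : Term k (isoSig a) (dn * up) (up * dn) := rotate neg

/-- The right cap `↑ ⊗ ↓ → 1`. -/
def rightCap : Term k (isoSig a) (up * dn) 1 := negRight.comp leftCap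

/-- The right cup `1 → ↓ ⊗ ↑`. -/
def rightCup : Term k (isoSig a) 1 (dn * up) := leftCup.comp negRight

/-- The positive right crossing: the downward strand is over. -/
def posRight (z : k) : Term k (isoSig a) (up * dn) (dn * up) :=
  negRight.add ((rightCap.comp rightCup).smul z)

end IsoTerm

open IsoTerm in
/-- The defining relations; the last three are those of the affine supercategory.  In `s.comp t`
the factor `s` is at the bottom. -/
inductive IsoRel {k : Type u} [CommRing k] (z : k) : ∀ {a : Bool} {X Y : FreeMonoid Arrow},
    Term k (isoSig a) X Y → Term k (isoSig a) X Y → Prop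
  | pos_neg {a : Bool} : IsoRel z (a := a) (pos.comp neg) (one _)
  | neg_pos {a : Bool} : IsoRel z (a := a) (neg.comp pos) (one _)
  | right_left {a : Bool} : IsoRel z (a := a) (negRight.comp posLeft) (one _)
  | left_right {a : Bool} : IsoRel z (a := a) (posLeft.comp negRight) (one _)
  | braid {a : Bool} : IsoRel z (a := a) (X := up * up * up) (Y := up * up * up)
      ((pos.tensor (one up)).comp (((one up).tensor pos).comp (pos.tensor (one up))))
      (Term.comp (Y := up * up * up) ((one up).tensor pos)
        ((pos.tensor (one up)).comp ((one up).tensor pos)))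
  | skein {a : Bool} : IsoRel z (a := a) (pos.add (neg.smul (-1))) ((one (up * up)).smul z)
  | tok_tok {a : Bool} : IsoRel z (a := a) (tok.comp tok) ((one up).smul (-1))
  | tok_pos {a : Bool} : IsoRel z (a := a) ((tok.tensor (one up)).comp pos)
      (pos.comp ((one up).tensor tok))
  | bubble_tok {a : Bool} : IsoRel z (a := a)
      (leftCup.comp ((tok.tensor (one dn)).comp rightCap)) (Term.zero _ _)
  | bubble {a : Bool} : IsoRel z (a := a) (leftCup.comp rightCap) (Term.zero _ _)
  | zigzag_up {a : Bool} : IsoRel z (a := a) (X := up) (Y := up)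
      (Term.comp (Y := up * dn * up) (leftCup.tensor (one up)) ((one up).tensor leftCap)) (one up)
  | zigzag_down {a : Bool} : IsoRel z (a := a) (X := dn) (Y := dn)
      (Term.comp (Y := dn * up * dn) ((one dn).tensor leftCup) (leftCap.tensor (one dn))) (one dn)
  | opn_opn : IsoRel z (opn.comp opn) ((one up).smul (-1))
  | opn_pos : IsoRel z (((one up).tensor opn).comp pos) (pos.comp (opn.tensor (one up)))
  | bubble_opn : IsoRel z (leftCup.comp ((opn.tensor (one dn)).comp rightCap)) (Term.zero _ _)

namespace IsoTerm

variable {k : Type u} {a : Bool}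

theorem pos_homog : (pos : Term k (isoSig a) _ _).Homog 0 := .gen (S := isoSig a) IsoGen.pos
theorem neg_homog : (neg : Term k (isoSig a) _ _).Homog 0 := .gen (S := isoSig a) IsoGen.neg
theorem negRight_homog : (negRight : Term k (isoSig a) _ _).Homog 0 :=
  .gen (S := isoSig a) IsoGen.negRight
theorem leftCap_homog : (leftCap : Term k (isoSig a) _ _).Homog 0 :=
  .gen (S := isoSig a) IsoGen.leftCap
theorem leftCup_homog : (leftCup : Term k (isoSig a) _ _).Homog 0 :=
  .gen (S := isoSig a) IsoGen.leftCup
theorem tok_homog : (tok : Term k (isoSig a) _ _).Homog 1 := .gen (S := isoSig a) IsoGen.tok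
theorem opn_homog : (opn : Term k (isoSig true) _ _).Homog 1 :=
  .gen (S := isoSig true) IsoGen.opn
theorem one_homog (X : FreeMonoid Arrow) : (one X : Term k (isoSig a) X X).Homog 0 :=
  .id (S := isoSig a) X
theorem rotate_homog {c : Term k (isoSig a) (up * up) (up * up)} (h : c.Homog 0) :
    (rotate c).Homog 0 := by
  have h1 := Term.Homog.tensor (one_homog (k := k) (a := a) (dn * up)) leftCup_homog
  have h2 := Term.Homog.tensor (one_homog (k := k) (a := a) dn) (h.tensor (one_homog dn))
  have h3 := (leftCap_homog (k := k) (a := a)).tensor (one_homog (up * dn))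
  exact h1.comp (h2.comp h3)
theorem rightCap_homog : (rightCap : Term k (isoSig a) _ _).Homog 0 :=
  .comp negRight_homog leftCap_homog

end IsoTerm

open IsoTerm in
/-- The presentations of the quantum isomeric supercategory (`a = false`) and of the quantum
affine isomeric supercategory (`a = true`). -/
def isoPres {k : Type u} [CommRing k] (z : k) (a : Bool) : Presentation k Arrow where
  toSignature := isoSig a
  rel := IsoRel z
  homog h := by
    cases h
    case pos_neg => exact ⟨0, .comp pos_homog neg_homog, one_homog _⟩
    case neg_pos => exact ⟨0, .comp neg_homog pos_homog, one_homog _⟩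
    case right_left => exact ⟨0, .comp negRight_homog (rotate_homog pos_homog), one_homog _⟩
    case left_right => exact ⟨0, .comp (rotate_homog pos_homog) negRight_homog, one_homog _⟩
    case braid =>
      have h1 := (pos_homog (k := k) (a := a)).tensor (one_homog up)
      have h2 := (one_homog (k := k) (a := a) up).tensor pos_homog
      exact ⟨0, h1.comp (h2.comp h1), h2.comp (h1.comp h2)⟩
    case skein => exact ⟨0, .add pos_homog (.smul _ neg_homog), .smul _ (one_homog _)⟩
    case tok_tok => exact ⟨0, .comp tok_homog tok_homog, .smul _ (one_homog _)⟩
    case tok_pos =>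
      exact ⟨1, .comp (.tensor tok_homog (one_homog _)) pos_homog,
        .comp pos_homog (.tensor (one_homog _) tok_homog)⟩
    case bubble_tok =>
      exact ⟨1, .comp leftCup_homog (.comp (.tensor tok_homog (one_homog _)) rightCap_homog),
        .zero _ _ _⟩
    case bubble => exact ⟨0, .comp leftCup_homog rightCap_homog, .zero _ _ _⟩
    case zigzag_up =>
      have h1 := (leftCup_homog (k := k) (a := a)).tensor (one_homog up)
      have h2 := (one_homog (k := k) (a := a) up).tensor leftCap_homog
      exact ⟨0, h1.comp h2, one_homog _⟩
    case zigzag_down =>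
      have h1 := (one_homog (k := k) (a := a) dn).tensor leftCup_homog
      have h2 := (leftCap_homog (k := k) (a := a)).tensor (one_homog dn)
      exact ⟨0, h1.comp h2, one_homog _⟩
    case opn_opn => exact ⟨0, .comp opn_homog opn_homog, .smul _ (one_homog _)⟩
    case opn_pos =>
      exact ⟨1, .comp (.tensor (one_homog _) opn_homog) pos_homog,
        .comp pos_homog (.tensor opn_homog (one_homog _))⟩
    case bubble_opn =>
      exact ⟨1, .comp leftCup_homog (.comp (.tensor opn_homog (one_homog _)) rightCap_homog),
        .zero _ _ _⟩

/-- The quantum isomeric supercategory. -/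
abbrev QCat {k : Type u} [CommRing k] (z : k) : Type := (isoPres z false).Cat

/-- The quantum affine isomeric supercategory. -/
abbrev AQCat {k : Type u} [CommRing k] (z : k) : Type := (isoPres z true).Cat
/-! ### General facts on strict monoidal supercategories -/

section General

variable {k : Type u} [CommRing k] {C : Type w} [Category.{v} C] [Preadditive C] [Linear k C]
  [Supercategory k C] [Monoid C] [StrictMonoidalSupercategory k C]

variable (k) in
theorem tensor_comp_left {X Y Z X' Y' Z' : C} {q : ZMod 2} (f : X ⟶ Y) (f' : Y ⟶ Z)
    (g' : X' ⟶ Y') {g : Y' ⟶ Z'} (hf : f ∈ Supercategory.parity (k := k) X Y 0)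
    (hg : g ∈ Supercategory.parity (k := k) Y' Z' q) :
    tensor k f g' ≫ tensor k f' g = tensor k (f ≫ f') (g' ≫ g) := by
  rw [interchange f' g' hf hg, sgn_zero_left, one_smul]

variable (k) in
theorem id_tensor_comp (X : C) {Y Z W : C} (f : Y ⟶ Z) (g : Z ⟶ W) :
    tensor k (𝟙 X) (f ≫ g) = tensor k (𝟙 X) f ≫ tensor k (𝟙 X) g :=
  (tensorLeft k X).map_comp f g

variable (k) in
theorem comp_tensor_id {X Y Z : C} (f : X ⟶ Y) (g : Y ⟶ Z) (W : C) :
    tensor k (f ≫ g) (𝟙 W) = tensor k f (𝟙 W) ≫ tensor k g (𝟙 W) := by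
  obtain ⟨a, ha, b, hb, rfl⟩ := exists_parity k f
  have e0 := interchange g (𝟙 W) ha (Supercategory.id_mem (k := k) W)
  have e1 := interchange g (𝟙 W) hb (Supercategory.id_mem (k := k) W)
  rw [sgn_zero_right, one_smul, Category.comp_id] at e0 e1
  rw [Preadditive.add_comp, add_tensor, add_tensor, Preadditive.add_comp, e0, e1]

variable (k) in
/-- `f ⊗ g` is `f` above `g`. -/
theorem tensor_eq {X Y X' Y' : C} (f : X ⟶ Y) (g : X' ⟶ Y') :
    tensor k f g = tensor k (𝟙 X) g ≫ tensor k f (𝟙 Y') := by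
  obtain ⟨a, ha, b, hb, rfl⟩ := exists_parity k g
  have e0 := interchange f (𝟙 X') (Supercategory.id_mem (k := k) X) ha
  have e1 := interchange f (𝟙 X') (Supercategory.id_mem (k := k) X) hb
  have e2 := interchange f a (Supercategory.id_mem (k := k) X) (Supercategory.id_mem (k := k) Y')
  have e3 := interchange f b (Supercategory.id_mem (k := k) X) (Supercategory.id_mem (k := k) Y')
  simp only [sgn_zero_right, one_smul, Category.comp_id, Category.id_comp] at e2 e3
  rw [tensor_add, tensor_add, Preadditive.add_comp, e2, e3]

variable (k) in
theorem tensor_exchange {X Y X' Y' : C} {p q : ZMod 2} {f : X ⟶ Y} {g : X' ⟶ Y'}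
    (hf : f ∈ Supercategory.parity (k := k) X Y p)
    (hg : g ∈ Supercategory.parity (k := k) X' Y' q) :
    tensor k f (𝟙 X') ≫ tensor k (𝟙 Y) g =
      sgn k p q • (tensor k (𝟙 X) g ≫ tensor k f (𝟙 Y')) := by
  rw [interchange (𝟙 Y) (𝟙 X') hf hg, Category.comp_id, Category.id_comp, ← tensor_eq]

variable (k) in
theorem tensor_eqToHom {X Y X' Y' : C} (h : X = Y) (h' : X' = Y') :
    tensor k (eqToHom h) (eqToHom h') = eqToHom (by rw [h, h']) := by
  subst h; subst h'; simp [tensor_id]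

variable (k) in
theorem tensor_conj {X Y X' Y' Z W Z' W' : C} (h₁ : X = Y) (h₂ : Y' = X') (f : Y ⟶ Y')
    (h₃ : Z = W) (h₄ : W' = Z') (g : W ⟶ W') :
    tensor k (eqToHom h₁ ≫ f ≫ eqToHom h₂) (eqToHom h₃ ≫ g ≫ eqToHom h₄) =
      eqToHom (by rw [h₁, h₃]) ≫ tensor k f g ≫ eqToHom (by rw [h₂, h₄]) := by
  subst h₁; subst h₂; subst h₃; subst h₄; simp

theorem eqToHom_mem {X Y : C} (h : X = Y) :
    eqToHom h ∈ Supercategory.parity (k := k) X Y 0 := by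
  subst h; exact Supercategory.id_mem X

theorem conj_mem {X Y X' Y' : C} {p : ZMod 2} (h : X = Y) (h' : Y' = X') {f : Y ⟶ Y'}
    (hf : f ∈ Supercategory.parity (k := k) Y Y' p) :
    eqToHom h ≫ f ≫ eqToHom h' ∈ Supercategory.parity (k := k) X X' p := by
  subst h; subst h'; simpa using hf

theorem SEnd.app_eqToHom {F G : SEnd k C} (h : F = G) (X : C) :
    SEnd.app (eqToHom h) X = eqToHom (by rw [h]) := by
  subst h; rfl

theorem SEnd.app_comp {F G H : SEnd k C} (α : F ⟶ G) (β : G ⟶ H) (X : C) :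
    SEnd.app (α ≫ β) X = SEnd.app α X ≫ SEnd.app β X := rfl

theorem SEnd.app_tensor {F G F' G' : SEnd k C} (α : F ⟶ G) (β : F' ⟶ G') (X : C) :
    SEnd.app (tensor k α β) X = F.map (SEnd.app β X) ≫ SEnd.app α (G'.obj X) := rfl

variable (k) in
theorem tensorLeft_mul (X Y : C) : tensorLeft k (X * Y) = tensorLeft k X * tensorLeft k Y := by
  have : (tensorLeft k (X * Y)).toFunctor = (tensorLeft k X * tensorLeft k Y).toFunctor := by
    refine CategoryTheory.Functor.ext (fun Z => mul_assoc X Y Z) fun Z W f => ?_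
    change tensor k (𝟙 (X * Y)) f = _ ≫ tensor k (𝟙 X) (tensor k (𝟙 Y) f) ≫ _
    rw [← tensor_id (k := k), tensor_assoc]
    rfl
  generalize tensorLeft k (X * Y) = F at *
  generalize tensorLeft k X * tensorLeft k Y = G at *
  cases F; cases G; cases this; rfl

variable (k) in
theorem tensorLeft_one : tensorLeft k (1 : C) = 1 := by
  have : (tensorLeft k (1 : C)).toFunctor = (1 : SEnd k C).toFunctor := by
    refine CategoryTheory.Functor.ext (fun Z => one_mul Z) fun Z W f => ?_
    change tensor k (𝟙 1) f = _ ≫ f ≫ _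
    rw [one_tensor]
    rfl
  generalize tensorLeft k (1 : C) = F at *
  generalize (1 : SEnd k C) = G at *
  cases F; cases G; cases this; rfl

theorem supernat_whisker {X Y : C} {p : ZMod 2} {f : X ⟶ Y}
    (hf : f ∈ Supercategory.parity (k := k) X Y p) :
    (fun Z => tensor k f (𝟙 Z)) ∈ supernat (tensorLeft k X) (tensorLeft k Y) p := by
  refine ⟨fun Z => ?_, fun Z W q g hg => tensor_exchange k hf hg⟩
  have := tensor_mem hf (Supercategory.id_mem (k := k) Z)
  rwa [add_zero] at this

variable (k) in
/-- The supernatural transformation `f ⊗ -`, with components `f ⊗ 1_Z`. -/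
def whisker {X Y : C} (f : X ⟶ Y) : tensorLeft k X ⟶ tensorLeft k Y :=
  ⟨fun Z => tensor k f (𝟙 Z), by
    obtain ⟨a, ha, b, hb, rfl⟩ := exists_parity k f
    have : (fun Z => tensor k (a + b) (𝟙 Z)) =
        (fun Z : C => tensor k a (𝟙 Z)) + (fun Z => tensor k b (𝟙 Z)) := by
      funext Z; exact add_tensor _ _ _
    rw [this]
    exact add_mem (supernat_le _ _ _ (supernat_whisker ha))
      (supernat_le _ _ _ (supernat_whisker hb))⟩

theorem whisker_app {X Y : C} (f : X ⟶ Y) (Z : C) :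
    SEnd.app (whisker k f) Z = tensor k f (𝟙 Z) := rfl

theorem whisker_comp {X Y Z : C} (f : X ⟶ Y) (g : Y ⟶ Z) :
    whisker k (f ≫ g) = whisker k f ≫ whisker k g :=
  SEnd.ext fun W => comp_tensor_id k f g W

theorem whisker_id (X : C) : whisker k (𝟙 X) = 𝟙 (tensorLeft k X) :=
  SEnd.ext fun W => tensor_id X W

theorem whisker_add {X Y : C} (f g : X ⟶ Y) : whisker k (f + g) = whisker k f + whisker k g :=
  SEnd.ext fun _ => add_tensor _ _ _

theorem whisker_smul {X Y : C} (a : k) (f : X ⟶ Y) : whisker k (a • f) = a • whisker k f :=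
  SEnd.ext fun _ => smul_tensor _ _ _

theorem whisker_zero (X Y : C) : whisker k (0 : X ⟶ Y) = 0 := by
  have := whisker_smul (0 : k) (0 : X ⟶ Y); simpa using this

theorem whisker_tensor {X Y X' Y' : C} (f : X ⟶ Y) (g : X' ⟶ Y') :
    whisker k (tensor k f g) = eqToHom (tensorLeft_mul k X X') ≫
      tensor k (whisker k f) (whisker k g) ≫ eqToHom (tensorLeft_mul k Y Y').symm := by
  refine SEnd.ext fun Z => ?_
  rw [SEnd.app_comp, SEnd.app_comp, SEnd.app_eqToHom, SEnd.app_eqToHom, SEnd.app_tensor,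
    whisker_app, tensor_assoc, tensor_eq k f (tensor k g (𝟙 Z))]
  rfl

end General

namespace Presentation

variable {k : Type u} [CommRing k] {L : Type} {P : Presentation k L}
variable {D : Type w} [Category.{v} D] [Preadditive D] [Linear k D]
  [Supercategory k D] [Monoid D] [StrictMonoidalSupercategory k D]

/-- The value of a formal expression, given the values of the generators. -/
def eval (F : FreeMonoid L →* D) (φ : ∀ g, F (P.dom g) ⟶ F (P.cod g)) :
    ∀ {X Y : FreeMonoid L}, Term k P.toSignature X Y → (F X ⟶ F Y)
  | _, _, .gen g => φ g
  | _, _, .id X => 𝟙 (F X)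
  | _, _, .comp f g => eval F φ f ≫ eval F φ g
  | _, _, .tensor f g => eqToHom (F.map_mul _ _) ≫ tensor k (eval F φ f) (eval F φ g) ≫
      eqToHom (F.map_mul _ _).symm
  | _, _, .zero _ _ => 0
  | _, _, .add f g => eval F φ f + eval F φ g
  | _, _, .smul a f => a • eval F φ f

variable (F : FreeMonoid L →* D) (φ : ∀ g, F (P.dom g) ⟶ F (P.cod g))

theorem eval_mem (hφ : ∀ g, φ g ∈ Supercategory.parity (k := k) _ _ (P.par g))
    {X Y : FreeMonoid L} {t : Term k P.toSignature X Y} {p : ZMod 2} (h : t.Homog p) :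
    eval F φ t ∈ Supercategory.parity (k := k) _ _ p := by
  induction h with
  | gen g => exact hφ g
  | id X => exact Supercategory.id_mem _
  | comp _ _ h1 h2 => exact Supercategory.comp_mem h1 h2
  | tensor _ _ h1 h2 => exact conj_mem _ _ (tensor_mem h1 h2)
  | zero => exact zero_mem _
  | add _ _ h1 h2 => exact add_mem h1 h2
  | smul a _ h => exact Submodule.smul_mem _ _ h

theorem eval_eqTo {X Y : FreeMonoid L} (h : X = Y) :
    eval F φ (Term.eqTo h : Term k P.toSignature X Y) = eqToHom (by rw [h]) := by
  subst h; rfl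

theorem tensor_left_conj {X Y X' Y' Z W : D} (h₁ : X = Y) (h₂ : Y' = X') (f : Y ⟶ Y')
    (g : Z ⟶ W) : tensor k (eqToHom h₁ ≫ f ≫ eqToHom h₂) g =
      eqToHom (by rw [h₁]) ≫ tensor k f g ≫ eqToHom (by rw [h₂]) := by
  subst h₁; subst h₂; simp

theorem tensor_right_conj {X Y X' Y' Z W : D} (h₁ : X = Y) (h₂ : Y' = X') (f : Y ⟶ Y')
    (g : Z ⟶ W) : tensor k g (eqToHom h₁ ≫ f ≫ eqToHom h₂) =
      eqToHom (by rw [h₁]) ≫ tensor k g f ≫ eqToHom (by rw [h₂]) := by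
  subst h₁; subst h₂; simp

theorem one_tensor_of_eq {X Y W : D} (h : W = 1) (f : X ⟶ Y) :
    tensor k (𝟙 W) f = eqToHom (by rw [h, one_mul]) ≫ f ≫ eqToHom (by rw [h, one_mul]) := by
  subst h; exact one_tensor f

theorem tensor_one_of_eq {X Y W : D} (h : W = 1) (f : X ⟶ Y) :
    tensor k f (𝟙 W) = eqToHom (by rw [h, mul_one]) ≫ f ≫ eqToHom (by rw [h, mul_one]) := by
  subst h; exact tensor_one f

theorem eval_rel (hφ : ∀ g, φ g ∈ Supercategory.parity (k := k) _ _ (P.par g))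
    (hrel : ∀ {X Y : FreeMonoid L} {s t : Term k P.toSignature X Y}, P.rel s t →
      eval F φ s = eval F φ t)
    {X Y : FreeMonoid L} {s t : Term k P.toSignature X Y} (h : P.Rel s t) :
    eval F φ s = eval F φ t := by
  induction h with
  | of h => exact hrel h
  | comp_left g h ih => simp only [eval, ih]
  | comp_right g h ih => simp only [eval, ih]
  | tensor_left g h ih => simp only [eval, ih]
  | tensor_right g h ih => simp only [eval, ih]
  | add_left g h ih => simp only [eval, ih]
  | add_right g h ih => simp only [eval, ih]
  | smul_right a h ih => simp only [eval, ih]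
  | add_comm f g => exact _root_.add_comm _ _
  | add_assoc f g h => exact _root_.add_assoc _ _ _
  | zero_add f => exact _root_.zero_add _
  | zero_smul f => exact _root_.zero_smul _ _
  | one_smul f => exact _root_.one_smul _ _
  | mul_smul a b f => exact SemigroupAction.mul_smul _ _ _
  | add_smul a b f => exact _root_.add_smul _ _ _
  | smul_add a f g => exact _root_.smul_add _ _ _
  | id_comp f => exact Category.id_comp _
  | comp_id f => exact Category.comp_id _
  | assoc f g h => exact Category.assoc _ _ _
  | add_comp f f' g => exact Preadditive.add_comp _ _ _ _ _ _
  | comp_add f g g' => exact Preadditive.comp_add _ _ _ _ _ _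
  | smul_comp a f g => exact Linear.smul_comp _ _ _ _ _ _
  | comp_smul a f g => exact Linear.comp_smul _ _ _ _ _ _
  | add_tensor f f' g => simp [eval, add_tensor]
  | tensor_add f g g' => simp [eval, tensor_add]
  | smul_tensor a f g => simp [eval, smul_tensor]
  | tensor_smul a f g => simp [eval, tensor_smul]
  | tensor_id X Y => simp [eval, tensor_id]
  | interchange hf hf' hg' hg =>
    simp only [eval, Category.assoc, eqToHom_trans_assoc, eqToHom_refl, Category.id_comp]
    rw [← Category.assoc (tensor k _ _), interchange _ _ (eval_mem F φ hφ hf) (eval_mem F φ hφ hg)]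
    simp
  | tensor_assoc f g h =>
    simp only [eval, eval_eqTo, tensor_left_conj, tensor_right_conj, tensor_assoc]
    simp
  | one_tensor f =>
    simp only [eval, eval_eqTo, one_tensor_of_eq F.map_one]
    simp
  | tensor_one f =>
    simp only [eval, eval_eqTo, tensor_one_of_eq F.map_one]
    simp

/-- The universal property of a presented strict monoidal supercategory: values of the generators
that respect parities and relations extend to a monoidal superfunctor. -/
def lift (hφ : ∀ g, φ g ∈ Supercategory.parity (k := k) _ _ (P.par g))
    (hrel : ∀ {X Y : FreeMonoid L} {s t : Term k P.toSignature X Y}, P.rel s t →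
      eval F φ s = eval F φ t) : MonoidalSuperfunctor k P.Cat D where
  obj X := F X
  map {X Y} := Quot.lift (eval F φ) fun _ _ h => eval_rel F φ hφ hrel h
  map_id _ := rfl
  map_comp := by
    rintro _ _ _ ⟨f⟩ ⟨g⟩; rfl
  map_add := by
    rintro _ _ ⟨f⟩ ⟨g⟩; rfl
  map_smul := by
    rintro _ _ a ⟨f⟩; rfl
  map_mem := by
    rintro _ _ p _ ⟨t, ht, rfl⟩
    exact eval_mem F φ hφ ht
  obj_one := F.map_one
  obj_mul := F.map_mul
  map_tensor := by
    rintro _ _ _ _ ⟨f⟩ ⟨g⟩; rfl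

end Presentation
/-! ### Morphisms of the quantum isomeric supercategories -/

section Calculus

variable {k : Type u} [CommRing k] {z : k} {a : Bool}

/-- A word, as an object. -/
def ob (z : k) (a : Bool) (X : FreeMonoid Arrow) : (isoPres z a).Cat := X

variable (z) in
/-- The morphism depicted by an expression. -/
def mor {X Y : FreeMonoid Arrow} (t : Term k (isoSig a) X Y) : ob z a X ⟶ ob z a Y :=
  Presentation.cls (P := isoPres z a) t

variable (z) in
/-- The morphism depicted by an expression, tensored with an identity on the right. -/
def wh {X Y : FreeMonoid Arrow} (t : Term k (isoSig a) X Y) (Z : (isoPres z a).Cat) :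
    (tensorLeft k (ob z a X)).obj Z ⟶ (tensorLeft k (ob z a Y)).obj Z :=
  tensor k (mor z t) (𝟙 Z)

theorem mor_rel {X Y : FreeMonoid Arrow} {s t : Term k (isoSig a) X Y} (h : IsoRel z s t) :
    mor z s = mor z t := Presentation.cls_eq (P := isoPres z a) (.of h)

theorem mor_mem {X Y : FreeMonoid Arrow} {t : Term k (isoSig a) X Y} {p : ZMod 2}
    (h : t.Homog p) : mor z t ∈ Supercategory.parity (k := k) (ob z a X) (ob z a Y) p :=
  ⟨t, h, rfl⟩

theorem wh_mem {X Y : FreeMonoid Arrow} {t : Term k (isoSig a) X Y} {p : ZMod 2}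
    (h : t.Homog p) {Z : (isoPres z a).Cat} :
    wh z t Z ∈ Supercategory.parity (k := k) _ _ p := by
  have := tensor_mem (mor_mem (z := z) h) (Supercategory.id_mem (k := k) Z)
  rwa [add_zero] at this

theorem wh_rel {X Y : FreeMonoid Arrow} {s t : Term k (isoSig a) X Y} (h : IsoRel z s t)
    (Z : (isoPres z a).Cat) : wh z s Z = wh z t Z := by rw [wh, mor_rel h, wh]

theorem wh_one (X : FreeMonoid Arrow) (Z : (isoPres z a).Cat) :
    wh z (IsoTerm.one X) Z = 𝟙 _ := tensor_id (k := k) (ob z a X) Z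

theorem wh_comp {X Y Y' : FreeMonoid Arrow} (s : Term k (isoSig a) X Y)
    (t : Term k (isoSig a) Y Y') (Z : (isoPres z a).Cat) :
    wh z (s.comp t) Z = wh z s Z ≫ wh z t Z :=
  comp_tensor_id k (mor z s) (mor z t) Z

theorem wh_add {X Y : FreeMonoid Arrow} (s t : Term k (isoSig a) X Y) (Z : (isoPres z a).Cat) :
    wh z (s.add t) Z = wh z s Z + wh z t Z :=
  add_tensor (mor z s) (mor z t) (𝟙 Z)

theorem wh_smul {X Y : FreeMonoid Arrow} (b : k) (t : Term k (isoSig a) X Y)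
    (Z : (isoPres z a).Cat) : wh z (t.smul b) Z = b • wh z t Z :=
  smul_tensor b (mor z t) (𝟙 Z)

theorem wh_zero (X Y : FreeMonoid Arrow) (Z : (isoPres z a).Cat) :
    wh z (Term.zero (k := k) (S := isoSig a) X Y) Z = 0 := by
  have := smul_tensor (0 : k) (0 : ob z a X ⟶ ob z a Y) (𝟙 Z)
  rw [zero_smul, zero_smul] at this
  exact this

theorem wh_tensor_one {X Y : FreeMonoid Arrow} (t : Term k (isoSig a) X Y) (V : FreeMonoid Arrow)
    (Z : (isoPres z a).Cat) : wh z (t.tensor (IsoTerm.one V)) Z =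
      eqToHom (mul_assoc (ob z a X) (ob z a V) Z) ≫ wh z t (ob z a V * Z) ≫
        eqToHom (mul_assoc (ob z a Y) (ob z a V) Z).symm := by
  have := tensor_assoc (k := k) (mor z t) (𝟙 (ob z a V)) (𝟙 Z)
  rw [tensor_id] at this
  exact this

theorem wh_one_tensor {X Y : FreeMonoid Arrow} (V : FreeMonoid Arrow) (t : Term k (isoSig a) X Y)
    (Z : (isoPres z a).Cat) : wh z ((IsoTerm.one V).tensor t) Z =
      eqToHom (mul_assoc (ob z a V) (ob z a X) Z) ≫ (tensorLeft k (ob z a V)).map (wh z t Z) ≫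
        eqToHom (mul_assoc (ob z a V) (ob z a Y) Z).symm :=
  tensor_assoc (k := k) (𝟙 (ob z a V)) (mor z t) (𝟙 Z)

theorem wh_natural {X Y : FreeMonoid Arrow} {t : Term k (isoSig a) X Y} {p q : ZMod 2}
    (h : t.Homog p) {Z Z' : (isoPres z a).Cat} {g : Z ⟶ Z'}
    (hg : g ∈ Supercategory.parity (k := k) Z Z' q) :
    wh z t Z ≫ (tensorLeft k (ob z a Y)).map g =
      sgn k p q • ((tensorLeft k (ob z a X)).map g ≫ wh z t Z') :=
  tensor_exchange k (mor_mem h) hg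

theorem wh_natural_even {X Y : FreeMonoid Arrow} {t : Term k (isoSig a) X Y}
    (h : t.Homog 0) {Z Z' : (isoPres z a).Cat} (g : Z ⟶ Z') :
    wh z t Z ≫ (tensorLeft k (ob z a Y)).map g =
      (tensorLeft k (ob z a X)).map g ≫ wh z t Z' := by
  obtain ⟨b, hb, c, hc, rfl⟩ := exists_parity k g
  rw [Superfunctor.map_add, Superfunctor.map_add, Preadditive.comp_add, Preadditive.add_comp,
    wh_natural h hb, wh_natural h hc, sgn_zero_left, one_smul, sgn_zero_left, one_smul]

/-- The endosuperfunctors `↑ ⊗ -` and `↓ ⊗ -`. -/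
def lf (z : k) (a : Bool) (c : Arrow) : SEnd k (isoPres z a).Cat :=
  tensorLeft k (ob z a (FreeMonoid.of c))


theorem lf_lf (c d : Arrow) {Z Z' : (isoPres z a).Cat} (g : Z ⟶ Z') :
    (tensorLeft k (ob z a (FreeMonoid.of c * FreeMonoid.of d))).map g =
      (lf z a c).map ((lf z a d).map g) := by
  have := tensor_assoc (k := k) (𝟙 (ob z a (FreeMonoid.of c)))
    (𝟙 (ob z a (FreeMonoid.of d))) g
  rw [tensor_id] at this
  refine this.trans ?_
  exact (Category.id_comp _).trans (Category.comp_id _)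

theorem lf_one {Z Z' : (isoPres z a).Cat} (g : Z ⟶ Z') :
    (tensorLeft k (ob z a 1)).map g = g := by
  have := one_tensor (k := k) g
  exact this.trans ((Category.id_comp _).trans (Category.comp_id _))

def Pc (Z : (isoPres z a).Cat) : (lf z a .up).obj ((lf z a .up).obj Z) ⟶ (lf z a .up).obj ((lf z a .up).obj Z) :=
  wh z (X := up * up) (Y := up * up) IsoTerm.pos Z
def Nc (Z : (isoPres z a).Cat) : (lf z a .up).obj ((lf z a .up).obj Z) ⟶ (lf z a .up).obj ((lf z a .up).obj Z) :=
  wh z (X := up * up) (Y := up * up) IsoTerm.neg Z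
def Rc (Z : (isoPres z a).Cat) : (lf z a .up).obj ((lf z a .down).obj Z) ⟶ (lf z a .down).obj ((lf z a .up).obj Z) :=
  wh z (X := up * dn) (Y := dn * up) IsoTerm.negRight Z
def Lc (Z : (isoPres z a).Cat) : (lf z a .down).obj ((lf z a .up).obj Z) ⟶ (lf z a .up).obj ((lf z a .down).obj Z) :=
  wh z (X := dn * up) (Y := up * dn) IsoTerm.posLeft Z
def Cap (Z : (isoPres z a).Cat) : (lf z a .down).obj ((lf z a .up).obj Z) ⟶ Z :=
  wh z (X := dn * up) (Y := 1) IsoTerm.leftCap Z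
def Cup (Z : (isoPres z a).Cat) : Z ⟶ (lf z a .up).obj ((lf z a .down).obj Z) :=
  wh z (X := 1) (Y := up * dn) IsoTerm.leftCup Z
def Tc (Z : (isoPres z a).Cat) : (lf z a .up).obj Z ⟶ (lf z a .up).obj Z :=
  wh z (X := up) (Y := up) IsoTerm.tok Z

variable {Z Z' : (isoPres z a).Cat} (g : Z ⟶ Z')

theorem Pc_nat : Pc Z ≫ (lf z a .up).map ((lf z a .up).map g) = (lf z a .up).map ((lf z a .up).map g) ≫ Pc Z' := by
  rw [← lf_lf]; exact wh_natural_even (.gen (S := isoSig a) IsoGen.pos) g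
theorem Nc_nat : Nc Z ≫ (lf z a .up).map ((lf z a .up).map g) = (lf z a .up).map ((lf z a .up).map g) ≫ Nc Z' := by
  rw [← lf_lf]; exact wh_natural_even (.gen (S := isoSig a) IsoGen.neg) g
theorem Rc_nat : Rc Z ≫ (lf z a .down).map ((lf z a .up).map g) = (lf z a .up).map ((lf z a .down).map g) ≫ Rc Z' := by
  rw [← lf_lf, ← lf_lf]; exact wh_natural_even (.gen (S := isoSig a) IsoGen.negRight) g
theorem Cap_nat : Cap Z ≫ g = (lf z a .down).map ((lf z a .up).map g) ≫ Cap Z' := by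
  have h := wh_natural_even (z := z) (.gen (S := isoSig a) IsoGen.leftCap) g
  rw [← lf_lf]
  exact (congrArg (Cap Z ≫ ·) (lf_one g)).symm.trans h
theorem Cup_nat : Cup Z ≫ (lf z a .up).map ((lf z a .down).map g) = g ≫ Cup Z' := by
  have h := wh_natural_even (z := z) (.gen (S := isoSig a) IsoGen.leftCup) g
  rw [← lf_lf]
  exact h.trans (congrArg (· ≫ Cup Z') (lf_one g))
theorem Pc_Nc : Pc Z ≫ Nc Z = 𝟙 ((lf z a .up).obj ((lf z a .up).obj Z)) := by
  have h := wh_rel (z := z) (a := a) .pos_neg Z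
  rw [wh_comp, wh_one] at h
  exact h
theorem Nc_Pc : Nc Z ≫ Pc Z = 𝟙 ((lf z a .up).obj ((lf z a .up).obj Z)) := by
  have h := wh_rel (z := z) (a := a) .neg_pos Z
  rw [wh_comp, wh_one] at h
  exact h
theorem Rc_Lc : Rc Z ≫ Lc Z = 𝟙 ((lf z a .up).obj ((lf z a .down).obj Z)) := by
  have h := wh_rel (z := z) (a := a) .right_left Z
  rw [wh_comp, wh_one] at h
  exact h
theorem Lc_Rc : Lc Z ≫ Rc Z = 𝟙 ((lf z a .down).obj ((lf z a .up).obj Z)) := by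
  have h := wh_rel (z := z) (a := a) .left_right Z
  rw [wh_comp, wh_one] at h
  exact h
theorem skein : Pc Z - Nc Z = z • 𝟙 ((lf z a .up).obj ((lf z a .up).obj Z)) := by
  have h := wh_rel (z := z) (a := a) .skein Z
  rw [wh_add, wh_smul, wh_smul, wh_one, neg_one_smul, ← sub_eq_add_neg] at h
  exact h
theorem Tc_Tc : Tc Z ≫ Tc Z = -𝟙 ((lf z a .up).obj Z) := by
  have h := wh_rel (z := z) (a := a) .tok_tok Z
  rw [wh_comp, wh_smul, wh_one, neg_one_smul] at h
  exact h

theorem wh_comp₃ {X Y Y' X' : FreeMonoid Arrow} (s : Term k (isoSig a) X Y)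
    (t : Term k (isoSig a) Y Y') (u : Term k (isoSig a) Y' X') (Z : (isoPres z a).Cat) :
    wh z (s.comp (t.comp u)) Z = wh z s Z ≫ wh z t Z ≫ wh z u Z := by
  rw [wh_comp, wh_comp]

theorem wh_pos_up : wh z (IsoTerm.pos.tensor (IsoTerm.one up)) Z = Pc ((lf z a .up).obj Z) :=
  (wh_tensor_one IsoTerm.pos up Z).trans ((Category.id_comp _).trans (Category.comp_id _))
theorem wh_up_pos : wh z ((IsoTerm.one up).tensor IsoTerm.pos) Z = (lf z a .up).map (Pc Z) :=
  (wh_one_tensor up IsoTerm.pos Z).trans ((Category.id_comp _).trans (Category.comp_id _))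
theorem wh_tok_up : wh z (IsoTerm.tok.tensor (IsoTerm.one up)) Z = Tc ((lf z a .up).obj Z) :=
  (wh_tensor_one IsoTerm.tok up Z).trans ((Category.id_comp _).trans (Category.comp_id _))
theorem wh_tok_dn : wh z (IsoTerm.tok.tensor (IsoTerm.one dn)) Z = Tc ((lf z a .down).obj Z) :=
  (wh_tensor_one IsoTerm.tok dn Z).trans ((Category.id_comp _).trans (Category.comp_id _))
theorem wh_up_tok : wh z ((IsoTerm.one up).tensor IsoTerm.tok) Z = (lf z a .up).map (Tc Z) :=
  (wh_one_tensor up IsoTerm.tok Z).trans ((Category.id_comp _).trans (Category.comp_id _))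

theorem braid : Pc ((lf z a .up).obj Z) ≫ (lf z a .up).map (Pc Z) ≫ Pc ((lf z a .up).obj Z) =
    (lf z a .up).map (Pc Z) ≫ Pc ((lf z a .up).obj Z) ≫ (lf z a .up).map (Pc Z) := by
  rw [← wh_pos_up, ← wh_up_pos]
  exact (wh_comp₃ _ _ _ Z).symm.trans ((wh_rel (z := z) (a := a) .braid Z).trans
    (wh_comp₃ (Y := up * up * up) (Y' := up * up * up) (X' := up * up * up) _ _ _ Z))

theorem Tc_Pc : Tc ((lf z a .up).obj Z) ≫ Pc Z = Pc Z ≫ (lf z a .up).map (Tc Z) := by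
  rw [← wh_tok_up, ← wh_up_tok]
  exact (wh_comp _ _ Z).symm.trans ((wh_rel (z := z) (a := a) .tok_pos Z).trans (wh_comp _ _ Z))

theorem zigzag_up : Cup ((lf z a .up).obj Z) ≫ (lf z a .up).map (Cap Z) = 𝟙 ((lf z a .up).obj Z) := by
  have h := wh_rel (z := z) (a := a) .zigzag_up Z
  have h1 : wh z (IsoTerm.leftCup.tensor (IsoTerm.one up)) Z = Cup ((lf z a .up).obj Z) :=
    (wh_tensor_one IsoTerm.leftCup up Z).trans ((Category.id_comp _).trans (Category.comp_id _))
  have h2 : wh z ((IsoTerm.one up).tensor IsoTerm.leftCap) Z = (lf z a .up).map (Cap Z) :=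
    (wh_one_tensor up IsoTerm.leftCap Z).trans ((Category.id_comp _).trans (Category.comp_id _))
  rw [← h1, ← h2]
  exact (wh_comp (X := up) (Y := up * dn * up) (Y' := up) _ _ Z).symm.trans
    (h.trans (wh_one up Z))

theorem zigzag_down : (lf z a .down).map (Cup Z) ≫ Cap ((lf z a .down).obj Z) = 𝟙 ((lf z a .down).obj Z) := by
  have h := wh_rel (z := z) (a := a) .zigzag_down Z
  have h1 : wh z ((IsoTerm.one dn).tensor IsoTerm.leftCup) Z = (lf z a .down).map (Cup Z) :=
    (wh_one_tensor dn IsoTerm.leftCup Z).trans ((Category.id_comp _).trans (Category.comp_id _))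
  have h2 : wh z (IsoTerm.leftCap.tensor (IsoTerm.one dn)) Z = Cap ((lf z a .down).obj Z) :=
    (wh_tensor_one IsoTerm.leftCap dn Z).trans ((Category.id_comp _).trans (Category.comp_id _))
  rw [← h1, ← h2]
  exact (wh_comp (X := dn) (Y := dn * up * dn) (Y' := dn) _ _ Z).symm.trans
    (h.trans (wh_one dn Z))

theorem wh_rotate (c : Term k (isoSig a) (up * up) (up * up))
    (f : (lf z a .up).obj ((lf z a .up).obj ((lf z a .down).obj Z)) ⟶ (lf z a .up).obj ((lf z a .up).obj ((lf z a .down).obj Z)))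
    (hf : wh z c ((lf z a .down).obj Z) = f) :
    wh z (X := dn * up) (Y := up * dn) (IsoTerm.rotate c) Z =
      (show (lf z a .down).obj ((lf z a .up).obj Z) ⟶ (lf z a .up).obj ((lf z a .down).obj Z) from
        (lf z a .down).map ((lf z a .up).map (Cup Z)) ≫ (lf z a .down).map f ≫ Cap ((lf z a .up).obj ((lf z a .down).obj Z))) := by
  have h1 : wh z ((IsoTerm.one (dn * up)).tensor IsoTerm.leftCup) Z =
      (lf z a .down).map ((lf z a .up).map (Cup Z)) := by
    rw [← lf_lf]
    exact (wh_one_tensor _ IsoTerm.leftCup Z).trans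
      ((Category.id_comp _).trans (Category.comp_id _))
  have h2 : wh z ((IsoTerm.one dn).tensor (c.tensor (IsoTerm.one dn))) Z = (lf z a .down).map f := by
    refine (wh_one_tensor dn _ Z).trans ((Category.id_comp _).trans ((Category.comp_id _).trans ?_))
    have h3 := (wh_tensor_one c dn Z).trans ((Category.id_comp _).trans (Category.comp_id _))
    exact congrArg (lf z a .down).map (h3.trans hf)
  have h3 : wh z (IsoTerm.leftCap.tensor (IsoTerm.one (up * dn))) Z =
      Cap ((lf z a .up).obj ((lf z a .down).obj Z)) :=
    (wh_tensor_one IsoTerm.leftCap _ Z).trans ((Category.id_comp _).trans (Category.comp_id _))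
  rw [← h1, ← h2, ← h3]
  exact wh_comp₃ (X := dn * up) (Y := dn * up * up * dn) (Y' := dn * up * up * dn)
    (X' := up * dn) _ _ _ Z

theorem Lc_eq : Lc Z = (lf z a .down).map ((lf z a .up).map (Cup Z)) ≫ (lf z a .down).map (Pc ((lf z a .down).obj Z)) ≫
    Cap ((lf z a .up).obj ((lf z a .down).obj Z)) := wh_rotate IsoTerm.pos _ rfl

/-- The left crossing with the downward strand over. -/
def Mc (Z : (isoPres z a).Cat) : (lf z a .down).obj ((lf z a .up).obj Z) ⟶ (lf z a .up).obj ((lf z a .down).obj Z) :=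
  wh z (X := dn * up) (Y := up * dn) IsoTerm.negLeft Z
/-- The right crossing with the downward strand over. -/
def Qc (Z : (isoPres z a).Cat) : (lf z a .up).obj ((lf z a .down).obj Z) ⟶ (lf z a .down).obj ((lf z a .up).obj Z) :=
  wh z (X := up * dn) (Y := dn * up) (IsoTerm.posRight z) Z

theorem Mc_eq : Mc Z = (lf z a .down).map ((lf z a .up).map (Cup Z)) ≫ (lf z a .down).map (Nc ((lf z a .down).obj Z)) ≫
    Cap ((lf z a .up).obj ((lf z a .down).obj Z)) := wh_rotate IsoTerm.neg _ rfl

theorem wh_rightCap : wh z (X := up * dn) (Y := 1) IsoTerm.rightCap Z = Rc Z ≫ Cap Z :=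
  wh_comp _ _ _
theorem wh_rightCup : wh z (X := 1) (Y := dn * up) IsoTerm.rightCup Z = Cup Z ≫ Rc Z :=
  wh_comp _ _ _

theorem Qc_eq : Qc Z = Rc Z + z • (Rc Z ≫ Cap Z ≫ Cup Z ≫ Rc Z) := by
  refine (wh_add _ _ Z).trans (congrArg₂ (· + ·) rfl ?_)
  refine (wh_smul z _ Z).trans (congrArg (z • ·) ?_)
  refine (wh_comp _ _ Z).trans ?_
  rw [wh_rightCap, wh_rightCup]
  exact Category.assoc _ _ _

theorem bubble : Cup Z ≫ Rc Z ≫ Cap Z = 0 := by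
  have h := (wh_rel (z := z) (a := a) .bubble Z).trans (wh_zero _ _ _)
  exact ((congrArg (Cup Z ≫ ·) wh_rightCap.symm).trans
    (wh_comp IsoTerm.leftCup IsoTerm.rightCap Z).symm).trans h

theorem bubble_tok : Cup Z ≫ Tc ((lf z a .down).obj Z) ≫ Rc Z ≫ Cap Z = 0 := by
  have h := (wh_rel (z := z) (a := a) .bubble_tok Z).trans (wh_zero _ _ _)
  exact ((congrArg₂ (Cup Z ≫ · ≫ ·) wh_tok_dn.symm wh_rightCap.symm).trans
    (wh_comp₃ IsoTerm.leftCup _ IsoTerm.rightCap Z).symm).trans h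

theorem SEnd.map_sub' (F : SEnd k (isoPres z a).Cat) {X Y : (isoPres z a).Cat} (f g : X ⟶ Y) :
    F.map (f - g) = F.map f - F.map g := by
  have h := F.map_add (f - g) g
  rw [sub_add_cancel] at h
  rw [h, add_sub_cancel_right]

theorem Lc_sub_Mc : Lc Z - Mc Z = z • (Cap Z ≫ Cup Z) := by
  rw [Lc_eq, Mc_eq, ← Preadditive.comp_sub, ← Preadditive.sub_comp, ← SEnd.map_sub', skein,
    Superfunctor.map_smul, CategoryTheory.Functor.map_id, Linear.smul_comp, Category.id_comp, Linear.comp_smul,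
    ← Cap_nat]

theorem Mc_eq' : Mc Z = Lc Z - z • (Cap Z ≫ Cup Z) := by rw [← Lc_sub_Mc, sub_sub_cancel]

theorem Qc_Mc : Qc Z ≫ Mc Z = 𝟙 ((lf z a .up).obj ((lf z a .down).obj Z)) := by
  have hb := bubble (Z := Z)
  rw [Qc_eq, Mc_eq']
  simp only [Preadditive.add_comp, Preadditive.comp_sub, Linear.comp_smul, Linear.smul_comp,
    Category.assoc, Rc_Lc, Category.comp_id]
  rw [reassoc_of% hb]
  simp

theorem Mc_Qc : Mc Z ≫ Qc Z = 𝟙 ((lf z a .down).obj ((lf z a .up).obj Z)) := by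
  have hb := bubble (Z := Z)
  have h1 := Lc_Rc (Z := Z)
  rw [Qc_eq, Mc_eq']
  simp only [Preadditive.sub_comp, Preadditive.comp_add, Linear.comp_smul, Linear.smul_comp,
    Category.assoc, Lc_Rc, reassoc_of% h1]
  rw [reassoc_of% hb]
  simp

theorem Cup_Qc : Cup Z ≫ Qc Z = Cup Z ≫ Rc Z := by
  have hb := bubble (Z := Z)
  rw [Qc_eq, Preadditive.comp_add, Linear.comp_smul, reassoc_of% hb]
  simp

theorem Mc_RCap : Mc Z ≫ Rc Z ≫ Cap Z = Cap Z := by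
  have hb := bubble (Z := Z)
  have h1 := Lc_Rc (Z := Z)
  rw [Mc_eq', Preadditive.sub_comp, reassoc_of% h1, Linear.smul_comp, Category.assoc, hb]
  simp

/-- A cap slides over a strand. -/
theorem Mc_Cap : (lf z a .down).map (Nc Z) ≫ Cap ((lf z a .up).obj Z) = Mc ((lf z a .up).obj Z) ≫ (lf z a .up).map (Cap Z) := by
  rw [Mc_eq, Category.assoc, Category.assoc, Cap_nat, ← Functor.map_comp_assoc, ← Functor.map_comp_assoc, 
    Category.assoc, Nc_nat, ← Category.assoc, ← Functor.map_comp, zigzag_up]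
  simp

theorem Cup_Mc : Cup ((lf z a .up).obj Z) ≫ (lf z a .up).map (Mc Z) = (lf z a .up).map (Cup Z) ≫ Nc ((lf z a .down).obj Z) := by
  rw [Mc_eq, Functor.map_comp, Functor.map_comp, ← Category.assoc, Cup_nat, Category.assoc,
    ← Category.assoc (Cup _), Cup_nat, Category.assoc, zigzag_up, Category.comp_id]

theorem Lc_Cap : (lf z a .down).map (Pc Z) ≫ Cap ((lf z a .up).obj Z) = Lc ((lf z a .up).obj Z) ≫ (lf z a .up).map (Cap Z) := by
  rw [Lc_eq, Category.assoc, Category.assoc, Cap_nat, ← Functor.map_comp_assoc,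
    ← Functor.map_comp_assoc, Category.assoc, Pc_nat, ← Category.assoc, ← Functor.map_comp,
    zigzag_up]
  simp

theorem Cup_Lc : Cup ((lf z a .up).obj Z) ≫ (lf z a .up).map (Lc Z) = (lf z a .up).map (Cup Z) ≫ Pc ((lf z a .down).obj Z) := by
  rw [Lc_eq, Functor.map_comp, Functor.map_comp, ← Category.assoc, Cup_nat, Category.assoc,
    ← Category.assoc (Cup _), Cup_nat, Category.assoc, zigzag_up, Category.comp_id]

theorem Tc_nat (h : g ∈ Supercategory.parity (k := k) Z Z' 0) :
    Tc Z ≫ (lf z a .up).map g = (lf z a .up).map g ≫ Tc Z' := by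
  have := wh_natural (z := z) (.gen (S := isoSig a) IsoGen.tok) h
  rw [sgn_zero_right, one_smul] at this
  exact this

theorem Lc_Tc : Lc Z ≫ Tc ((lf z a .down).obj Z) = (lf z a .down).map (Tc Z) ≫ Lc Z := by
  have hc : Cup Z ∈ Supercategory.parity (k := k) _ _ 0 := wh_mem IsoTerm.leftCup_homog
  have e : (lf z a .up).map (Cup Z) ≫ Pc ((lf z a .down).obj Z) ≫ (lf z a .up).map (Tc ((lf z a .down).obj Z)) =
      Tc Z ≫ (lf z a .up).map (Cup Z) ≫ Pc ((lf z a .down).obj Z) := by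
    rw [← Tc_Pc, ← Category.assoc, ← Tc_nat _ hc, Category.assoc]
  have e' := congrArg (lf z a .down).map e
  simp only [Functor.map_comp] at e'
  rw [Lc_eq, Category.assoc, Category.assoc, Cap_nat, ← Category.assoc, ← Category.assoc,
    Category.assoc ((lf z a .down).map _), e']
  simp only [Category.assoc]

theorem Rc_Tc : Tc ((lf z a .down).obj Z) ≫ Rc Z = Rc Z ≫ (lf z a .down).map (Tc Z) := by
  have h1 := Rc_Lc (Z := Z)
  have h2 := Lc_Rc (Z := Z)
  calc Tc ((lf z a .down).obj Z) ≫ Rc Z = Rc Z ≫ (Lc Z ≫ Tc ((lf z a .down).obj Z)) ≫ Rc Z := by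
        simp only [Category.assoc]; rw [reassoc_of% h1]
    _ = _ := by
        rw [Lc_Tc, Category.assoc, h2, Category.comp_id]

theorem braid_Nc : Nc ((lf z a .up).obj Z) ≫ (lf z a .up).map (Nc Z) ≫ Pc ((lf z a .up).obj Z) =
    (lf z a .up).map (Pc Z) ≫ Nc ((lf z a .up).obj Z) ≫ (lf z a .up).map (Nc Z) := by
  have hb := braid (Z := Z)
  have h1 := Nc_Pc (Z := (lf z a .up).obj Z)
  have h2 := Pc_Nc (Z := (lf z a .up).obj Z)
  have h3 : (lf z a .up).map (Nc Z) ≫ (lf z a .up).map (Pc Z) = 𝟙 _ := by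
    rw [← Functor.map_comp, Nc_Pc, CategoryTheory.Functor.map_id]
  have h4 : (lf z a .up).map (Pc Z) ≫ (lf z a .up).map (Nc Z) = 𝟙 _ := by
    rw [← Functor.map_comp, Pc_Nc, CategoryTheory.Functor.map_id]
  calc _ = Nc ((lf z a .up).obj Z) ≫ (lf z a .up).map (Nc Z) ≫ (Pc ((lf z a .up).obj Z) ≫ (lf z a .up).map (Pc Z) ≫
        Pc ((lf z a .up).obj Z)) ≫ Nc ((lf z a .up).obj Z) ≫ (lf z a .up).map (Nc Z) := by
        simp only [Category.assoc]; rw [reassoc_of% h2, h4, Category.comp_id]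
    _ = _ := by
        rw [hb]; simp only [Category.assoc]; rw [reassoc_of% h3, reassoc_of% h1]

theorem braid_Pc : Nc ((lf z a .up).obj Z) ≫ (lf z a .up).map (Pc Z) ≫ Pc ((lf z a .up).obj Z) =
    (lf z a .up).map (Pc Z) ≫ Pc ((lf z a .up).obj Z) ≫ (lf z a .up).map (Nc Z) := by
  have hb := braid (Z := Z)
  have h1 := Nc_Pc (Z := (lf z a .up).obj Z)
  have h4 : (lf z a .up).map (Pc Z) ≫ (lf z a .up).map (Nc Z) = 𝟙 _ := by
    rw [← Functor.map_comp, Pc_Nc, CategoryTheory.Functor.map_id]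
  calc _ = Nc ((lf z a .up).obj Z) ≫ ((lf z a .up).map (Pc Z) ≫ Pc ((lf z a .up).obj Z) ≫ (lf z a .up).map (Pc Z)) ≫
        (lf z a .up).map (Nc Z) := by
        simp only [Category.assoc]; rw [h4, Category.comp_id]
    _ = _ := by
        rw [← hb]; simp only [Category.assoc]; rw [reassoc_of% h1]

theorem Lc_Lc : Lc ((lf z a .up).obj Z) ≫ (lf z a .up).map (Lc Z) = (lf z a .down).map ((lf z a .up).map ((lf z a .up).map (Cup Z)) ≫
    (lf z a .up).map (Pc ((lf z a .down).obj Z)) ≫ Pc ((lf z a .up).obj ((lf z a .down).obj Z))) ≫ Cap _ := by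
  have hz : (lf z a .up).map (Cup ((lf z a .up).obj ((lf z a .up).obj ((lf z a .down).obj Z)))) ≫
      (lf z a .up).map ((lf z a .up).map (Cap ((lf z a .up).obj ((lf z a .down).obj Z)))) = 𝟙 _ := by
    rw [← Functor.map_comp, zigzag_up, CategoryTheory.Functor.map_id]
  rw [Lc_eq, Lc_eq, Category.assoc, Category.assoc, Cap_nat, ← Functor.map_comp_assoc,
    ← Functor.map_comp_assoc]
  congr 2
  have e : (lf z a .up).map (Cup ((lf z a .up).obj Z)) ≫ (lf z a .up).map ((lf z a .up).map ((lf z a .down).map ((lf z a .up).map (Cup Z) ≫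
      Pc ((lf z a .down).obj Z)))) = (lf z a .up).map ((lf z a .up).map (Cup Z) ≫ Pc ((lf z a .down).obj Z)) ≫
        (lf z a .up).map (Cup ((lf z a .up).obj ((lf z a .up).obj ((lf z a .down).obj Z)))) := by
    rw [← Functor.map_comp, Cup_nat, Functor.map_comp]
  rw [Category.assoc, Pc_nat, ← Category.assoc ((lf z a .down).map _), ← Functor.map_comp (lf z a .down).toFunctor,
    Functor.map_comp (lf z a .up).toFunctor ((lf z a .down).map _), Functor.map_comp (lf z a .up).toFunctor ((lf z a .up).map _)]
  simp only [Category.assoc]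
  rw [reassoc_of% e, reassoc_of% hz, Functor.map_comp, Category.assoc]

theorem Nc_Lc_Lc : (lf z a .down).map (Nc Z) ≫ Lc ((lf z a .up).obj Z) ≫ (lf z a .up).map (Lc Z) =
    Lc ((lf z a .up).obj Z) ≫ (lf z a .up).map (Lc Z) ≫ Nc ((lf z a .down).obj Z) := by
  rw [Lc_Lc, ← Category.assoc, ← Functor.map_comp, ← Category.assoc (Lc _), Lc_Lc,
    Category.assoc, Cap_nat, ← Category.assoc ((lf z a .down).map _), ← Functor.map_comp]
  congr 2
  rw [← Category.assoc, Nc_nat]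
  simp only [Category.assoc]
  rw [braid_Pc]

/-- The bubble, passing through an upward strand. -/
theorem RCup_up : (Cup ((lf z a .up).obj Z) ≫ Rc ((lf z a .up).obj Z)) ≫ (lf z a .down).map (Nc Z) =
    (lf z a .up).map (Cup Z ≫ Rc Z) ≫ Rc ((lf z a .up).obj Z) := by
  have h1 := Rc_Lc (Z := (lf z a .up).obj Z)
  have h2 := Lc_Rc (Z := (lf z a .up).obj Z)
  have h3 : (lf z a .up).map (Lc Z) ≫ (lf z a .up).map (Rc Z) = 𝟙 _ := by
    rw [← Functor.map_comp, Lc_Rc, CategoryTheory.Functor.map_id]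
  have h4 := Pc_Nc (Z := (lf z a .down).obj Z)
  have h5 := Cup_Lc (Z := Z)
  have h6 := Nc_Lc_Lc (Z := Z)
  calc _ = Cup ((lf z a .up).obj Z) ≫ Rc ((lf z a .up).obj Z) ≫ ((lf z a .down).map (Nc Z) ≫ Lc ((lf z a .up).obj Z) ≫
        (lf z a .up).map (Lc Z)) ≫ (lf z a .up).map (Rc Z) ≫ Rc ((lf z a .up).obj Z) := by
        simp only [Category.assoc]; rw [reassoc_of% h3, h2, Category.comp_id]
    _ = _ := by
        rw [h6]; simp only [Category.assoc]
        rw [reassoc_of% h1, reassoc_of% h5, reassoc_of% h4, Functor.map_comp, Category.assoc]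

/-! ### Crossing a strand under a word, and the collapsing superfunctor -/

/-- The crossing `↑ ⊗ c → c ⊗ ↑` in which the strand labelled `c` is over. -/
def crossUnder (Z : (isoPres z a).Cat) :
    ∀ c : Arrow, (lf z a .up).obj ((lf z a c).obj Z) ⟶ (lf z a c).obj ((lf z a .up).obj Z)
  | .up => Nc Z
  | .down => Qc Z

/-- The inverse crossing `c ⊗ ↑ → ↑ ⊗ c`; the strand labelled `c` is over. -/
def crossBack (Z : (isoPres z a).Cat) :
    ∀ c : Arrow, (lf z a c).obj ((lf z a .up).obj Z) ⟶ (lf z a .up).obj ((lf z a c).obj Z)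
  | .up => Pc Z
  | .down => Mc Z

variable (z a) in
/-- The crossing `↑ ⊗ X → X ⊗ ↑` of a strand with the strands of a word, by recursion. -/
def underWord : ∀ X : List Arrow, (lf z a .up).obj (ob z a X) ⟶ ob z a X * ob z a up
  | [] => 𝟙 (ob z a up)
  | c :: X => crossUnder (ob z a X) c ≫ (lf z a c).map (underWord X)

variable (z a) in
/-- The crossing `X ⊗ ↑ → ↑ ⊗ X` of a strand with the strands of a word, by recursion. -/
def backWord : ∀ X : List Arrow, ob z a X * ob z a up ⟶ (lf z a .up).obj (ob z a X)
  | [] => 𝟙 (ob z a up)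
  | c :: X => (lf z a c).map (backWord X) ≫ crossBack (ob z a X) c

/-- The crossing `↑ ⊗ X → X ⊗ ↑` in which all strands of `X` are over. -/
def under (X : (isoPres z a).Cat) : (lf z a .up).obj X ⟶ X * ob z a up := underWord z a X

/-- The crossing `X ⊗ ↑ → ↑ ⊗ X` in which all strands of `X` are over. -/
def back (X : (isoPres z a).Cat) : X * ob z a up ⟶ (lf z a .up).obj X := backWord z a X

theorem under_lf (c : Arrow) (X : (isoPres z a).Cat) :
    under ((lf z a c).obj X) = crossUnder X c ≫ (lf z a c).map (under X) := rfl

theorem back_lf (c : Arrow) (X : (isoPres z a).Cat) :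
    back ((lf z a c).obj X) = (lf z a c).map (back X) ≫ crossBack X c := rfl

@[elab_as_elim]
theorem word_induction {p : (isoPres z a).Cat → Prop} (h1 : p (ob z a 1))
    (h : ∀ c X, p X → p ((lf z a c).obj X)) (X : (isoPres z a).Cat) : p X := by
  have : ∀ X : List Arrow, p (ob z a X) := fun X => by
    induction X with
    | nil => exact h1
    | cons c X ih => exact h c _ ih
  exact this X

/-- Tensoring with `↑` on the right. -/
def rt {X Y : (isoPres z a).Cat} (f : X ⟶ Y) : X * ob z a up ⟶ Y * ob z a up :=
  tensor k f (𝟙 (ob z a up))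

theorem cross_cross (c : Arrow) : crossUnder Z c ≫ crossBack Z c = 𝟙 _ := by
  cases c
  · exact Nc_Pc
  · exact Qc_Mc

theorem cross_cross' (c : Arrow) : crossBack Z c ≫ crossUnder Z c = 𝟙 _ := by
  cases c
  · exact Pc_Nc
  · exact Mc_Qc

theorem under_back (X : (isoPres z a).Cat) : under X ≫ back X = 𝟙 _ := by
  induction X using word_induction with
  | h1 => exact Category.id_comp _
  | h c X ih =>
    have h : (lf z a c).map (under X) ≫ (lf z a c).map (back X) = 𝟙 _ := by
      rw [← Functor.map_comp, ih, CategoryTheory.Functor.map_id]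
    have h2 : crossUnder X c ≫ (lf z a c).map (under X) ≫ (lf z a c).map (back X) ≫
        crossBack X c = 𝟙 _ := by rw [reassoc_of% h, cross_cross]
    exact (Category.assoc _ _ _).trans h2

theorem back_under (X : (isoPres z a).Cat) : back X ≫ under X = 𝟙 _ := by
  induction X using word_induction with
  | h1 => exact Category.id_comp _
  | h c X ih =>
    have h := cross_cross' (Z := X) c
    have h2 : (lf z a c).map (back X) ≫ crossBack X c ≫ crossUnder X c ≫
        (lf z a c).map (under X) = 𝟙 _ := by
      rw [reassoc_of% h, ← Functor.map_comp, ih, CategoryTheory.Functor.map_id]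
    exact (Category.assoc _ _ _).trans h2

theorem posRight_homog : (IsoTerm.posRight z : Term k (isoSig a) _ _).Homog 0 :=
  .add IsoTerm.negRight_homog (.smul _ (.comp IsoTerm.rightCap_homog
    (.comp IsoTerm.leftCup_homog IsoTerm.negRight_homog)))

theorem crossUnder_mem (c : Arrow) :
    crossUnder Z c ∈ Supercategory.parity (k := k) _ _ 0 := by
  cases c
  · exact wh_mem IsoTerm.neg_homog
  · exact wh_mem posRight_homog

theorem crossBack_mem (c : Arrow) :
    crossBack Z c ∈ Supercategory.parity (k := k) _ _ 0 := by
  cases c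
  · exact wh_mem IsoTerm.pos_homog
  · exact wh_mem (IsoTerm.rotate_homog IsoTerm.neg_homog)

theorem crossUnder_nat (c : Arrow) : crossUnder Z c ≫ (lf z a c).map ((lf z a .up).map g) =
    (lf z a .up).map ((lf z a c).map g) ≫ crossUnder Z' c := by
  cases c
  · exact Nc_nat g
  · rw [← lf_lf, ← lf_lf]; exact wh_natural_even posRight_homog g

theorem under_mem (X : (isoPres z a).Cat) :
    under X ∈ Supercategory.parity (k := k) _ _ 0 := by
  induction X using word_induction with
  | h1 => exact Supercategory.id_mem _
  | h c X ih =>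
    have := Supercategory.comp_mem (crossUnder_mem (Z := X) c) ((lf z a c).map_mem ih)
    rw [add_zero] at this
    exact this

theorem back_mem (X : (isoPres z a).Cat) :
    back X ∈ Supercategory.parity (k := k) _ _ 0 := by
  induction X using word_induction with
  | h1 => exact Supercategory.id_mem _
  | h c X ih =>
    have := Supercategory.comp_mem ((lf z a c).map_mem ih) (crossBack_mem (Z := X) c)
    rw [add_zero] at this
    exact this

/-- Naturality of `under` for one morphism. -/
def Slides {X Y : (isoPres z a).Cat} (f : X ⟶ Y) : Prop :=
  under X ≫ rt f = (lf z a .up).map f ≫ under Y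

theorem rt_comp {X Y Y' : (isoPres z a).Cat} (f : X ⟶ Y) (g : Y ⟶ Y') :
    rt (f ≫ g) = rt f ≫ rt g := comp_tensor_id k f g _

theorem rt_id (X : (isoPres z a).Cat) : rt (𝟙 X) = 𝟙 _ := tensor_id _ _

theorem Slides.id (X : (isoPres z a).Cat) : Slides (𝟙 X) := by
  rw [Slides, rt_id, CategoryTheory.Functor.map_id]
  exact (Category.comp_id _).trans (Category.id_comp _).symm

theorem Slides.eqToHom {X Y : (isoPres z a).Cat} (h : X = Y) : Slides (eqToHom h) := by
  subst h; exact Slides.id X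

theorem Slides.comp {X Y Y' : (isoPres z a).Cat} {f : X ⟶ Y} {g : Y ⟶ Y'} (hf : Slides f)
    (hg : Slides g) : Slides (f ≫ g) := by
  have h1 : under X ≫ rt f = (lf z a .up).map f ≫ under Y := hf
  have h2 : under Y ≫ rt g = (lf z a .up).map g ≫ under Y' := hg
  rw [Slides, rt_comp, reassoc_of% h1, h2, Functor.map_comp]
  exact (Category.assoc _ _ _).symm

theorem Slides.inv {X Y : (isoPres z a).Cat} {f : X ⟶ Y} {g : Y ⟶ X} (hf : Slides f)
    (h : f ≫ g = 𝟙 X) (h' : g ≫ f = 𝟙 Y) : Slides g := by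
  have h1 : under X ≫ rt f = (lf z a .up).map f ≫ under Y := hf
  have h2 : (lf z a .up).map g ≫ (lf z a .up).map f = 𝟙 _ := by
    rw [← Functor.map_comp, h', CategoryTheory.Functor.map_id]
  have h3 : rt f ≫ rt g = 𝟙 _ := by rw [← rt_comp, h, rt_id]
  have h4 : (lf z a .up).map g ≫ under X ≫ rt f = under Y := by
    rw [h1, reassoc_of% h2]
  rw [Slides, ← h4]
  simp only [Category.assoc]
  rw [h3, Category.comp_id]

theorem Slides.add {X Y : (isoPres z a).Cat} {f g : X ⟶ Y} (hf : Slides f) (hg : Slides g) :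
    Slides (f + g) := by
  have h1 : under X ≫ rt f = (lf z a .up).map f ≫ under Y := hf
  have h2 : under X ≫ rt g = (lf z a .up).map g ≫ under Y := hg
  have h3 : rt (f + g) = rt f + rt g := add_tensor _ _ _
  rw [Slides, h3, Preadditive.comp_add, h1, h2, Superfunctor.map_add]
  exact (Preadditive.add_comp _ _ _ _ _ _).symm

theorem Slides.smul {X Y : (isoPres z a).Cat} {f : X ⟶ Y} (b : k) (hf : Slides f) :
    Slides (b • f) := by
  have h1 : under X ≫ rt f = (lf z a .up).map f ≫ under Y := hf
  have h3 : rt (b • f) = b • rt f := smul_tensor _ _ _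
  rw [Slides, h3, Linear.comp_smul, h1, Superfunctor.map_smul]
  exact (Linear.smul_comp _ _ _ _ _ _).symm

theorem Slides.zero (X Y : (isoPres z a).Cat) : Slides (0 : X ⟶ Y) := by
  have h3 : rt (0 : X ⟶ Y) = 0 := by
    have := smul_tensor (0 : k) (0 : X ⟶ Y) (𝟙 (ob z a up))
    rw [zero_smul, zero_smul] at this
    exact this
  rw [Slides, h3, Superfunctor.map_zero]
  exact Limits.comp_zero.trans Limits.zero_comp.symm

theorem Slides.letter {X Y : (isoPres z a).Cat} {f : X ⟶ Y} (c : Arrow) (hf : Slides f) :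
    Slides ((lf z a c).map f) := by
  have h1 : under X ≫ rt f = (lf z a .up).map f ≫ under Y := hf
  have h2 : rt ((lf z a c).map f) = (lf z a c).map (rt f) :=
    (tensor_assoc (k := k) (𝟙 (ob z a (FreeMonoid.of c))) f (𝟙 (ob z a up))).trans
      ((Category.id_comp _).trans (Category.comp_id _))
  have h5 := crossUnder_nat f c
  rw [Slides, h2, under_lf, under_lf]
  have h6 : crossUnder X c ≫ (lf z a c).map (under X) ≫
      (lf z a c).map (rt f) = (lf z a .up).map ((lf z a c).map f) ≫ crossUnder Y c ≫
        (lf z a c).map (under Y) := by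
    rw [← Functor.map_comp, h1, Functor.map_comp, reassoc_of% h5]
  exact (Category.assoc _ _ _).trans h6

/-! Generators slide. -/

theorem rt_wh {X Y : FreeMonoid Arrow} (t : Term k (isoSig a) X Y) :
    rt (wh z t Z) = eqToHom (mul_assoc _ _ _) ≫ wh z t (Z * ob z a up) ≫
      eqToHom (mul_assoc _ _ _).symm := by
  have := tensor_assoc (k := k) (mor z t) (𝟙 Z) (𝟙 (ob z a up))
  rw [tensor_id] at this
  exact this

theorem Slides.pos : Slides (Pc Z) := by
  have h : rt (Pc Z) = Pc (Z * ob z a up) :=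
    (rt_wh _).trans ((Category.id_comp _).trans (Category.comp_id _))
  have h1 : Nc ((lf z a .up).obj Z) ≫ (lf z a .up).map (Nc Z ≫ (lf z a .up).map (under Z)) ≫ Pc (Z * ob z a up) =
      (lf z a .up).map (Pc Z) ≫ Nc ((lf z a .up).obj Z) ≫ (lf z a .up).map (Nc Z ≫ (lf z a .up).map (under Z)) := by
    have hb := braid_Nc (Z := Z)
    rw [Functor.map_comp, Category.assoc, ← Pc_nat, reassoc_of% hb]
  rw [Slides, h]
  exact (Category.assoc _ _ _).trans h1

theorem Slides.neg : Slides (Nc Z) := Slides.pos.inv Pc_Nc Nc_Pc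

theorem Slides.tok : Slides (Tc Z) := by
  have h : rt (Tc Z) = Tc (Z * ob z a up) :=
    (rt_wh _).trans ((Category.id_comp _).trans (Category.comp_id _))
  have h0 : Nc Z ≫ Tc ((lf z a .up).obj Z) = (lf z a .up).map (Tc Z) ≫ Nc Z := by
    have h1 := Nc_Pc (Z := Z)
    calc _ = Nc Z ≫ (Tc ((lf z a .up).obj Z) ≫ Pc Z) ≫ Nc Z := by
          rw [Category.assoc, Pc_Nc, Category.comp_id]
      _ = _ := by rw [Tc_Pc, Category.assoc, reassoc_of% h1]
  have h1 : Nc Z ≫ (lf z a .up).map (under Z) ≫ Tc (Z * ob z a up) =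
      (lf z a .up).map (Tc Z) ≫ Nc Z ≫ (lf z a .up).map (under Z) := by
    rw [← Tc_nat _ (under_mem Z), reassoc_of% h0]
  rw [Slides, h]
  exact (Category.assoc _ _ _).trans h1

theorem Slides.leftCap : Slides (Cap Z) := by
  have h : rt (Cap Z) = Cap (Z * ob z a up) :=
    (rt_wh _).trans ((Category.id_comp _).trans (Category.comp_id _))
  have h1 : Qc ((lf z a .up).obj Z) ≫ (lf z a .down).map (Nc Z ≫ (lf z a .up).map (under Z)) ≫ Cap (Z * ob z a up) =
      (lf z a .up).map (Cap Z) ≫ under Z := by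
    have h2 := Qc_Mc (Z := (lf z a .up).obj Z)
    have h3 := Mc_Cap (Z := Z)
    rw [Functor.map_comp, Category.assoc, ← Cap_nat, reassoc_of% h3, reassoc_of% h2]
  rw [Slides, h]
  exact (Category.assoc _ _ _).trans h1

theorem Slides.leftCup : Slides (Cup Z) := by
  have h : rt (Cup Z) = Cup (Z * ob z a up) :=
    (rt_wh _).trans ((Category.id_comp _).trans (Category.comp_id _))
  have h1 : under Z ≫ Cup (Z * ob z a up) =
      (lf z a .up).map (Cup Z) ≫ Nc ((lf z a .down).obj Z) ≫ (lf z a .up).map (Qc Z ≫ (lf z a .down).map (under Z)) := by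
    have h2 := Cup_Mc (Z := Z)
    have h3 : (lf z a .up).map (Mc Z) ≫ (lf z a .up).map (Qc Z) = 𝟙 _ := by
      rw [← Functor.map_comp, Mc_Qc, CategoryTheory.Functor.map_id]
    rw [← Cup_nat, Functor.map_comp, ← reassoc_of% h2, reassoc_of% h3]
  rw [Slides, h]
  exact h1

theorem Slides.posLeft : Slides (Lc Z) := by
  rw [Lc_eq]
  exact ((Slides.leftCup.letter _).letter _).comp ((Slides.pos.letter _).comp Slides.leftCap)

theorem Slides.negRight : Slides (Rc Z) := Slides.posLeft.inv Lc_Rc Rc_Lc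

theorem Slides.conj {X Y X' Y' : (isoPres z a).Cat} {f : X ⟶ Y} (hf : Slides f) (h : X' = X)
    (h' : Y = Y') : Slides (CategoryTheory.eqToHom h ≫ f ≫ CategoryTheory.eqToHom h') :=
  (Slides.eqToHom h).comp (hf.comp (Slides.eqToHom h'))

theorem Slides.left {X Y : (isoPres z a).Cat} {f : X ⟶ Y} (hf : Slides f)
    (V : (isoPres z a).Cat) : Slides ((tensorLeft k V).map f) := by
  induction V using word_induction with
  | h1 => rw [lf_one]; exact hf
  | h c V ih =>
    have h1 : (tensorLeft k ((lf z a c).obj V)).map f =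
        (lf z a c).map ((tensorLeft k V).map f) := by
      have := tensor_assoc (k := k) (𝟙 (ob z a (FreeMonoid.of c))) (𝟙 V) f
      rw [tensor_id] at this
      exact this.trans ((Category.id_comp _).trans (Category.comp_id _))
    rw [h1]
    exact ih.letter c

theorem Slides.wh : ∀ {X Y : FreeMonoid Arrow} (t : Term k (isoSig false) X Y)
    (Z : (isoPres z false).Cat), Slides (wh z t Z)
  | _, _, .gen g, Z => by
    cases g
    · exact Slides.pos (Z := Z)
    · exact Slides.neg (Z := Z)
    · exact Slides.negRight (Z := Z)
    · exact Slides.leftCap (Z := Z)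
    · exact Slides.leftCup (Z := Z)
    · exact Slides.tok (Z := Z)
  | _, _, .id X, Z => by
    have := wh_one (z := z) (a := false) X Z
    rw [IsoTerm.one] at this
    rw [this]; exact Slides.id _
  | _, _, .comp s t, Z => by
    rw [wh_comp]; exact (Slides.wh s Z).comp (Slides.wh t Z)
  | _, _, .zero X Y, Z => by
    rw [wh_zero]; exact Slides.zero _ _
  | _, _, .add s t, Z => by
    rw [wh_add]; exact (Slides.wh s Z).add (Slides.wh t Z)
  | _, _, .smul b t, Z => by
    rw [wh_smul]; exact (Slides.wh t Z).smul b
  | _, _, .tensor (X := X) (Y' := Y') s t, Z => by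
    have h1 := tensor_assoc (k := k) (mor z s) (mor z t) (𝟙 Z)
    rw [tensor_eq k (mor z s) (tensor k (mor z t) (𝟙 Z))] at h1
    have h2 : Isomeric.wh z (s.tensor t) Z = _ := h1
    rw [h2]
    exact Slides.conj (((Slides.wh t Z).left _).comp (Slides.wh s (ob z false Y' * Z))) _ _

theorem conj_symm {X Y X' Y' : (isoPres z a).Cat} {f : X ⟶ Y} {g : X' ⟶ Y'} (h : X' = X)
    (h' : Y = Y') (e : g = eqToHom h ≫ f ≫ eqToHom h') :
    f = eqToHom h.symm ≫ g ≫ eqToHom h'.symm := by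
  subst h; subst h'; simp [e]

theorem Cup_mem : Cup Z ∈ Supercategory.parity (k := k) _ _ 0 := wh_mem IsoTerm.leftCup_homog

theorem slides {X Y : QCat z} (f : X ⟶ Y) : under X ≫ rt f = (lf z false .up).map f ≫ under Y := by
  obtain ⟨t, ht⟩ := Quot.exists_rep (r := (isoPres z false).Rel (X := X) (Y := Y)) f
  have h1 : wh z t 1 = eqToHom (mul_one X) ≫ f ≫ eqToHom (mul_one Y).symm := by
    rw [← ht]; exact tensor_one (k := k) (mor z t)
  have h2 : f = eqToHom (mul_one X).symm ≫ wh z t 1 ≫ eqToHom (mul_one Y) := by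
    exact conj_symm _ _ h1
  rw [h2]
  exact (Slides.wh t 1).conj _ _

theorem slides_back {X Y : QCat z} (f : X ⟶ Y) : back X ≫ (lf z false .up).map f = rt f ≫ back Y := by
  have h1 := under_back Y
  have h2 := back_under X
  calc _ = back X ≫ ((lf z false .up).map f ≫ under Y) ≫ back Y := by
        rw [Category.assoc, under_back, Category.comp_id]
    _ = _ := by rw [← slides, Category.assoc, reassoc_of% h2]

variable (z) in
/-- The image of the open Clifford token under the collapsing superfunctor, at the object `X`:
the strand passes under `X`, carries a closed Clifford token, and passes back under `X`. -/
def loop (X : QCat z) : (lf z false .up).obj X ⟶ (lf z false .up).obj X :=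
  under X ≫ tensor k (𝟙 X) (mor z IsoTerm.tok) ≫ back X

theorem loop_mem (X : QCat z) : loop z X ∈ Supercategory.parity (k := k) _ _ 1 := by
  have h := tensor_mem (Supercategory.id_mem (k := k) X) (mor_mem (z := z) IsoTerm.tok_homog)
  have h2 := Supercategory.comp_mem (under_mem X) (Supercategory.comp_mem h (back_mem X))
  rw [add_zero, zero_add, zero_add] at h2
  exact h2

theorem loop_supernat :
    loop z ∈ supernat (k := k) (lf z false .up) (lf z false .up) 1 := by
  refine ⟨loop_mem, fun X Y q f hf => ?_⟩
  have h1 := tensor_exchange k hf (mor_mem (z := z) IsoTerm.tok_homog)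
  have h2 := slides f
  have h3 : tensor k (𝟙 X) (mor z IsoTerm.tok) ≫ rt f =
      sgn k 1 q • (rt f ≫ tensor k (𝟙 Y) (mor z IsoTerm.tok)) := by
    rw [rt, h1, smul_smul, sgn_comm 1 q, sgn_mul_self, one_smul]
  rw [loop, Category.assoc, Category.assoc, slides_back, reassoc_of% h3, loop]
  rw [Linear.smul_comp, Linear.comp_smul, Category.assoc, reassoc_of% h2]

variable (z) in
/-- The supernatural transformation `loop` of the endosuperfunctor `↑ ⊗ -`. -/
def loopNat : tensorLeft k (ob z false up) ⟶ tensorLeft k (ob z false up) :=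
  ⟨loop z, supernat_le _ _ _ loop_supernat⟩

variable (z) in
/-- The object part of the collapsing superfunctor, sending `X` to `X ⊗ -`. -/
def collapseObj : FreeMonoid Arrow →* SEnd k (QCat z) where
  toFun X := tensorLeft k (ob z false X)
  map_one' := tensorLeft_one k
  map_mul' X Y := tensorLeft_mul k (ob z false X) (ob z false Y)

variable (z) in
/-- The collapsing superfunctor on generating morphisms: a generating morphism `f` of the quantum
isomeric supercategory is sent to `f ⊗ -`, and the open Clifford token to `loop`. -/
def collapseGen : ∀ g : IsoGen true,
    collapseObj z ((isoSig true).dom g) ⟶ collapseObj z ((isoSig true).cod g)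
  | .pos => whisker k (mor z (a := false) IsoTerm.pos)
  | .neg => whisker k (mor z (a := false) IsoTerm.neg)
  | .negRight => whisker k (mor z (a := false) IsoTerm.negRight)
  | .leftCap => whisker k (mor z (a := false) IsoTerm.leftCap)
  | .leftCup => whisker k (mor z (a := false) IsoTerm.leftCup)
  | .tok => whisker k (mor z (a := false) IsoTerm.tok)
  | .opn => loopNat z

theorem collapseGen_mem (g : IsoGen true) :
    collapseGen z g ∈ Supercategory.parity (k := k) _ _ ((isoSig true).par g) := by
  cases g
  · exact supernat_whisker (mor_mem IsoTerm.pos_homog)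
  · exact supernat_whisker (mor_mem IsoTerm.neg_homog)
  · exact supernat_whisker (mor_mem IsoTerm.negRight_homog)
  · exact supernat_whisker (mor_mem IsoTerm.leftCap_homog)
  · exact supernat_whisker (mor_mem IsoTerm.leftCup_homog)
  · exact supernat_whisker (mor_mem IsoTerm.tok_homog)
  · exact loop_supernat

theorem loop_loop (X : QCat z) : loop z X ≫ loop z X = -𝟙 _ := by
  have h1 := back_under X
  have h2 : tensor k (𝟙 X) (mor z (a := false) IsoTerm.tok) ≫
      tensor k (𝟙 X) (mor z IsoTerm.tok) = -𝟙 _ := by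
    rw [← id_tensor_comp]
    have h3 : mor z (a := false) IsoTerm.tok ≫ mor z IsoTerm.tok = (-1 : k) • 𝟙 (ob z false up) :=
      mor_rel .tok_tok
    rw [h3, tensor_smul, tensor_id, neg_one_smul]
  rw [loop, Category.assoc, Category.assoc, reassoc_of% h1, reassoc_of% h2]
  rw [Preadditive.neg_comp, Preadditive.comp_neg, Category.id_comp, under_back]

theorem loop_lf (c : Arrow) (X : QCat z) : loop z ((lf z false c).obj X) =
    crossUnder X c ≫ (lf z false c).map (loop z X) ≫ crossBack X c := by
  have h1 : tensor k (𝟙 ((lf z false c).obj X)) (mor z (a := false) IsoTerm.tok) =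
      (lf z false c).map (tensor k (𝟙 X) (mor z IsoTerm.tok)) := by
    have := tensor_assoc (k := k) (𝟙 (ob z false (FreeMonoid.of c))) (𝟙 X)
      (mor z (a := false) IsoTerm.tok)
    rw [tensor_id] at this
    exact this.trans ((Category.id_comp _).trans (Category.comp_id _))
  have h2 : loop z ((lf z false c).obj X) = (crossUnder X c ≫ (lf z false c).map (under X)) ≫
      (lf z false c).map (tensor k (𝟙 X) (mor z IsoTerm.tok)) ≫
        (lf z false c).map (back X) ≫ crossBack X c := by
    rw [loop, h1]; rfl
  rw [h2, loop]
  simp only [Functor.map_comp, Category.assoc]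

/-- A bubble with a loop. -/
def bub (X : QCat z) : X ⟶ X := Cup X ≫ Rc X ≫ (lf z false .down).map (loop z X) ≫ Cap X

theorem bub_up (X : QCat z) : bub ((lf z false .up).obj X) = (lf z false .up).map (bub X) := by
  have h1 := RCup_up (Z := X)
  have h2 := Lc_Cap (Z := X)
  have h3 := Rc_nat (loop z X)
  have h4 := Rc_Lc (Z := (lf z false .up).obj X)
  rw [bub, loop_lf]
  simp only [crossUnder, crossBack, Functor.map_comp, Category.assoc]
  rw [h2]
  have h5 : Cup ((lf z false .up).obj X) ≫ Rc ((lf z false .up).obj X) ≫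
      (lf z false .down).map (Nc X) = (lf z false .up).map (Cup X ≫ Rc X) ≫
        Rc ((lf z false .up).obj X) := by rw [← h1, Category.assoc]
  rw [reassoc_of% h5, reassoc_of% h3, reassoc_of% h4, bub]
  simp only [Functor.map_comp, Category.assoc]

theorem bub_nat {X Y : QCat z} {f : X ⟶ Y} (hf : f ∈ Supercategory.parity (k := k) X Y 0) :
    bub X ≫ f = f ≫ bub Y := by
  have h1 := loop_supernat.2 hf
  rw [sgn_zero_right, one_smul] at h1
  have h2 := Cup_nat f
  have h3 := Rc_nat f
  rw [bub, Category.assoc, Category.assoc, Category.assoc, Cap_nat, ← Functor.map_comp_assoc, h1,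
    Functor.map_comp_assoc, reassoc_of% h3, reassoc_of% h2, bub]

/-- A bubble with a loop is zero. -/
theorem bub_eq (X : QCat z) : bub X = 0 := by
  induction X using word_induction with
  | h1 =>
    have h1 : loop z (ob z false 1) = Tc (ob z false 1) := by
      have e1 := one_tensor (k := k) (mor z (a := false) IsoTerm.tok)
      have e2 := tensor_one (k := k) (mor z (a := false) IsoTerm.tok)
      have e3 : tensor k (𝟙 (ob z false 1)) (mor z (a := false) IsoTerm.tok) =
        mor z IsoTerm.tok := e1.trans ((Category.id_comp _).trans (Category.comp_id _))
      have e4 : Tc (ob z false 1) = mor z IsoTerm.tok :=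
        e2.trans ((Category.id_comp _).trans (Category.comp_id _))
      rw [loop, e4]
      exact (Category.id_comp _).trans ((Category.comp_id _).trans e3)
    have h2 := Rc_Tc (Z := ob z false 1)
    rw [bub, h1, ← reassoc_of% h2, bubble_tok]
  | h c X ih =>
    cases c
    · rw [bub_up, ih, Superfunctor.map_zero]
    · have h1 := bub_nat (Cup_mem (Z := X))
      rw [ih, bub_up, Limits.zero_comp] at h1
      have h2 := zigzag_down (Z := X)
      calc bub ((lf z false .down).obj X) = ((lf z false .down).map (Cup X) ≫
            Cap ((lf z false .down).obj X)) ≫ bub ((lf z false .down).obj X) := by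
            rw [h2, Category.id_comp]
        _ = (lf z false .down).map (Cup X ≫ (lf z false .up).map
            (bub ((lf z false .down).obj X))) ≫ Cap ((lf z false .down).obj X) := by
            rw [Category.assoc, Cap_nat, Functor.map_comp, Category.assoc]
        _ = 0 := by rw [← h1, Superfunctor.map_zero, Limits.zero_comp]

theorem loop_bubble' (X : QCat z) :
    Cup X ≫ loop z ((lf z false .down).obj X) ≫ Rc X ≫ Cap X = 0 := by
  have h1 := Cup_Qc (Z := X)
  have h2 := Mc_RCap (Z := X)
  have h3 : Cup X ≫ Rc X ≫ _ = 0 := bub_eq X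
  rw [loop_lf]
  simp only [crossUnder, crossBack, Category.assoc]
  rw [h2, reassoc_of% h1, h3]

/-- The image of an expression in the affine generators, before passing to the quotient. -/
def collapseEval (z : k) {X Y : FreeMonoid Arrow} (t : Term k (isoSig true) X Y) :
    tensorLeft k (ob z false X) ⟶ tensorLeft k (ob z false Y) :=
  Presentation.eval (P := isoPres z true) (collapseObj z) (collapseGen z) t

/-- An affine expression without open tokens is sent to tensoring with the same diagram. -/
def Same (z : k) {X Y : FreeMonoid Arrow} (t : Term k (isoSig true) X Y)
    (t' : Term k (isoSig false) X Y) : Prop := collapseEval z t = whisker k (mor z t')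

namespace Same

variable {X Y X' Y' Y'' : FreeMonoid Arrow}

theorem pos : Same z IsoTerm.pos IsoTerm.pos := rfl
theorem neg : Same z IsoTerm.neg IsoTerm.neg := rfl
theorem negRight : Same z IsoTerm.negRight IsoTerm.negRight := rfl
theorem leftCap : Same z IsoTerm.leftCap IsoTerm.leftCap := rfl
theorem leftCup : Same z IsoTerm.leftCup IsoTerm.leftCup := rfl
theorem tok : Same z IsoTerm.tok IsoTerm.tok := rfl
theorem one (X : FreeMonoid Arrow) : Same z (IsoTerm.one X) (IsoTerm.one X) :=
  (whisker_id (k := k) (ob z false X)).symm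
theorem comp {s : Term k (isoSig true) X Y} {s' : Term k (isoSig false) X Y}
    {t : Term k (isoSig true) Y Y'} {t' : Term k (isoSig false) Y Y'} (hs : Same z s s')
    (ht : Same z t t') : Same z (s.comp t) (s'.comp t') := by
  have h : collapseEval z (s.comp t) = collapseEval z s ≫ collapseEval z t := rfl
  rw [Same, h, hs, ht]
  exact (whisker_comp (k := k) (mor z s') (mor z t')).symm
theorem tensor {s : Term k (isoSig true) X Y} {s' : Term k (isoSig false) X Y}
    {t : Term k (isoSig true) X' Y'} {t' : Term k (isoSig false) X' Y'} (hs : Same z s s')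
    (ht : Same z t t') : Same z (s.tensor t) (s'.tensor t') := by
  have h : collapseEval z (s.tensor t) = eqToHom (tensorLeft_mul k (ob z false X) _) ≫
      StrictMonoidalSupercategory.tensor k (collapseEval z s) (collapseEval z t) ≫
        eqToHom (tensorLeft_mul k (ob z false Y) _).symm := rfl
  rw [Same, h, hs, ht]
  exact (whisker_tensor (k := k) (mor z s') (mor z t')).symm
theorem add {s t : Term k (isoSig true) X Y} {s' t' : Term k (isoSig false) X Y}
    (hs : Same z s s') (ht : Same z t t') : Same z (s.add t) (s'.add t') := by
  have h : collapseEval z (s.add t) = collapseEval z s + collapseEval z t := rfl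
  rw [Same, h, hs, ht]
  exact (whisker_add (k := k) (mor z s') (mor z t')).symm
theorem smul {s : Term k (isoSig true) X Y} {s' : Term k (isoSig false) X Y} (b : k)
    (hs : Same z s s') : Same z (s.smul b) (s'.smul b) := by
  have h : collapseEval z (s.smul b) = b • collapseEval z s := rfl
  rw [Same, h, hs]
  exact (whisker_smul (k := k) b (mor z s')).symm
theorem zero (X Y : FreeMonoid Arrow) : Same z (Term.zero X Y) (Term.zero X Y) :=
  (whisker_zero (k := k) (ob z false X) (ob z false Y)).symm
theorem rotate {s : Term k (isoSig true) (up * up) (up * up)}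
    {s' : Term k (isoSig false) (up * up) (up * up)} (hs : Same z s s') :
    Same z (IsoTerm.rotate s) (IsoTerm.rotate s') :=
  comp (tensor (one _) leftCup) (comp (tensor (one _) (tensor hs (one _)))
    (tensor leftCap (one _)))
theorem rightCap : Same z IsoTerm.rightCap IsoTerm.rightCap := comp negRight leftCap

theorem rel {s t : Term k (isoSig true) X Y} {s' t' : Term k (isoSig false) X Y}
    (hs : Same z s s') (ht : Same z t t') (h : IsoRel z s' t') :
    collapseEval z s = collapseEval z t := by rw [hs, ht, mor_rel h]

end Same

theorem collapse_opn : collapseEval z IsoTerm.opn = loopNat z := rfl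

theorem app_tensor_eval {X Y X' Y' : FreeMonoid Arrow} (s : Term k (isoSig true) X Y)
    (t : Term k (isoSig true) X' Y') (Z : QCat z) :
    SEnd.app (collapseEval z (s.tensor t)) Z = eqToHom (mul_assoc (ob z false X) (ob z false X') Z) ≫
      ((tensorLeft k (ob z false X)).map (SEnd.app (collapseEval z t) Z) ≫
        SEnd.app (collapseEval z s) (ob z false Y' * Z)) ≫
          eqToHom (mul_assoc (ob z false Y) (ob z false Y') Z).symm := by
  have h : SEnd.app (collapseEval z (s.tensor t)) Z = SEnd.app (eqToHom (tensorLeft_mul k (ob z false X) (ob z false X'))) Z ≫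
      SEnd.app (tensor k (collapseEval z s) (collapseEval z t)) Z ≫
        SEnd.app (eqToHom (tensorLeft_mul k (ob z false Y) (ob z false Y')).symm) Z := rfl
  rw [h, SEnd.app_eqToHom, SEnd.app_eqToHom]
  rfl

theorem conj_id' {X Y : (isoPres z a).Cat} {f g : X ⟶ Y} (h : X = X) (h' : Y = Y) (e : f = g) :
    eqToHom h ≫ f ≫ eqToHom h' = g := by simp [e]

theorem collapse_rel {X Y : FreeMonoid Arrow} {s t : Term k (isoSig true) X Y}
    (h : IsoRel z s t) : collapseEval z s = collapseEval z t := by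
  cases h
  case pos_neg => exact Same.rel (Same.comp .pos .neg) (.one _) .pos_neg
  case neg_pos => exact Same.rel (Same.comp .neg .pos) (.one _) .neg_pos
  case right_left => exact Same.rel (Same.comp .negRight (.rotate .pos)) (.one _) .right_left
  case left_right => exact Same.rel (Same.comp (.rotate .pos) .negRight) (.one _) .left_right
  case braid =>
    have h1 := Same.tensor (z := z) .pos (.one up)
    have h2 := Same.tensor (z := z) (.one up) .pos
    exact Same.rel (h1.comp (h2.comp h1)) (h2.comp (h1.comp h2)) .braid
  case skein => exact Same.rel (Same.add .pos (.smul _ .neg)) (.smul _ (.one _)) .skein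
  case tok_tok => exact Same.rel (Same.comp .tok .tok) (.smul _ (.one _)) .tok_tok
  case tok_pos =>
    exact Same.rel (Same.comp (.tensor .tok (.one _)) .pos) (.comp .pos (.tensor (.one _) .tok)) .tok_pos
  case bubble_tok =>
    exact Same.rel (Same.comp .leftCup (.comp (.tensor .tok (.one _)) .rightCap)) (.zero _ _) .bubble_tok
  case bubble => exact Same.rel (Same.comp .leftCup .rightCap) (.zero _ _) .bubble
  case zigzag_up =>
    have h1 := Same.tensor (z := z) .leftCup (.one up)
    have h2 := Same.tensor (z := z) (.one up) .leftCap
    exact Same.rel (h1.comp h2) (.one _) .zigzag_up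
  case zigzag_down =>
    have h1 := Same.tensor (z := z) (.one dn) .leftCup
    have h2 := Same.tensor (z := z) .leftCap (.one dn)
    exact Same.rel (h1.comp h2) (.one _) .zigzag_down
  case opn_opn =>
    refine SEnd.ext fun X => (loop_loop X).trans ?_
    exact (neg_one_smul k _).symm
  case opn_pos =>
    refine SEnd.ext fun X => ?_
    have h1 : SEnd.app (collapseEval z ((IsoTerm.one up).tensor IsoTerm.opn)) X =
        (lf z false .up).map (loop z X) := by
      refine (app_tensor_eval _ _ X).trans (conj_id' _ _ ?_)
      exact Category.comp_id _
    have h2 : SEnd.app (collapseEval z (IsoTerm.opn.tensor (IsoTerm.one up))) X =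
        loop z ((lf z false .up).obj X) := by
      refine (app_tensor_eval _ _ X).trans (conj_id' _ _ ?_)
      exact (congrArg (· ≫ loop z ((lf z false .up).obj X))
        ((lf z false .up).map_id _)).trans (Category.id_comp _)
    have h3 : (lf z false .up).map (loop z X) ≫ Pc X = Pc X ≫ loop z ((lf z false .up).obj X) := by
      have h4 := Pc_Nc (Z := X)
      rw [loop_lf]
      simp only [crossUnder, crossBack]
      rw [reassoc_of% h4]
    exact (congrArg (· ≫ Pc X) h1).trans (h3.trans (congrArg (Pc X ≫ ·) h2).symm)
  case bubble_opn =>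
    refine SEnd.ext fun X => ?_
    have h2 : SEnd.app (collapseEval z (IsoTerm.opn.tensor (IsoTerm.one dn))) X =
        loop z ((lf z false .down).obj X) := by
      refine (app_tensor_eval _ _ X).trans (conj_id' _ _ ?_)
      exact (congrArg (· ≫ loop z ((lf z false .down).obj X))
        ((lf z false .up).map_id _)).trans (Category.id_comp _)
    exact (congrArg (fun f => Cup X ≫ f ≫ Rc X ≫ Cap X) h2).trans (loop_bubble' X)

variable (z) in
/-- The collapsing superfunctor, a monoidal superfunctor from the quantum affine isomeric
supercategory to the endosuperfunctors of the quantum isomeric supercategory. -/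
def collapse : MonoidalSuperfunctor k (AQCat z) (SEnd k (QCat z)) :=
  Presentation.lift (P := isoPres z true) (collapseObj z) (collapseGen z) collapseGen_mem
    collapse_rel

/-- An expression without open tokens, seen as an affine expression. -/
def inclTerm : ∀ {X Y : FreeMonoid Arrow}, Term k (isoSig false) X Y → Term k (isoSig true) X Y
  | _, _, .gen g =>
    match g with
    | .pos => IsoTerm.pos
    | .neg => IsoTerm.neg
    | .negRight => IsoTerm.negRight
    | .leftCap => IsoTerm.leftCap
    | .leftCup => IsoTerm.leftCup
    | .tok => IsoTerm.tok
  | _, _, .id X => .id X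
  | _, _, .comp s t => .comp (inclTerm s) (inclTerm t)
  | _, _, .tensor s t => .tensor (inclTerm s) (inclTerm t)
  | _, _, .zero X Y => .zero X Y
  | _, _, .add s t => .add (inclTerm s) (inclTerm t)
  | _, _, .smul b t => .smul b (inclTerm t)

theorem inclTerm_rel {X Y : FreeMonoid Arrow} {s t : Term k (isoSig false) X Y}
    (h : IsoRel z s t) : IsoRel z (inclTerm s) (inclTerm t) := by
  cases h
  · exact .pos_neg
  · exact .neg_pos
  · exact .right_left
  · exact .left_right
  · exact .braid
  · exact .skein
  · exact .tok_tok
  · exact .tok_pos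
  · exact .bubble_tok
  · exact .bubble
  · exact .zigzag_up
  · exact .zigzag_down

variable (z) in
/-- The words, as objects of the affine supercategory. -/
def inclObj : FreeMonoid Arrow →* AQCat z where
  toFun X := ob z true X
  map_one' := rfl
  map_mul' _ _ := rfl

variable (z) in
/-- The generating morphisms without open tokens, in the affine supercategory. -/
def inclGen (g : IsoGen false) :
    inclObj z ((isoSig false).dom g) ⟶ inclObj z ((isoSig false).cod g) :=
  mor z (inclTerm (.gen (S := isoSig false) g))

theorem inclGen_mem (g : IsoGen false) :
    inclGen z g ∈ Supercategory.parity (k := k) _ _ ((isoSig false).par g) := by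
  cases g
  · exact mor_mem IsoTerm.pos_homog
  · exact mor_mem IsoTerm.neg_homog
  · exact mor_mem IsoTerm.negRight_homog
  · exact mor_mem IsoTerm.leftCap_homog
  · exact mor_mem IsoTerm.leftCup_homog
  · exact mor_mem IsoTerm.tok_homog

theorem inclEval : ∀ {X Y : FreeMonoid Arrow} (t : Term k (isoSig false) X Y),
    Presentation.eval (P := isoPres z false) (inclObj z) (inclGen z) t = mor z (inclTerm t)
  | _, _, .gen _ => rfl
  | _, _, .id _ => rfl
  | _, _, .comp s t => congrArg₂ (· ≫ ·) (inclEval s) (inclEval t)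
  | _, _, .tensor s t => conj_id' _ _ (congrArg₂ (tensor k) (inclEval s) (inclEval t))
  | _, _, .zero _ _ => rfl
  | _, _, .add s t => congrArg₂ (· + ·) (inclEval s) (inclEval t)
  | _, _, .smul b t => congrArg (b • ·) (inclEval t)

variable (z) in
/-- The monoidal superfunctor from the quantum isomeric supercategory to its affine version, given
by viewing diagrams without open tokens as affine diagrams. -/
def incl : MonoidalSuperfunctor k (QCat z) (AQCat z) :=
  Presentation.lift (P := isoPres z false) (inclObj z) (inclGen z) inclGen_mem fun {X Y s t} h =>
    (inclEval s).trans ((mor_rel (inclTerm_rel h)).trans (inclEval t).symm)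

end Calculus

/-! ### Hecke–Clifford superalgebras -/

/-- The generators of the Hecke–Clifford superalgebra, and for `a = true` of the affine one.
Indices start at `0`. -/
inductive HCGen (r : ℕ) : Bool → Type
  | t {a : Bool} (i : ℕ) (h : i + 1 < r) : HCGen r a
  | c {a : Bool} (i : Fin r) : HCGen r a
  | w (i : Fin r) : HCGen r true

section HC

variable {k : Type u} [CommRing k] {r : ℕ}

namespace HCFree

variable {a : Bool}

variable (k) in
/-- The generator `t`, in the free algebra. -/
def t (i : ℕ) (h : i + 1 < r) : FreeAlgebra k (HCGen r a) := FreeAlgebra.ι k (HCGen.t i h)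
variable (k) in
/-- The generator `c`, in the free algebra. -/
def c (i : Fin r) : FreeAlgebra k (HCGen r a) := FreeAlgebra.ι k (HCGen.c i)
variable (k) in
/-- The generator `ϖ`, in the free algebra. -/
def w (i : Fin r) : FreeAlgebra k (HCGen r true) := FreeAlgebra.ι k (HCGen.w i)

end HCFree

open HCFree in
/-- The defining relations of the Hecke–Clifford superalgebras; the ones involving `w` occur in
the affine case only. -/
inductive HCRel (z : k) : ∀ {a : Bool}, FreeAlgebra k (HCGen r a) →
    FreeAlgebra k (HCGen r a) → Prop
  | quad {a : Bool} (i : ℕ) (h : i + 1 < r) :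
      HCRel z (a := a) (t k i h * t k i h) (z • t k i h + 1)
  | braid {a : Bool} (i : ℕ) (h : i + 1 < r) (h' : i + 1 + 1 < r) :
      HCRel z (a := a) (t k i h * t k (i + 1) h' * t k i h)
        (t k (i + 1) h' * t k i h * t k (i + 1) h')
  | t_t {a : Bool} (i j : ℕ) (h : i + 1 < r) (h' : j + 1 < r) (hij : i + 1 < j) :
      HCRel z (a := a) (t k i h * t k j h') (t k j h' * t k i h)
  | c_sq {a : Bool} (i : Fin r) : HCRel z (a := a) (c k i * c k i) (-1)
  | c_c {a : Bool} (i j : Fin r) (hij : i ≠ j) :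
      HCRel z (a := a) (c k i * c k j) (-(c k j * c k i))
  | t_c {a : Bool} (i : ℕ) (h : i + 1 < r) :
      HCRel z (a := a) (t k i h * c k ⟨i, by omega⟩) (c k ⟨i + 1, h⟩ * t k i h)
  | t_c_ne {a : Bool} (i : ℕ) (h : i + 1 < r) (j : Fin r) (hj : j.val ≠ i) (hj' : j.val ≠ i + 1) :
      HCRel z (a := a) (t k i h * c k j) (c k j * t k i h)
  | w_sq (i : Fin r) : HCRel z (w k i * w k i) (-1)
  | w_w (i j : Fin r) (hij : i ≠ j) : HCRel z (w k i * w k j) (-(w k j * w k i))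
  | t_w (i : ℕ) (h : i + 1 < r) :
      HCRel z (t k i h * w k ⟨i + 1, h⟩) (w k ⟨i, by omega⟩ * t k i h)
  | t_w_ne (i : ℕ) (h : i + 1 < r) (j : Fin r) (hj : j.val ≠ i) (hj' : j.val ≠ i + 1) :
      HCRel z (t k i h * w k j) (w k j * t k i h)

/-- The Hecke–Clifford superalgebra (`a = false`) and the affine Hecke–Clifford superalgebra
(`a = true`).  The generators `t` are even, the generators `c` and `w` odd. -/
abbrev HCAlg (z : k) (r : ℕ) (a : Bool) : Type u := RingQuot (HCRel (r := r) z (a := a))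

namespace HC

variable (z : k) (a : Bool)

/-- The generators `t`, with index from `0` to `r - 2`. -/
def t (i : ℕ) (h : i + 1 < r) : HCAlg z r a := RingQuot.mkAlgHom k _ (HCFree.t k i h)
/-- The generators `c`, with index from `0` to `r - 1`. -/
def c (i : Fin r) : HCAlg z r a := RingQuot.mkAlgHom k _ (HCFree.c k i)
/-- The generators `ϖ` of the affine superalgebra, with index from `0` to `r - 1`. -/
def w (i : Fin r) : HCAlg z r true := RingQuot.mkAlgHom k _ (HCFree.w k i)

theorem t_mul_t (i : ℕ) (h : i + 1 < r) : t z a i h * t z a i h = z • t z a i h + 1 := by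
  have := RingQuot.mkAlgHom_rel k (HCRel.quad (z := z) (a := a) i h)
  rw [map_mul, map_add, map_smul, map_one] at this
  exact this

/-- The generator `t`, as a unit. -/
def tUnit (i : ℕ) (h : i + 1 < r) : (HCAlg z r a)ˣ where
  val := t z a i h
  inv := t z a i h - z • 1
  val_inv := by rw [mul_sub, t_mul_t, mul_smul_comm, mul_one, add_sub_cancel_left]
  inv_val := by rw [sub_mul, t_mul_t, smul_mul_assoc, one_mul, add_sub_cancel_left]

/-- The product of the first `i` generators `t`, in increasing order. -/
def tProd : ∀ i : ℕ, i < r → (HCAlg z r a)ˣ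
  | 0, _ => 1
  | i + 1, h => tProd i (by omega) * tUnit z a i h

/-- The odd Jucys–Murphy elements. -/
def Jodd (i : Fin r) : HCAlg z r a :=
  ((tProd z a i.val i.isLt)⁻¹ : (HCAlg z r a)ˣ) * c z a ⟨0, i.pos⟩ *
    (tProd z a i.val i.isLt : (HCAlg z r a)ˣ)

/-- The Jucys–Murphy elements, by recursion. -/
def Jrec : ∀ i : ℕ, i < r → HCAlg z r a
  | 0, _ => 1
  | i + 1, h => (t z a i h - z • (c z a ⟨i, by omega⟩ * c z a ⟨i + 1, h⟩)) *
      Jrec i (by omega) * t z a i h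

/-- The Jucys–Murphy elements. -/
def J (i : Fin r) : HCAlg z r a := Jrec z a i.val i.isLt

end HC

end HC

/-! ### Diagrams on upward strands -/

section Ups

variable {k : Type u} [CommRing k] (z : k) (a : Bool)

/-- The object `↑ ⊗ ⋯ ⊗ ↑` with `n` factors. -/
def ups : ℕ → (isoPres z a).Cat
  | 0 => 1
  | n + 1 => ob z a up * ups n

theorem ups_add (m n : ℕ) : ups z a m * ups z a n = ups z a (m + n) := by
  induction m with
  | zero => rw [Nat.zero_add]; exact one_mul _
  | succ m ih => rw [Nat.add_right_comm, ups, ups, mul_assoc, ih]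

theorem ups_one : ups z a 1 = ob z a up := rfl
theorem ups_two : ups z a 2 = ob z a (up * up) := rfl

theorem ups_eq {m n j r : ℕ} (h : m + n + j = r) :
    ups z a m * (ups z a n * ups z a j) = ups z a r := by
  rw [ups_add, ups_add, ← h, Nat.add_assoc]

variable {z a}

theorem up_eq {m j r : ℕ} (h : m + 1 + j = r) :
    ups z a m * (ob z a up * ups z a j) = ups z a r := ups_eq z a (n := 1) h

theorem upup_eq {m j r : ℕ} (h : m + 2 + j = r) :
    ups z a m * (ob z a (up * up) * ups z a j) = ups z a r := ups_eq z a (n := 2) h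

/-- An endomorphism, moved along an equality of objects. -/
def conj {X Y : (isoPres z a).Cat} (h : X = Y) (f : X ⟶ X) : Y ⟶ Y :=
  eqToHom h.symm ≫ f ≫ eqToHom h

/-- The endomorphism `1 ⊗ f ⊗ 1` of `↑ ⊗ ⋯ ⊗ ↑`, with `m` strands to the left of `f` and `j`
strands to the right of `f`. -/
def place {X : (isoPres z a).Cat} {r : ℕ} (m j : ℕ) (h : ups z a m * (X * ups z a j) = ups z a r)
    (f : X ⟶ X) : ups z a r ⟶ ups z a r :=
  conj h (tensor k (𝟙 (ups z a m)) (tensor k f (𝟙 (ups z a j))))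

/-- An endomorphism of one strand, put on the strand `i` from the right (counted from `0`). -/
def dotEnd {r : ℕ} (f : ob z a up ⟶ ob z a up) (i : Fin r) : End (ups z a r) :=
  place (X := ob z a up) (r - 1 - i.val) i.val (up_eq (by have := i.isLt; omega)) f

/-- An endomorphism of two strands, put on the strands `i` and `i + 1` from the right. -/
def crossEnd {r : ℕ} (f : ob z a (up * up) ⟶ ob z a (up * up)) (i : ℕ) (h : i + 1 < r) :
    End (ups z a r) :=
  place (X := ob z a (up * up)) (r - 2 - i) i (upup_eq (by omega)) f

/-! Elementary properties. -/

theorem conj_heq {X Y : (isoPres z a).Cat} (h : X = Y) (f : X ⟶ X) : HEq (conj h f) f := by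
  subst h; simp [conj]

theorem conj_comp {X Y : (isoPres z a).Cat} (h : X = Y) (f g : X ⟶ X) :
    conj h (f ≫ g) = conj h f ≫ conj h g := by
  subst h; simp [conj]

theorem conj_eq_iff {X Y : (isoPres z a).Cat} (h : X = Y) (f : X ⟶ X) (g : Y ⟶ Y)
    (e : HEq g f) : g = conj h f := eq_of_heq (e.trans (conj_heq h f).symm)

theorem conj_parity {X Y : (isoPres z a).Cat} {p : ZMod 2} (h : X = Y) {f : X ⟶ X}
    (hf : f ∈ Supercategory.parity (k := k) X X p) :
    conj h f ∈ Supercategory.parity (k := k) Y Y p := by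
  subst h; simpa [conj] using hf

theorem tensor_heq {X Y X' Y' : (isoPres z a).Cat} {f : X ⟶ X} {g : Y ⟶ Y} {f' : X' ⟶ X'}
    {g' : Y' ⟶ Y'} (hX : X = X') (hY : Y = Y') (hf : HEq f f') (hg : HEq g g') :
    HEq (tensor k f g) (tensor k f' g') := by
  subst hX; subst hY; rw [eq_of_heq hf, eq_of_heq hg]

theorem id_heq {X Y : (isoPres z a).Cat} (h : X = Y) : HEq (𝟙 X) (𝟙 Y) := by subst h; rfl

theorem assoc_heq {X Y Z : (isoPres z a).Cat} (f : X ⟶ X) (g : Y ⟶ Y) (h : Z ⟶ Z) :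
    HEq (tensor k (tensor k f g) h) (tensor k f (tensor k g h)) := by
  rw [tensor_assoc]
  exact conj_heq (mul_assoc X Y Z).symm _

theorem id_mul_heq {X Y V : (isoPres z a).Cat} (h : X * Y = V) :
    HEq (𝟙 V) (tensor k (𝟙 X) (𝟙 Y)) := by
  subst h; rw [tensor_id]

section Place

variable {X V : (isoPres z a).Cat} {r m j m' j' : ℕ}
  (h : ups z a m * (X * ups z a j) = ups z a r)

theorem place_comp (f g : X ⟶ X) : place m j h (f ≫ g) = place m j h f ≫ place m j h g := by
  rw [place, comp_tensor_id, id_tensor_comp, conj_comp]; rfl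

theorem place_id : place m j h (𝟙 X) = 𝟙 _ := by
  rw [place, tensor_id, tensor_id]; simp [conj]

theorem place_smul (b : k) (f : X ⟶ X) : place m j h (b • f) = b • place m j h f := by
  rw [place, smul_tensor, tensor_smul]; simp [conj, place]

theorem place_add (f g : X ⟶ X) : place m j h (f + g) = place m j h f + place m j h g := by
  rw [place, add_tensor, tensor_add]; simp [conj, place]

theorem place_mem {p : ZMod 2} {f : X ⟶ X} (hf : f ∈ Supercategory.parity (k := k) X X p) :
    place m j h f ∈ Supercategory.parity (k := k) _ _ p := by
  have h1 := tensor_mem (Supercategory.id_mem (k := k) (ups z a m))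
    (tensor_mem hf (Supercategory.id_mem (k := k) (ups z a j)))
  rw [add_zero, zero_add] at h1
  exact conj_parity h h1

/-- Putting `f ⊗ 1` somewhere. -/
theorem place_left (f : X ⟶ X) (h' : ups z a m * ((X * V) * ups z a j) = ups z a r)
    (hV : V * ups z a j = ups z a j') (h'' : ups z a m * (X * ups z a j') = ups z a r) :
    place m j h' (tensor k f (𝟙 V)) = place m j' h'' f := by
  refine eq_of_heq ((conj_heq _ _).trans (HEq.trans ?_ (conj_heq _ _).symm))
  refine tensor_heq rfl (by rw [mul_assoc, hV]) HEq.rfl ((assoc_heq _ _ _).trans ?_)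
  exact tensor_heq rfl hV HEq.rfl (id_mul_heq hV).symm

/-- Putting `1 ⊗ f` somewhere. -/
theorem place_right (f : X ⟶ X) (h' : ups z a m * ((V * X) * ups z a j) = ups z a r)
    (hV : ups z a m * V = ups z a m') (h'' : ups z a m' * (X * ups z a j) = ups z a r) :
    place m j h' (tensor k (𝟙 V) f) = place m' j h'' f := by
  refine eq_of_heq ((conj_heq _ _).trans (HEq.trans ?_ (conj_heq _ _).symm))
  refine (tensor_heq rfl (mul_assoc _ _ _) HEq.rfl (assoc_heq _ _ _)).trans ?_
  refine (assoc_heq _ _ _).symm.trans ?_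
  exact tensor_heq hV rfl (id_mul_heq hV).symm HEq.rfl

/-- Endomorphisms of disjoint sets of strands supercommute. -/
theorem place_far {Y : (isoPres z a).Cat} {n n' : ℕ} {p q : ZMod 2} {f : X ⟶ X} {g : Y ⟶ Y}
    (hX : X = ups z a n) (hY : Y = ups z a n') (hm : m + n + j = r) (hm' : m' + n' + j' = r)
    (hle : m + n ≤ m')
    (hf : f ∈ Supercategory.parity (k := k) X X p) (hg : g ∈ Supercategory.parity (k := k) Y Y q)
    (h' : ups z a m' * (Y * ups z a j') = ups z a r) :
    place m j h f ≫ place m' j' h' g = sgn k p q • (place m' j' h' g ≫ place m j h f) := by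
  obtain ⟨e, rfl⟩ := Nat.exists_eq_add_of_le hle
  have hj : e + n' + j' = j := by omega
  have hN : ups z a e * (Y * ups z a j') = ups z a j := by rw [hY]; exact ups_eq z a hj
  have h1 : place (m + n + e) j' h' g =
      conj h (tensor k (𝟙 (ups z a m)) (tensor k (𝟙 X) (place e j' hN g))) := by
    refine conj_eq_iff h _ _ ((conj_heq _ _).trans ?_)
    have e1 : ups z a m * (X * ups z a e) = ups z a (m + n + e) := by
      rw [hX]; exact ups_eq z a rfl
    refine HEq.trans ?_ (tensor_heq rfl (by rw [← hN]) HEq.rfl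
      (tensor_heq rfl hN.symm HEq.rfl (conj_heq _ _))).symm
    refine (tensor_heq (by rw [← e1]) rfl (id_mul_heq e1) HEq.rfl).trans ?_
    refine (assoc_heq _ _ _).trans ?_
    rw [← tensor_id (k := k)]
    exact tensor_heq rfl (mul_assoc _ _ _) HEq.rfl (assoc_heq _ _ _)
  rw [h1, place, ← conj_comp, ← conj_comp, ← id_tensor_comp, ← id_tensor_comp,
    tensor_exchange k hf (place_mem hN hg), tensor_smul]
  simp [conj]

end Place

/-! The relations of the Hecke–Clifford superalgebras hold for diagrams. -/

section Relations

variable (z a)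

/-- The image of a generator. -/
def iotaGen (r : ℕ) : HCGen r a → End (ups z a r)
  | .t i h => -crossEnd (mor z IsoTerm.neg) i h
  | .c i => dotEnd (mor z IsoTerm.tok) i
  | .w i => dotEnd (mor z IsoTerm.opn) i

variable {z a}

theorem neg_neg_eq : mor z (a := a) IsoTerm.neg ≫ mor z IsoTerm.neg =
    𝟙 (ob z a (up * up)) + (-z) • mor z IsoTerm.neg := by
  have h1 : mor z (a := a) IsoTerm.pos + (-1 : k) • mor z IsoTerm.neg =
      z • 𝟙 (ob z a (up * up)) := mor_rel .skein
  have h2 : mor z (a := a) IsoTerm.neg ≫ mor z IsoTerm.pos = 𝟙 (ob z a (up * up)) :=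
    mor_rel .neg_pos
  have h3 : mor z (a := a) IsoTerm.neg ≫ (mor z IsoTerm.pos + (-1 : k) • mor z IsoTerm.neg) =
      z • mor z IsoTerm.neg := by rw [h1, Linear.comp_smul, Category.comp_id]
  rw [Preadditive.comp_add, h2, Linear.comp_smul] at h3
  rw [neg_smul, ← h3, neg_one_smul]
  abel

theorem swap_inv {X : (isoPres z a).Cat} {p n s t : X ⟶ X} (h2 : n ≫ p = 𝟙 X) (h3 : p ≫ n = 𝟙 X)
    (h1 : s ≫ p = p ≫ t) : t ≫ n = n ≫ s := by
  calc t ≫ n = n ≫ (p ≫ t) ≫ n := by simp only [Category.assoc]; rw [reassoc_of% h2]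
    _ = _ := by rw [← h1, Category.assoc, h3, Category.comp_id]

theorem braid_inv {X : (isoPres z a).Cat} {p n p' n' : X ⟶ X} (h1 : n ≫ p = 𝟙 X)
    (h2 : p ≫ n = 𝟙 X) (h3 : n' ≫ p' = 𝟙 X) (h4 : p' ≫ n' = 𝟙 X)
    (h : p ≫ p' ≫ p = p' ≫ p ≫ p') : n ≫ n' ≫ n = n' ≫ n ≫ n' := by
  have e1 : (n ≫ n' ≫ n) ≫ p ≫ p' ≫ p = 𝟙 X := by
    simp only [Category.assoc]
    rw [reassoc_of% h1, reassoc_of% h3, h1]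
  have e2 : (p' ≫ p ≫ p') ≫ n' ≫ n ≫ n' = 𝟙 X := by
    simp only [Category.assoc]
    rw [reassoc_of% h4, reassoc_of% h2, h4]
  calc n ≫ n' ≫ n = (n ≫ n' ≫ n) ≫ (p' ≫ p ≫ p') ≫ n' ≫ n ≫ n' := by rw [e2, Category.comp_id]
    _ = _ := by rw [← h, ← Category.assoc (n ≫ n' ≫ n), e1, Category.id_comp]

variable (z a) in
/-- The negative crossing. -/
def negM : ob z a up * ob z a up ⟶ ob z a up * ob z a up := mor z IsoTerm.neg

variable (z a) in
/-- The positive crossing. -/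
def posM : ob z a up * ob z a up ⟶ ob z a up * ob z a up := mor z IsoTerm.pos

theorem neg_posM : negM z a ≫ posM z a = 𝟙 _ := mor_rel .neg_pos
theorem pos_negM : posM z a ≫ negM z a = 𝟙 _ := mor_rel .pos_neg

theorem mor_tok_neg : tensor k (𝟙 (ob z a up)) (mor z IsoTerm.tok) ≫ negM z a =
    negM z a ≫ tensor k (mor z IsoTerm.tok) (𝟙 (ob z a up)) :=
  swap_inv neg_posM pos_negM (mor_rel .tok_pos)

theorem mor_opn_neg : tensor k (mor z IsoTerm.opn) (𝟙 (ob z true up)) ≫ negM z true =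
    negM z true ≫ tensor k (𝟙 (ob z true up)) (mor z IsoTerm.opn) :=
  swap_inv neg_posM pos_negM (mor_rel .opn_pos)

variable (z a) in
/-- A crossing in three strands. -/
def crossL (f : ob z a up * ob z a up ⟶ ob z a up * ob z a up) :
    ob z a up * (ob z a up * ob z a up) ⟶ ob z a up * (ob z a up * ob z a up) :=
  tensor k (X := ob z a up * ob z a up) (Y := ob z a up * ob z a up) f (𝟙 (ob z a up))

variable (z a) in
/-- A crossing in three strands. -/
def crossR (f : ob z a up * ob z a up ⟶ ob z a up * ob z a up) :
    ob z a up * (ob z a up * ob z a up) ⟶ ob z a up * (ob z a up * ob z a up) :=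
  tensor k (𝟙 (ob z a up)) f

theorem mor_braid : crossL z a (negM z a) ≫ crossR z a (negM z a) ≫ crossL z a (negM z a) =
    crossR z a (negM z a) ≫ crossL z a (negM z a) ≫ crossR z a (negM z a) := by
  refine braid_inv (p := crossL z a (posM z a)) (p' := crossR z a (posM z a)) ?_ ?_ ?_ ?_
    (mor_rel .braid)
  · refine (comp_tensor_id k (negM z a) (posM z a) (ob z a up)).symm.trans ?_
    rw [neg_posM]; exact tensor_id _ _
  · refine (comp_tensor_id k (posM z a) (negM z a) (ob z a up)).symm.trans ?_
    rw [pos_negM]; exact tensor_id _ _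
  · refine (id_tensor_comp k (ob z a up) (negM z a) (posM z a)).symm.trans ?_
    rw [neg_posM]; exact tensor_id _ _
  · refine (id_tensor_comp k (ob z a up) (posM z a) (negM z a)).symm.trans ?_
    rw [pos_negM]; exact tensor_id _ _

theorem dotEnd_sq {f : ob z a up ⟶ ob z a up} (hf : f ≫ f = (-1 : k) • 𝟙 _) {r : ℕ} (i : Fin r) :
    dotEnd f i * dotEnd f i = -1 := by
  refine (place_comp _ f f).symm.trans ?_
  rw [hf, place_smul, place_id, neg_one_smul]; rfl

theorem dotEnd_anti {f : ob z a up ⟶ ob z a up}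
    (hf : f ∈ Supercategory.parity (k := k) _ _ 1) {r : ℕ} (i j : Fin r) (h : i ≠ j) :
    dotEnd f i * dotEnd f j = -(dotEnd f j * dotEnd f i) := by
  have key : ∀ i j : Fin r, i.val < j.val → dotEnd f j ≫ dotEnd f i =
      -(dotEnd f i ≫ dotEnd f j) := by
    intro i j hij
    have hi := i.isLt
    have hj := j.isLt
    have := place_far (X := ob z a up) (Y := ob z a up) (r := r) (n := 1) (n' := 1)
      (m := r - 1 - j.val) (j := j.val) (m' := r - 1 - i.val)
      (j' := i.val) (ups_eq z a (n := 1) (by omega)) rfl rfl (by omega) (by omega) (by omega) hf hf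
      (ups_eq z a (n := 1) (by omega))
    have hs : sgn k 1 1 = -1 := by simp [sgn, ZMod.val_one]
    rw [hs, neg_one_smul] at this
    exact this
  rw [End.mul_def, End.mul_def]
  rcases lt_or_gt_of_ne (fun e => h (Fin.ext e) : i.val ≠ j.val) with h1 | h1
  · exact key i j h1
  · rw [key j i h1, neg_neg]

theorem dotEnd_cross {f : ob z a up ⟶ ob z a up} {p : ZMod 2}
    (hf : f ∈ Supercategory.parity (k := k) _ _ p) {r : ℕ} (i : ℕ) (h : i + 1 < r) (j : Fin r)
    (hj : j.val ≠ i) (hj' : j.val ≠ i + 1) : crossEnd (mor z IsoTerm.neg) i h * dotEnd f j =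
      dotEnd f j * crossEnd (mor z IsoTerm.neg) i h := by
  rw [End.mul_def, End.mul_def]
  have hj2 := j.isLt
  rcases lt_or_gt_of_ne hj with h1 | h1
  · have := place_far (X := ob z a (up * up)) (Y := ob z a up) (r := r) (n := 2) (n' := 1)
      (m := r - 2 - i) (j := i) (m' := r - 1 - j.val)
      (j' := j.val) (ups_eq z a (n := 2) (by omega)) rfl rfl (by omega) (by omega) (by omega)
      (mor_mem (z := z) IsoTerm.neg_homog) hf (ups_eq z a (n := 1) (by omega))
    rw [sgn_zero_left, one_smul] at this
    exact this.symm
  · have := place_far (X := ob z a up) (Y := ob z a (up * up)) (r := r) (n := 1) (n' := 2)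
      (m := r - 1 - j.val) (j := j.val) (m' := r - 2 - i)
      (j' := i) (ups_eq z a (n := 1) (by omega)) rfl rfl (by omega) (by omega) (by omega)
      hf (mor_mem (z := z) IsoTerm.neg_homog) (ups_eq z a (n := 2) (by omega))
    rw [sgn_zero_right, one_smul] at this
    exact this

theorem crossEnd_comm {r : ℕ} (i j : ℕ) (h : i + 1 < r) (h' : j + 1 < r) (hij : i + 1 < j) :
    crossEnd (mor z (a := a) IsoTerm.neg) i h * crossEnd (mor z IsoTerm.neg) j h' =
      crossEnd (mor z IsoTerm.neg) j h' * crossEnd (mor z IsoTerm.neg) i h := by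
  have := place_far (X := ob z a (up * up)) (Y := ob z a (up * up)) (r := r) (n := 2) (n' := 2)
      (m := r - 2 - j) (j := j) (m' := r - 2 - i)
      (j' := i) (ups_eq z a (n := 2) (by omega)) rfl rfl (by omega) (by omega) (by omega)
      (mor_mem (z := z) IsoTerm.neg_homog) (mor_mem (z := z) IsoTerm.neg_homog)
      (ups_eq z a (n := 2) (by omega))
  rw [sgn_zero_right, one_smul] at this
  exact this

theorem place_congr {m m' j j' : ℕ} (hm : m = m') (hj : j = j') {X : (isoPres z a).Cat} {r : ℕ}
    (h : ups z a m * (X * ups z a j) = ups z a r) (h' : ups z a m' * (X * ups z a j') = ups z a r)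
    (f : X ⟶ X) : place m j h f = place m' j' h' f := by
  subst hm; subst hj; rfl

theorem dotEnd_left (f : ob z a up ⟶ ob z a up) {r : ℕ} (i : ℕ) (h : i + 1 < r) :
    dotEnd f ⟨i + 1, h⟩ = crossEnd (tensor k f (𝟙 (ob z a up))) i h := by
  refine Eq.symm ((place_left (X := ob z a up) (V := ob z a up) (j' := i + 1) f _ rfl
    (ups_eq z a (n := 1) (by omega))).trans ?_)
  exact place_congr (by simp only; omega) rfl _ _ f

theorem dotEnd_right (f : ob z a up ⟶ ob z a up) {r : ℕ} (i : ℕ) (h : i + 1 < r) :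
    dotEnd f ⟨i, by omega⟩ = crossEnd (tensor k (𝟙 (ob z a up)) f) i h := by
  refine Eq.symm ((place_right (X := ob z a up) (V := ob z a up) (m' := r - 1 - i) f _ ?_ 
    (ups_eq z a (n := 1) (by omega))))
  exact (ups_add z a _ 1).trans (congrArg _ (by omega))

theorem crossEnd_comp (f g : ob z a (up * up) ⟶ ob z a (up * up)) {r : ℕ} (i : ℕ)
    (h : i + 1 < r) : crossEnd (f ≫ g) i h = crossEnd g i h * crossEnd f i h :=
  place_comp _ f g

/-- Three strands. -/
def tripleEnd (f : ob z a up * (ob z a up * ob z a up) ⟶ ob z a up * (ob z a up * ob z a up))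
    {r : ℕ} (i : ℕ) (h : i + 1 + 1 < r) : End (ups z a r) :=
  place (X := ob z a up * (ob z a up * ob z a up)) (r - 3 - i) i
    (ups_eq z a (n := 3) (by omega)) f

theorem tripleEnd_comp (f g : ob z a up * (ob z a up * ob z a up) ⟶
    ob z a up * (ob z a up * ob z a up)) {r : ℕ} (i : ℕ) (h : i + 1 + 1 < r) :
    tripleEnd (f ≫ g) i h = tripleEnd g i h * tripleEnd f i h :=
  place_comp _ f g

theorem triple_left (f : ob z a (up * up) ⟶ ob z a (up * up)) {r : ℕ} (i : ℕ)
    (h : i + 1 + 1 < r) : tripleEnd (crossL z a f) i h = crossEnd f (i + 1) h := by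
  refine (place_left (X := ob z a (up * up)) (V := ob z a up) (j' := i + 1) f _ rfl
    (ups_eq z a (n := 2) (by omega))).trans ?_
  exact place_congr (by omega) rfl _ _ f

theorem triple_right (f : ob z a (up * up) ⟶ ob z a (up * up)) {r : ℕ} (i : ℕ)
    (h : i + 1 + 1 < r) : tripleEnd (crossR z a f) i h = crossEnd f i (by omega) := by
  refine place_right (X := ob z a (up * up)) (V := ob z a up) (m' := r - 2 - i) f _ ?_
    (ups_eq z a (n := 2) (by omega))
  exact (ups_add z a _ 1).trans (congrArg _ (by omega))

theorem cross_braid {r : ℕ} (i : ℕ) (h : i + 1 < r) (h' : i + 1 + 1 < r) :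
    crossEnd (mor z (a := a) IsoTerm.neg) i h * crossEnd (mor z IsoTerm.neg) (i + 1) h' *
      crossEnd (mor z IsoTerm.neg) i h = crossEnd (mor z IsoTerm.neg) (i + 1) h' *
        crossEnd (mor z IsoTerm.neg) i h * crossEnd (mor z IsoTerm.neg) (i + 1) h' := by
  have := congrArg (tripleEnd · i h') (mor_braid (z := z) (a := a))
  simp only [tripleEnd_comp] at this
  have hl : tripleEnd (crossL z a (negM z a)) i h' = crossEnd (mor z IsoTerm.neg) (i + 1) h' :=
    triple_left _ i h'
  have hr : tripleEnd (crossR z a (negM z a)) i h' = crossEnd (mor z IsoTerm.neg) i h :=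
    triple_right _ i h'
  rw [hl, hr] at this
  exact this.symm

theorem cross_quad {r : ℕ} (i : ℕ) (h : i + 1 < r) :
    crossEnd (mor z (a := a) IsoTerm.neg) i h * crossEnd (mor z (a := a) IsoTerm.neg) i h =
      1 + (-z) • crossEnd (mor z (a := a) IsoTerm.neg) i h := by
  rw [← crossEnd_comp, neg_neg_eq]
  refine (place_add _ _ _).trans ?_
  rw [place_id, place_smul]; rfl

theorem cross_tok {r : ℕ} (i : ℕ) (h : i + 1 < r) :
    crossEnd (mor z (a := a) IsoTerm.neg) i h * dotEnd (mor z IsoTerm.tok) ⟨i, by omega⟩ =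
      dotEnd (mor z IsoTerm.tok) ⟨i + 1, h⟩ * crossEnd (mor z IsoTerm.neg) i h := by
  rw [dotEnd_left, dotEnd_right _ i h]
  refine (crossEnd_comp _ _ i h).symm.trans (Eq.trans ?_ (crossEnd_comp _ _ i h))
  exact congrArg (crossEnd · i h) mor_tok_neg

theorem cross_opn {r : ℕ} (i : ℕ) (h : i + 1 < r) :
    crossEnd (mor z IsoTerm.neg) i h * dotEnd (mor z IsoTerm.opn) ⟨i + 1, h⟩ =
      dotEnd (mor z IsoTerm.opn) ⟨i, by omega⟩ * crossEnd (mor z IsoTerm.neg) i h := by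
  rw [dotEnd_left, dotEnd_right _ i h]
  refine (crossEnd_comp _ _ i h).symm.trans (Eq.trans ?_ (crossEnd_comp _ _ i h))
  exact congrArg (crossEnd · i h) mor_opn_neg

theorem iota_rel {r : ℕ} {x y : FreeAlgebra k (HCGen r a)} (h : HCRel z x y) :
    FreeAlgebra.lift k (iotaGen z a r) x = FreeAlgebra.lift k (iotaGen z a r) y := by
  cases h <;>
    simp only [HCFree.t, HCFree.c, HCFree.w, map_mul, map_add, map_smul, map_neg, map_one,
      FreeAlgebra.lift_ι_apply, iotaGen, neg_mul, mul_neg, neg_neg, neg_inj]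
  case quad i h => rw [cross_quad]; simp [add_comm]
  case braid i h h' => exact cross_braid i h h'
  case t_t i j h h' hij => exact crossEnd_comm i j h h' hij
  case c_sq i => exact dotEnd_sq ((mor_rel .tok_tok)) i
  case c_c i j hij => exact dotEnd_anti (mor_mem IsoTerm.tok_homog) i j hij
  case t_c i h => exact cross_tok i h
  case t_c_ne i h j hj hj' => exact dotEnd_cross (mor_mem IsoTerm.tok_homog) i h j hj hj'
  case w_sq i => exact dotEnd_sq ((mor_rel .opn_opn)) i
  case w_w i j hij => exact dotEnd_anti (mor_mem IsoTerm.opn_homog) i j hij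
  case t_w i h => exact cross_opn i h
  case t_w_ne i h j hj hj' => exact dotEnd_cross (mor_mem IsoTerm.opn_homog) i h j hj hj'

end Relations

variable (z a) in
/-- The homomorphism from a Hecke–Clifford superalgebra to the endomorphisms of `r` upward
strands: `t` goes to minus the negative crossing, `c` to the closed token and `w` to the open
token. -/
def iota (r : ℕ) : HCAlg z r a →ₐ[k] End (ups z a r) :=
  RingQuot.liftAlgHom k ⟨FreeAlgebra.lift k (iotaGen z a r), fun {_ _} h => iota_rel h⟩

theorem iota_t (r i : ℕ) (h : i + 1 < r) :
    iota z a r (HC.t z a i h) = -crossEnd (mor z IsoTerm.neg) i h := by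
  simp [iota, HC.t, HCFree.t, iotaGen]

theorem iota_c (r : ℕ) (i : Fin r) : iota z a r (HC.c z a i) = dotEnd (mor z IsoTerm.tok) i := by
  simp [iota, HC.c, HCFree.c, iotaGen]

theorem iota_w (r : ℕ) (i : Fin r) : iota z true r (HC.w z i) = dotEnd (mor z IsoTerm.opn) i := by
  simp [iota, HC.w, HCFree.w, iotaGen]

variable (z) in
/-- The open token `↑ → ↑` in the affine supercategory. -/
def openToken : ob z true up ⟶ ob z true up := mor z IsoTerm.opn

variable (z) in
/-- The zebra `↑ → ↑`: an open token at the bottom and a closed token at the top. -/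
def zebra : ob z true up ⟶ ob z true up := openToken z ≫ mor z IsoTerm.tok

/-- The element `c ϖ` of the affine superalgebra goes to the zebra. -/
theorem iota_c_mul_w (r : ℕ) (i : Fin r) :
    iota z true r (HC.c z true i * HC.w z i) = dotEnd (zebra z) i := by
  rw [map_mul, iota_c, iota_w]
  exact (place_comp _ _ _).symm

variable (z) in
/-- The collapsing superfunctor followed by evaluation on the unit object. -/
def evCollapse : Superfunctor k (AQCat z) (QCat z) :=
  (collapse z).toSuperfunctor.comp (evOne k (QCat z))

theorem evCollapse_ups (r : ℕ) : (evCollapse z).obj (ups z true r) = ups z false r := by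
  have h : ∀ r, ob z false (ups z true r : FreeMonoid Arrow) = ups z false r := by
    intro r
    induction r with
    | zero => rfl
    | succ n ih => exact congrArg (ob z false up * ·) ih
  exact (mul_one (ups z true r : FreeMonoid Arrow)).trans (h r)

theorem incl_ups (r : ℕ) : (incl z).obj (ups z false r) = ups z true r := by
  induction r with
  | zero => rfl
  | succ n ih => exact congrArg (ob z true up * ·) ih

variable (z) in
/-- The value of the collapsing superfunctor followed by evaluation on the unit object on an
endomorphism of `↑ ⊗ ⋯ ⊗ ↑`.  The equality of objects by which it is moved is
`X ⊗ 1 = X`. -/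
def evCollapseEnd (r : ℕ) (f : End (ups z true r)) : End (ups z false r) :=
  conj (evCollapse_ups r) ((evCollapse z).map f)

variable (z) in
/-- An endomorphism of `↑ ⊗ ⋯ ⊗ ↑`, viewed in the affine supercategory. -/
def inclEnd (r : ℕ) (f : End (ups z false r)) : End (ups z true r) :=
  conj (incl_ups r) ((incl z).map f)

end Ups

end Isomeric

open Isomeric

/-! The collapsing superfunctor turns an open token on a strand with `X` to its right into a loop.
The strand passes under all of `X`, receives a closed Clifford token at the far right, and returns
under `X`. Tensoring the token with identity strands on the right only enlarges `X`. Tensoring with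
identity strands on the left only puts idle strands beside the loop. Hence, evaluated on the unit
object, an open token with `i` strands to its right becomes the loop over `X = ↑ ⊗ ⋯ ⊗ ↑` (`i`
factors), padded by identities on the left (`evCollapseEnd_dotEnd`).

The loop obeys a recursion in `X`. Peeling off the leftmost strand of `X` writes the loop as a
negative crossing at the bottom, the loop over the remaining strands in the middle, and a positive
crossing at the top. Under `iota` the negative crossing is `-t`. By the skein relation the positive
crossing is `-t + z`, and `t * t = z • t + 1` shows that this is `-t⁻¹`. The two signs cancel, so
adding a strand conjugates the loop by a generator: `L ↦ t⁻¹ L t`. Over no strands at all the loop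
is the bare token `c`. The odd Jucys–Murphy elements have the same initial value and the same
recursion (`HC.Jodd_succ`), so the two agree (`pad_loop`).

The zebra needs no second topological argument. The collapsing superfunctor is multiplicative and
leaves a closed token where it is, so a zebra goes to `c i * Jodd i` (`evCollapseEnd_zebra`). It
remains to know that this product is `-J i`, which is pure algebra (`HC.J_eq`). The computation
rests on the identity `(t i - z c i c (i+1)) c i = c (i+1) (t i - z) = c (i+1) (t i)⁻¹`. It
exchanges the factor `t - z c c` in the recursion for `J` with the factor `t⁻¹` in the recursion for
`Jodd`, at the price of moving the Clifford generator one place up.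

The affine versions follow because both families are given by the same formulas in the `t` and `c`.
The inclusion of the isomeric supercategory induces an algebra homomorphism on endomorphisms of
upward strands (`inclEndHom`). This homomorphism matches the two maps `iota` on the generators `t`
and `c`, and therefore on `Jodd` and `J`.

Objects such as `X ⊗ 1` and `X`, or the two bracketings of a triple product, are identified through
equalities of words. The comparisons of diagrams are therefore made as heterogeneous equalities, in
which the transports `conj` disappear. -/

namespace Isomeric

open StrictMonoidalSupercategory

/-! ### Jucys–Murphy elements in the Hecke–Clifford superalgebras -/

namespace HC

variable {k : Type u} [CommRing k] {r : ℕ} (z : k) (a : Bool)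

/-- The ring laws with the type fixed to `HCAlg`. Inside this namespace a bare `neg_mul` or
`mul_neg` in a rewrite means these versions. -/
theorem neg_mul (x y : HCAlg z r a) : -x * y = -(x * y) := _root_.neg_mul x y

theorem mul_neg (x y : HCAlg z r a) : x * -y = -(x * y) := _root_.mul_neg x y

/-- This and the next two lemmas carry defining relations from the free algebra to the quotient.
Together with the quadratic relation for `t` they are all that the comparison of `J` with `Jodd`
uses; braid relations do not enter. -/
theorem c_sq (i : Fin r) : c z a i * c z a i = -1 := by
  have := RingQuot.mkAlgHom_rel k (HCRel.c_sq (z := z) (a := a) i)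
  rwa [map_mul, map_neg, map_one] at this

theorem c_mul_c {i j : Fin r} (h : i ≠ j) : c z a i * c z a j = -(c z a j * c z a i) := by
  have := RingQuot.mkAlgHom_rel k (HCRel.c_c (z := z) (a := a) i j h)
  rwa [map_mul, map_neg, map_mul] at this

theorem t_mul_c (i : ℕ) (h : i + 1 < r) :
    t z a i h * c z a ⟨i, by omega⟩ = c z a ⟨i + 1, h⟩ * t z a i h := by
  have := RingQuot.mkAlgHom_rel k (HCRel.t_c (z := z) (a := a) i h)
  rwa [map_mul, map_mul] at this

theorem Jodd_zero (h : 0 < r) : Jodd z a ⟨0, h⟩ = c z a ⟨0, h⟩ := by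
  simp [Jodd, tProd]

/-- The conjugating product `tProd` grows on the right, so the newest generator is the outermost
conjugation. The inverse is written as the polynomial `t - z`, so that algebra homomorphisms can be
applied to the recursion without passing to units. -/
theorem Jodd_succ (i : ℕ) (h : i + 1 < r) : Jodd z a ⟨i + 1, h⟩ =
    (t z a i h - z • 1) * Jodd z a ⟨i, by omega⟩ * t z a i h := by
  -- The quadratic relation makes `t - z` the inverse of `t`; it is the inverse stored in `tUnit`.
  have h1 : ((tUnit z a i h)⁻¹ : (HCAlg z r a)ˣ).val = t z a i h - z • 1 := rfl
  have h2 : (tUnit z a i h).val = t z a i h := rfl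
  simp only [Jodd, tProd, mul_inv_rev, Units.val_mul, h1, h2, mul_assoc]

/-- The even and the odd Jucys–Murphy elements differ by a Clifford generator. -/
theorem J_eq (i : Fin r) : J z a i = -(c z a i * Jodd z a i) := by
  obtain ⟨i, hi⟩ := i
  induction i with
  | zero =>
    -- At the lowest index the right side is `-c² = 1`, which is the initial value of `Jrec`.
    rw [Jodd_zero, c_sq, neg_neg]
    rfl
  | succ i ih =>
    -- One sign comes from anticommuting the two generators, the other from `c i * c i = -1`; they
    -- cancel.
    have hc : c z a ⟨i, by omega⟩ * c z a ⟨i + 1, hi⟩ * c z a ⟨i, by omega⟩ =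
        c z a ⟨i + 1, hi⟩ := by
      rw [c_mul_c z a (by simp), neg_mul, mul_assoc, c_sq, mul_neg, mul_one, neg_neg]
    -- Pulling `c i` through from the right turns the correction term `z c c` into the `z` of `t⁻¹ =
    -- t - z`. This is why the correction in the recursion for `J` has this form.
    have key : (t z a i hi - z • (c z a ⟨i, by omega⟩ * c z a ⟨i + 1, hi⟩)) *
        c z a ⟨i, by omega⟩ = c z a ⟨i + 1, hi⟩ * (t z a i hi - z • 1) := by
      rw [sub_mul, smul_mul_assoc, hc, t_mul_c, mul_sub, mul_smul_comm, mul_one]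
    have e : J z a ⟨i + 1, hi⟩ = (t z a i hi - z • (c z a ⟨i, by omega⟩ * c z a ⟨i + 1, hi⟩)) *
      J z a ⟨i, by omega⟩ * t z a i hi := rfl
    -- The inductive hypothesis puts `c i` directly to the right of the corrected factor, where
    -- `key` applies; the remaining factors are those of `Jodd_succ`.
    rw [e, ih, Jodd_succ, mul_neg, neg_mul, ← mul_assoc, key]
    simp only [mul_assoc]

end HC

/-! ### Loops over upward strands -/

section Ups

variable {k : Type u} [CommRing k] {z : k} {a : Bool}

/-- The endomorphism `1 ⊗ f` of `↑ ⊗ ⋯ ⊗ ↑`, with `m` strands to the left of `f`. -/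
def pad (m : ℕ) {n r : ℕ} (h : m + n = r) (f : ups z a n ⟶ ups z a n) : End (ups z a r) :=
  conj ((ups_add z a m n).trans (congrArg _ h)) (tensor k (𝟙 (ups z a m)) f)

/-- The factors change order because multiplication in `End` puts the upper diagram on the left,
while `≫` puts the lower one first. -/
theorem pad_comp (m : ℕ) {n r : ℕ} (h : m + n = r) (f g : ups z a n ⟶ ups z a n) :
    pad m h (f ≫ g) = pad m h g * pad m h f := by
  rw [pad, id_tensor_comp, conj_comp]; rfl

/-- An identity strand standing directly to the left of `f` can be counted among the padding
strands. In the recursion for the loop, the strand that has just been crossed joins the idle strands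
in this way. -/
theorem pad_lf (m : ℕ) {n r : ℕ} (h : m + (n + 1) = r) (f : ups z a n ⟶ ups z a n) :
    pad m h ((lf z a .up).map f) = pad (m + 1) (by omega) f := by
  -- With the transports removed, only associativity of the tensor product and `↑^m ⊗ ↑ = ↑^(m+1)`
  -- remain.
  refine eq_of_heq ((conj_heq _ _).trans (HEq.trans ?_ (conj_heq _ _).symm))
  refine (assoc_heq (𝟙 (ups z a m)) (𝟙 (ob z a up)) f).symm.trans ?_
  exact tensor_heq (ups_add z a m 1) rfl (id_mul_heq (ups_add z a m 1)).symm HEq.rfl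

/-- The number `m` of strands on the left is determined by `r` and `i`, but it is kept as a variable
so that it can be shifted in an induction on `i`. -/
theorem pad_wh_up (f : Term k (isoSig a) up up) {r : ℕ} (i m : ℕ) (hi : i < r)
    (h : m + (i + 1) = r) : pad m h (wh z f (ups z a i)) = dotEnd (mor z f) ⟨i, hi⟩ := by
  -- For this value of `m`, the one built into `dotEnd`, the two sides agree by unfolding.
  obtain rfl : m = r - 1 - i := by omega
  rfl

theorem pad_wh_up_up (f : Term k (isoSig a) (up * up) (up * up)) {r : ℕ} (i m : ℕ)
    (hi : i + 1 < r) (h : m + (i + 1 + 1) = r) :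
    pad m h (wh z f (ups z a i)) = crossEnd (mor z f) i hi := by
  -- A crossing occupies two strands, so `crossEnd` leaves `r - 2 - i` of them on the left.
  obtain rfl : m = r - 2 - i := by omega
  rfl

/-- The skein relation gives `σ₊ = σ₋ + z`, and `iota` sends `t` to `-σ₋`, so `σ₊` is the image of
`-(t - z)`, that is, of `-t⁻¹`. -/
theorem cross_pos {r : ℕ} (i : ℕ) (h : i + 1 < r) :
    crossEnd (mor z (a := a) IsoTerm.pos) i h = -iota z a r (HC.t z a i h - z • 1) := by
  have h1 : mor z (a := a) IsoTerm.pos + (-1 : k) • mor z IsoTerm.neg =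
      z • 𝟙 (ob z a (up * up)) := mor_rel .skein
  -- Placing a two-strand endomorphism among identity strands is linear and preserves the identity,
  -- so the skein relation holds in every position.
  have h2 : crossEnd (mor z (a := a) IsoTerm.pos) i h +
      (-1 : k) • crossEnd (mor z (a := a) IsoTerm.neg) i h = z • 1 := by
    refine Eq.trans ?_ ((congrArg (crossEnd · i h) h1).trans ?_)
    · exact ((place_add _ _ _).trans (congrArg _ (place_smul _ _ _))).symm
    · exact (place_smul _ _ _).trans (congrArg _ (place_id _))
  rw [map_sub, map_smul, map_one, iota_t, ← h2, neg_one_smul]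
  abel

/-- With no strands to pass under, the loop is a bare Clifford token. This is the base of the
recursion. -/
theorem loop_ups_zero : loop z (ups z false 0) = wh z IsoTerm.tok (ups z false 0) := by
  have e1 := one_tensor (k := k) (mor z (a := false) IsoTerm.tok)
  have e2 := tensor_one (k := k) (mor z (a := false) IsoTerm.tok)
  -- The two crossings with the empty word are identities. The token tensored with the unit on the
  -- left then agrees with the token tensored with the unit on the right, by the unit laws.
  exact (Category.id_comp _).trans ((Category.comp_id _).trans (e1.trans e2.symm))

/-- A strand that passes under the strands to its right, carries a Clifford token and passes
back is the odd Jucys–Murphy element. -/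
theorem pad_loop {r : ℕ} (i m : ℕ) (hi : i < r) (h : m + (i + 1) = r) :
    pad m h (loop z (ups z false i)) = iota z false r (HC.Jodd z false ⟨i, hi⟩) := by
  -- `m` must vary: each step of the induction hands one strand from the right of the loop over to
  -- the padding on the left.
  induction i generalizing m with
  | zero =>
    rw [loop_ups_zero, HC.Jodd_zero, iota_c]
    exact pad_wh_up IsoTerm.tok 0 m hi h
  | succ i ih =>
    -- The loop over `i + 1` strands crosses under its left neighbour, performs the loop over the
    -- other `i`, and crosses back.
    have e : loop z (ups z false (i + 1)) = wh z IsoTerm.neg (ups z false i) ≫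
        (lf z false .up).map (loop z (ups z false i)) ≫ wh z IsoTerm.pos (ups z false i) :=
      loop_lf .up (ups z false i)
    have h1 := pad_wh_up_up (z := z) (a := false) IsoTerm.neg i m hi h
    have h2 := pad_wh_up_up (z := z) (a := false) IsoTerm.pos i m hi h
    -- The strand already crossed is idle during the inner loop, so the inductive hypothesis is used
    -- with one more padding strand.
    have h3 := (pad_lf m h (loop z (ups z false i))).trans (ih (m + 1) (by omega) (by omega))
    have e2 : pad m h (loop z (ups z false (i + 1))) =
        crossEnd (mor z IsoTerm.pos) i hi * iota z false r (HC.Jodd z false ⟨i, by omega⟩) *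
          crossEnd (mor z IsoTerm.neg) i hi := by
      rw [← h1, ← h2, ← h3, e]
      refine (pad_comp m h _ _).trans (congrArg (· * _) ?_)
      exact pad_comp m h _ _
    -- The upper crossing contributes `-(t - z)` and the lower one `-t`; the signs cancel and the
    -- recursion for `Jodd` is left.
    rw [e2, cross_pos, HC.Jodd_succ, map_mul, map_mul, iota_t, _root_.mul_neg, _root_.neg_mul, _root_.neg_mul]

/-! ### The collapsing superfunctor on diagrams of upward strands -/

variable (z) in
/-- The components of the image of an endomorphism under the collapsing superfunctor. -/
def collapseAt {X : AQCat z} (f : X ⟶ X) (Z : QCat z) :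
    ob z false X * Z ⟶ ob z false X * Z := SEnd.app ((collapse z).map f) Z

theorem collapseAt_id (X : AQCat z) (Z : QCat z) : collapseAt z (𝟙 X) Z = 𝟙 _ := by
  rw [collapseAt, CategoryTheory.Functor.map_id]; rfl

/-- Transporting `f` along an equality of words changes the source and target of the component, so
only a heterogeneous equality can be stated. -/
theorem collapseAt_conj {X Y : AQCat z} (h : X = Y) (f : X ⟶ X) (Z : QCat z) :
    HEq (collapseAt z (conj h f) Z) (collapseAt z f Z) := by
  subst h; simp [conj]

/-- The tensor product of supernatural transformations is horizontal composition: first `g` acts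
beside `Z`, whiskered by `X`, and then `f` acts with `Y ⊗ Z` as its object. The factor `g` is thus
part of what lies to the right of `f`. -/
theorem collapseAt_tensor {X Y : AQCat z} (f : X ⟶ X) (g : Y ⟶ Y) (Z : QCat z) :
    HEq (collapseAt z (tensor k f g) Z) ((tensorLeft k (ob z false X)).map (collapseAt z g Z) ≫
      collapseAt z f (ob z false Y * Z)) := by
  -- On representing expressions the collapsing superfunctor is computed by evaluation, which is
  -- known on tensor products up to reassociating the objects.
  obtain ⟨s⟩ := f
  obtain ⟨t⟩ := g
  refine (heq_of_eq (app_tensor_eval s t Z)).trans ?_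
  exact conj_heq (mul_assoc (ob z false X) (ob z false Y) Z).symm _

/-- The superfunctor is built from the universal property of the presentation, so a generator takes
its prescribed value on the nose. -/
theorem collapseAt_opn (Z : QCat z) : collapseAt z (openToken z) Z = loop z Z := rfl

/-- Both supercategories have the same words as objects, but `ups` is defined by recursion
separately in each, so the agreement requires an induction. -/
theorem ob_ups (r : ℕ) : ob z false (ups z true r : FreeMonoid Arrow) = ups z false r := by
  induction r with
  | zero => rfl
  | succ n ih => exact congrArg (ob z false up * ·) ih

theorem evCollapseEnd_heq {r : ℕ} (f : End (ups z true r)) :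
    HEq (evCollapseEnd z r f) (collapseAt z f 1) := conj_heq _ _

/-- Evaluation on the unit object is not monoidal, but it respects composition. This suffices to
split a zebra into its two tokens. -/
theorem evCollapseEnd_mul {r : ℕ} (f g : End (ups z true r)) :
    evCollapseEnd z r (f * g) = evCollapseEnd z r f * evCollapseEnd z r g := by
  have : (evCollapse z).map (g ≫ f) = (evCollapse z).map g ≫ (evCollapse z).map f :=
    (evCollapse z).map_comp g f
  rw [End.mul_def, End.mul_def, evCollapseEnd, this]
  exact conj_comp _ _ _

/-- Identity strands to the right of `f` move the object at which its image is evaluated from the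
unit to `↑^i`; identity strands to the left are merely tensored on. Any one-strand endomorphism
behaves in this way, which covers both kinds of token. -/
theorem evCollapseEnd_dotEnd {r : ℕ} (f : ob z true up ⟶ ob z true up) (i : Fin r)
    (h : r - 1 - i.val + (i.val + 1) = r) :
    evCollapseEnd z r (dotEnd f i) =
      pad (r - 1 - i.val) h (collapseAt z f (ups z false i.val)) := by
  have e1 : ob z false (ups z true i.val : FreeMonoid Arrow) * (1 : QCat z) = ups z false i.val :=
    (mul_one _).trans (ob_ups i.val)
  -- In the horizontal composition the identity on the right contributes an identity, and the
  -- component of `f` is taken at `↑^i ⊗ 1`, which is `↑^i`.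
  have e2 : HEq (collapseAt z (tensor k f (𝟙 (ups z true i.val))) 1)
      (collapseAt z f (ups z false i.val)) := by
    refine (collapseAt_tensor f (𝟙 (ups z true i.val)) 1).trans ?_
    rw [collapseAt_id, CategoryTheory.Functor.map_id]
    refine (heq_of_eq (Category.id_comp _)).trans ?_
    exact congr_arg_heq (collapseAt z f) e1
  refine eq_of_heq ((evCollapseEnd_heq _).trans ((collapseAt_conj _ _ _).trans
    (HEq.trans ?_ (conj_heq _ _).symm)))
  -- Now the identity is the left factor: its component, applied last, is an identity, and what
  -- survives is the inner component tensored with the left strands.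
  refine (collapseAt_tensor _ _ _).trans ?_
  rw [collapseAt_id]
  refine (heq_of_eq (Category.comp_id _)).trans ?_
  refine tensor_heq (ob_ups _) ?_ (id_heq (ob_ups _)) e2
  exact (mul_assoc _ _ _).trans (congrArg (ob z false up * ·) e1)

theorem evCollapseEnd_openToken {r : ℕ} (i : Fin r) :
    evCollapseEnd z r (dotEnd (openToken z) i) = iota z false r (HC.Jodd z false i) := by
  rw [evCollapseEnd_dotEnd _ i (by omega), collapseAt_opn]
  exact pad_loop i.val _ i.isLt _

/-- Unlike the open token, a closed token is sent to `c ⊗ -`. It crosses nothing and stays on its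
strand. -/
theorem evCollapseEnd_tok {r : ℕ} (i : Fin r) :
    evCollapseEnd z r (dotEnd (mor z IsoTerm.tok) i) = dotEnd (mor z IsoTerm.tok) i := by
  rw [evCollapseEnd_dotEnd _ i (by omega)]
  exact pad_wh_up IsoTerm.tok i.val _ i.isLt _

theorem evCollapseEnd_zebra {r : ℕ} (i : Fin r) :
    evCollapseEnd z r (dotEnd (zebra z) i) =
      dotEnd (mor z IsoTerm.tok) i * iota z false r (HC.Jodd z false i) := by
  rw [← evCollapseEnd_openToken, ← evCollapseEnd_tok, ← evCollapseEnd_mul]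
  -- In the zebra the open token is at the bottom, so it is the right-hand factor of the product in
  -- `End`.
  exact congrArg _ (place_comp _ _ _)

/-! ### The inclusion on diagrams of upward strands -/

theorem inclEnd_heq {r : ℕ} (f : End (ups z false r)) :
    HEq (inclEnd z r f) ((incl z).map f) := conj_heq _ _

/-- This and the next three lemmas make the inclusion an algebra homomorphism, which reduces the
affine equalities to the generators `t` and `c`. -/
theorem inclEnd_mul {r : ℕ} (f g : End (ups z false r)) :
    inclEnd z r (f * g) = inclEnd z r f * inclEnd z r g := by
  have : (incl z).map (g ≫ f) = (incl z).map g ≫ (incl z).map f := (incl z).map_comp g f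
  rw [End.mul_def, End.mul_def, inclEnd, this]
  exact conj_comp _ _ _

theorem inclEnd_one {r : ℕ} : inclEnd z r 1 = 1 := by
  have : (incl z).map (𝟙 (ups z false r)) = 𝟙 _ := (incl z).map_id _
  rw [End.one_def, inclEnd, this]
  simp [conj]

theorem inclEnd_add {r : ℕ} (f g : End (ups z false r)) :
    inclEnd z r (f + g) = inclEnd z r f + inclEnd z r g := by
  have : (incl z).map (f + g) = (incl z).map f + (incl z).map g := (incl z).map_add f g
  rw [inclEnd, this]
  simp [conj, inclEnd]

theorem inclEnd_smul {r : ℕ} (b : k) (f : End (ups z false r)) :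
    inclEnd z r (b • f) = b • inclEnd z r f := by
  have : (incl z).map (b • f) = b • (incl z).map f := (incl z).map_smul b f
  rw [inclEnd, this]
  simp [conj, inclEnd]

variable (z) in
/-- Viewing endomorphisms as affine ones is a homomorphism of algebras. -/
def inclEndHom (r : ℕ) : End (ups z false r) →ₐ[k] End (ups z true r) :=
  AlgHom.ofLinearMap ⟨⟨inclEnd z r, inclEnd_add⟩, inclEnd_smul⟩ inclEnd_one inclEnd_mul

theorem incl_conj {X Y : QCat z} (h : X = Y) (f : X ⟶ X) :
    HEq ((incl z).map (conj h f)) ((incl z).map f) := by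
  subst h; simp [conj]

/-- The inclusion is strictly monoidal up to the identifications of objects, which a heterogeneous
equality absorbs. -/
theorem incl_tensor {X Y : QCat z} (f : X ⟶ X) (g : Y ⟶ Y) :
    HEq ((incl z).map (tensor k f g)) (tensor k ((incl z).map f) ((incl z).map g)) := by
  rw [(incl z).map_tensor]
  exact conj_heq ((incl z).obj_mul X Y).symm _

theorem incl_id_ups (m : ℕ) : HEq ((incl z).map (𝟙 (ups z false m))) (𝟙 (ups z true m)) := by
  rw [CategoryTheory.Functor.map_id]
  exact id_heq (incl_ups m)

/-- A monoidal superfunctor preserves the identity strands on both sides, so only the morphism in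
the middle is changed. Both kinds of generator, `t` on two strands and `c` on one, are instances. -/
theorem inclEnd_place {X : QCat z} {r m j : ℕ} (h : ups z false m * (X * ups z false j) =
    ups z false r) (h' : ups z true m * ((incl z).obj X * ups z true j) = ups z true r)
    (f : X ⟶ X) : inclEnd z r (place m j h f) = place m j h' ((incl z).map f) := by
  refine eq_of_heq ((inclEnd_heq _).trans ((incl_conj _ _).trans
    (HEq.trans ?_ (conj_heq _ _).symm)))
  have e1 : (incl z).obj (X * ups z false j) = (incl z).obj X * ups z true j :=
    ((incl z).obj_mul _ _).trans (congrArg _ (incl_ups j))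
  refine (incl_tensor _ _).trans (tensor_heq (incl_ups m) e1 (incl_id_ups m) ?_)
  exact (incl_tensor _ _).trans (tensor_heq rfl (incl_ups j) HEq.rfl (incl_id_ups j))

theorem inclEnd_iota_t {r : ℕ} (i : ℕ) (h : i + 1 < r) :
    inclEndHom z r (iota z false r (HC.t z false i h)) = iota z true r (HC.t z true i h) := by
  rw [iota_t, iota_t, map_neg]
  -- The inclusion takes the negative crossing to the affine negative crossing by definition; the
  -- sign in `iota` is carried along.
  exact congrArg _ (inclEnd_place (X := ob z false (up * up)) _ _ _)

theorem inclEnd_iota_c {r : ℕ} (i : Fin r) :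
    inclEndHom z r (iota z false r (HC.c z false i)) = iota z true r (HC.c z true i) := by
  rw [iota_c, iota_c]
  exact inclEnd_place (X := ob z false up) _ _ _

/-- By `HC.Jodd_succ` the odd elements are obtained from `c` by a polynomial recursion in the `t`,
so agreement on these generators propagates by induction. -/
theorem inclEnd_iota_Jodd {r : ℕ} (i : Fin r) :
    inclEndHom z r (iota z false r (HC.Jodd z false i)) = iota z true r (HC.Jodd z true i) := by
  obtain ⟨i, hi⟩ := i
  induction i with
  | zero => rw [HC.Jodd_zero, HC.Jodd_zero, inclEnd_iota_c]
  | succ i ih =>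
    rw [HC.Jodd_succ, HC.Jodd_succ]
    simp only [map_mul, map_sub, map_smul, map_one, inclEnd_iota_t, ih]

/-- Factoring `J` as `-c * Jodd` in both algebras reduces this to the odd case, without a second
induction. -/
theorem inclEnd_iota_J {r : ℕ} (i : Fin r) :
    inclEndHom z r (iota z false r (HC.J z false i)) = iota z true r (HC.J z true i) := by
  rw [HC.J_eq, HC.J_eq, map_neg, map_neg, map_neg, map_mul, map_mul, map_mul, inclEnd_iota_c,
    inclEnd_iota_Jodd]

end Ups

end Isomeric

/-! ### The Jucys–Murphy identities -/

open Isomeric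
-- Indices start at 0: `i` is the number of strands to the right of the token, one less than in the
-- English statement.
theorem mainTheorem9 {k : Type*} [CommRing k] (hk : ringChar k ≠ 2) (z : k) (r : ℕ) (i : Fin r) :
    evCollapseEnd z r (dotEnd (openToken z) i) = iota z false r (HC.Jodd z false i) ∧
    evCollapseEnd z r (dotEnd (zebra z) i) = -iota z false r (HC.J z false i) ∧
    inclEnd z r (evCollapseEnd z r (dotEnd (openToken z) i)) =
      iota z true r (HC.Jodd z true i) ∧
    inclEnd z r (evCollapseEnd z r (dotEnd (zebra z) i)) = -iota z true r (HC.J z true i) ∧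
    HC.J z false i = -(HC.c z false i * HC.Jodd z false i) ∧
    HC.J z true i = -(HC.c z true i * HC.Jodd z true i) := by
  have h : evCollapseEnd z r (dotEnd (zebra z) i) = -iota z false r (HC.J z false i) := by
    -- Both sides become the image of `c * Jodd`: the left one because the zebra splits into two
    -- tokens, the right one because `-J = c * Jodd`.
    rw [evCollapseEnd_zebra, HC.J_eq, map_neg, neg_neg, map_mul, iota_c]
  refine ⟨evCollapseEnd_openToken i, h, ?_, ?_, HC.J_eq z false i, HC.J_eq z true i⟩
  · rw [evCollapseEnd_openToken]
    exact inclEnd_iota_Jodd i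
  · rw [h]
    -- `inclEnd` underlies the algebra homomorphism `inclEndHom`, so it commutes with the sign.
    exact (map_neg (inclEndHom z r) _).trans (congrArg _ (inclEnd_iota_J i))
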